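/- **Conventions.** For a complex vector space $W$, a family $T(u)=\begin{pmatrix}A(u)&B(u)\\C(u)&D(u)\end{pmatrix}$ ($u\in\mathbb C$) of matrices of linear operators on $W$ is a representation of the QISM I algebra if $$R(u-v)\,(T(u)\otimes I)\,(I\otimes T(v))=(I\otimes T(v))\,(T(u)\otimes I)\,R(u-v),\qquad u,v\in\mathbb C,$$ where $R(u)=u+P$ and $P$ is the flip on $\mathbb C^2\otimes\mathbb C^2$. Its quantum determinant is $$\begin{aligned}\Delta(u)&=A(u-\tfrac12)D(u+\tfrac12)-C(u-\tfrac12)B(u+\tfrac12)=D(u-\tfrac12)A(u+\tfrac12)-B(u-\tfrac12)C(u+\tfrac12)\\&=D(u+\tfrac12)A(u-\tfrac12)-C(u+\tfrac12)B(u-\tfrac12)=A(u+\tfrac12)D(u-\tfrac12)-B(u+\tfrac12)C(u-\tfrac12).\end{aligned}$$ Let $\mathcal D=\{u_0+m\mid m\in\mathbb Z,\ j_-<m<j_+\}$, with $u_0\in\mathbb C$, $j_-\in\mathbb Z\cup\{-\infty\}$, $j_+\in\mathbb Z\cup\{+\infty\}$. Given vectors $F(u)\in W$ and scalar functions $\Delta_\pm$,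 we say that $T$ is *of string type on $\mathcal D$ with $F$ and $\Delta_\pm$* if: * $T$ is a QISM I representation, and for every $u\in\mathcal D$ the space $\ker C(u)$ is one-dimensional, $F(u)\ne0$ and $C(u)F(u)=0$; * for $u\in\mathcal D$ and $0\neq w\in\ker C(u)$: $A(u)w=0$ if and only if $u=u_0+j_-+1$, and $D(u)w=0$ if and only if $u=u_0+j_+-1$ (so never when $j_-$, resp. $j_+$, is infinite); * $A(u)F(u)=\Delta_-(u-\frac12)F(u-1)$ for $u\in\mathcal D$, $u\ne u_0+j_-+1$, and $D(u)F(u)=\Delta_+(u+\frac12)F(u+1)$ for $u\in\mathcal D$, $u\neq u_0+j_+-1$; * on $\mathrm{Span}\{F(v)\mid v\in\mathcal D\}$ the operator $\Delta(u)$ is the scalar $\Delta_+(u)\Delta_-(u)$ for $u\in\mathcal D\pm\frac12$, and it is $0$ for $u=u_0+j_\pm\mp\frac12$ ($j_\pm$ finite). **Type C'.** Let $W$ be the space of (complex-valued, real-)analytic functions $f$ on $(0,\infty)$ such that $f$ and all its derivatives are of at most polynomial growth as $x\to\infty$. For $f\in W$ the integral in $$(\partial_x-1)^{-1}f(x)=-e^x\int_x^\infty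 e^{-y}f(y)\,dy$$ converges absolutely, and this defines an operator on $W$ which is a two-sided inverse of $\partial_x-1$ on $W$. Let $c\in\mathbb C$. Then $$A(u)=x\partial_x-x+c-1+u,\quad B(u)=\partial_x-1,\quad C(u)=(\partial_x-1)^{-1}\bigl(x\partial_x^2+(c+u-x)\partial_x-u\bigr),\quad D(u)=\partial_x$$ act on $W$ (as does $x\partial_x^2+(c+u-x)\partial_x-u$), $B(u)$ is injective, and they form a representation of the QISM I algebra with quantum determinant $\Delta(u)=u-\frac12$. Let $F(u)(x)=\Psi(u,c+u;x)$ with $\Psi$ Tricomi's confluent hypergeometric function; then $F(u)\in W$. The representation is of string type with this $F$ and $\Delta_+(u)=-(u-\frac12)$, $\Delta_-(u)=-1$, on $\mathcal D=u_0+\mathbb Z$ for every $u_0\in\mathbb C\setminus\mathbb Z$, and on $\mathcal D=\{0,-1,-2,\dots\}$ (with $u_0=0$, $j_-=-\infty$, $j_+=1$). In the latter case $F(-n)(x)=(-1)^n\,n!\,L_n^{(c-n-1)}(x)$ is, up to a factor, a Laguerre polynomial ($n=0,1,2,\dots$). **Type C''.** Let $W$ be the space of analytic functions $f$ on $(0,\infty)$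 such that $f$ and all its derivatives tend to $0$ faster than any inverse power of $x$ as $x\to\infty$. For $f\in W$ the integral in $$\partial_x^{-1}f(x)=-\int_x^\infty f(y)\,dy$$ converges absolutely, and this defines an operator on $W$ which is a two-sided inverse of $\partial_x$ on $W$. Then $$A(u)=x\partial_x+2u,\quad B(u)=2x^{-1}\partial_x,\quad C(u)=\tfrac12\,\partial_x^{-1}\bigl(x\partial_x^2+(2u+1)\partial_x-x\bigr),\quad D(u)=x^{-1}\partial_x$$ act on $W$ (as does $x\partial_x^2+(2u+1)\partial_x-x$), $B(u)$ is injective, and they form a representation of the QISM I algebra with quantum determinant $\Delta(u)=1$. Let $F(u)(x)=x^{-u}K_u(x)$ with $K_u$ Macdonald's function (the modified Bessel function of the third kind); then $F(u)\in W$. The representation is of string type with this $F$ and $\Delta_+=\Delta_-=-1$, on $\mathcal D=u_0+\mathbb Z$ for every $u_0\in\mathbb C$. -/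

import Mathlib

open Filter Topology MeasureTheory Set
open scoped Kronecker

noncomputable section

/-! ### The QISM I algebra (with `κ = 1`) and its representations -/

section QISM

variable {W : Type*} [AddCommGroup W] [Module ℂ W]

/-- The rational `R`-matrix `R(u) = u + P`, with `P` the flip of `ℂ² ⊗ ℂ²`. -/
def rMatrix (u : ℂ) : Matrix (Fin 2 × Fin 2) (Fin 2 × Fin 2) ℂ :=
  u • 1 + Matrix.of fun p q => if p = q.swap then 1 else 0

/-- The same matrix, with scalars viewed as operators on `W`. -/
def rMatrixOp (W : Type*) [AddCommGroup W] [Module ℂ W] (u : ℂ) :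
    Matrix (Fin 2 × Fin 2) (Fin 2 × Fin 2) (Module.End ℂ W) :=
  (rMatrix u).map (algebraMap ℂ (Module.End ℂ W))

/-- A family of `2 × 2` matrices `T(u) = (A(u), B(u); C(u), D(u))` of operators on `W` is a
representation of the QISM I algebra:
`R(u-v) T⁽¹⁾(u) T⁽²⁾(v) = T⁽²⁾(v) T⁽¹⁾(u) R(u-v)` with `T⁽¹⁾ = T ⊗ I`, `T⁽²⁾ = I ⊗ T`. -/
def IsQISMIRep (T : ℂ → Matrix (Fin 2) (Fin 2) (Module.End ℂ W)) : Prop :=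
  ∀ u v : ℂ,
    rMatrixOp W (u - v) * (T u ⊗ₖ (1 : Matrix (Fin 2) (Fin 2) (Module.End ℂ W))) *
        ((1 : Matrix (Fin 2) (Fin 2) (Module.End ℂ W)) ⊗ₖ T v) =
      ((1 : Matrix (Fin 2) (Fin 2) (Module.End ℂ W)) ⊗ₖ T v) *
        (T u ⊗ₖ (1 : Matrix (Fin 2) (Fin 2) (Module.End ℂ W))) * rMatrixOp W (u - v)

/-- The quantum determinant `Δ(u) = A(u - 1/2) D(u + 1/2) - C(u - 1/2) B(u + 1/2)`. -/
def quantumDet (T : ℂ → Matrix (Fin 2) (Fin 2) (Module.End ℂ W)) (u : ℂ) : Module.End ℂ W :=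
  T (u - 1 / 2) 0 0 * T (u + 1 / 2) 1 1 - T (u - 1 / 2) 1 0 * T (u + 1 / 2) 0 1

/-- The quantum determinant, in each of its four forms, is the scalar function `q`. -/
def HasQuantumDet (T : ℂ → Matrix (Fin 2) (Fin 2) (Module.End ℂ W)) (q : ℂ → ℂ) : Prop :=
  ∀ u : ℂ,
    quantumDet T u = q u • (1 : Module.End ℂ W) ∧
    T (u - 1 / 2) 1 1 * T (u + 1 / 2) 0 0 - T (u - 1 / 2) 0 1 * T (u + 1 / 2) 1 0
      = q u • (1 : Module.End ℂ W) ∧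
    T (u + 1 / 2) 1 1 * T (u - 1 / 2) 0 0 - T (u + 1 / 2) 1 0 * T (u - 1 / 2) 0 1
      = q u • (1 : Module.End ℂ W) ∧
    T (u + 1 / 2) 0 0 * T (u - 1 / 2) 1 1 - T (u + 1 / 2) 0 1 * T (u - 1 / 2) 1 0
      = q u • (1 : Module.End ℂ W)

/-- The string `{u₀ + m | m ∈ ℤ, j₋ < m < j₊}`, where `j₋` is an integer or `-∞` and `j₊` is an
integer or `+∞`. -/
def paramString (u₀ : ℂ) (jm : WithBot ℤ) (jp : WithTop ℤ) : Set ℂ :=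
  {u | ∃ m : ℤ, jm < (m : WithBot ℤ) ∧ (m : WithTop ℤ) < jp ∧ u = u₀ + m}

/-- `u = u₀ + j₋ + 1` (with `j₋` finite): the lowest point of the string. -/
def IsLowest (u₀ : ℂ) (jm : WithBot ℤ) (u : ℂ) : Prop :=
  ∃ j : ℤ, jm = (j : WithBot ℤ) ∧ u = u₀ + j + 1

/-- `u = u₀ + j₊ - 1` (with `j₊` finite): the highest point of the string. -/
def IsHighest (u₀ : ℂ) (jp : WithTop ℤ) (u : ℂ) : Prop :=
  ∃ j : ℤ, jp = (j : WithTop ℤ) ∧ u = u₀ + j - 1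

/-- The hypotheses under which a QISM I representation shifts the parameter along the string
`{u₀ + m | j₋ < m < j₊}`, together with the choice of a nonzero `F(u)` in the kernel of `C(u)` for
every `u` in the string. -/
structure StringConditions (T : ℂ → Matrix (Fin 2) (Fin 2) (Module.End ℂ W))
    (u₀ : ℂ) (jm : WithBot ℤ) (jp : WithTop ℤ) (F : ℂ → W) : Prop where
  rep : IsQISMIRep T
  ker_one_dim : ∀ u ∈ paramString u₀ jm jp,
    Module.finrank ℂ (LinearMap.ker (T u 1 0)) = 1
  lower_iff : ∀ u ∈ paramString u₀ jm jp, ∀ w : W, w ≠ 0 → T u 1 0 w = 0 →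
    (T u 0 0 w = 0 ↔ IsLowest u₀ jm u)
  raise_iff : ∀ u ∈ paramString u₀ jm jp, ∀ w : W, w ≠ 0 → T u 1 0 w = 0 →
    (T u 1 1 w = 0 ↔ IsHighest u₀ jp u)
  F_ne_zero : ∀ u ∈ paramString u₀ jm jp, F u ≠ 0
  F_mem_ker : ∀ u ∈ paramString u₀ jm jp, T u 1 0 (F u) = 0

/-- The shift relations along the string, with given scalar factors `Δ₊`, `Δ₋`:
`A(u)F(u) = Δ₋(u - 1/2)F(u - 1)`, `D(u)F(u) = Δ₊(u + 1/2)F(u + 1)`, and the quantum determinant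
acts on the span of the `F(v)` as `Δ₊(u)Δ₋(u)`, and as `0` at the ends of the string. -/
structure StringShifts (T : ℂ → Matrix (Fin 2) (Fin 2) (Module.End ℂ W))
    (u₀ : ℂ) (jm : WithBot ℤ) (jp : WithTop ℤ) (F : ℂ → W) (Δp Δm : ℂ → ℂ) : Prop where
  lower : ∀ u ∈ paramString u₀ jm jp, ¬ IsLowest u₀ jm u →
    T u 0 0 (F u) = Δm (u - 1 / 2) • F (u - 1)
  raise : ∀ u ∈ paramString u₀ jm jp, ¬ IsHighest u₀ jp u →
    T u 1 1 (F u) = Δp (u + 1 / 2) • F (u + 1)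
  det : ∀ u : ℂ, (u - 1 / 2 ∈ paramString u₀ jm jp ∨ u + 1 / 2 ∈ paramString u₀ jm jp) →
    ∀ w ∈ Submodule.span ℂ (F '' paramString u₀ jm jp), quantumDet T u w = (Δp u * Δm u) • w
  det_end : ∀ u : ℂ, (IsLowest u₀ jm (u + 1 / 2) ∨ IsHighest u₀ jp (u - 1 / 2)) →
    ∀ w ∈ Submodule.span ℂ (F '' paramString u₀ jm jp), quantumDet T u w = 0

end QISM

/-! ### Functions on `(0, ∞)`

A complex function on `(0, ∞)` is represented by its extension by `0` to the real line. -/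

/-- The restriction of `g` to `(0, ∞)`, extended by `0`. -/
def onPos (g : ℝ → ℂ) : ℝ → ℂ := (Ioi (0 : ℝ)).indicator g

theorem iteratedDeriv_add_eventuallyEq {f g : ℝ → ℂ} (hf : AnalyticOnNhd ℝ f (Ioi 0))
    (hg : AnalyticOnNhd ℝ g (Ioi 0)) (p : ℕ) :
    iteratedDeriv p (f + g) =ᶠ[atTop] fun x => iteratedDeriv p f x + iteratedDeriv p g x := by
  filter_upwards [eventually_gt_atTop (0 : ℝ)] with x hx
  exact iteratedDeriv_add ((hf x hx).contDiffAt) ((hg x hx).contDiffAt)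

theorem iteratedDeriv_smul_eventuallyEq {f : ℝ → ℂ} (hf : AnalyticOnNhd ℝ f (Ioi 0)) (a : ℂ)
    (p : ℕ) : iteratedDeriv p (a • f) =ᶠ[atTop] fun x => a * iteratedDeriv p f x := by
  filter_upwards [eventually_gt_atTop (0 : ℝ)] with x hx
  exact iteratedDeriv_const_smul ((hf x hx).contDiffAt) a

/-- Analytic functions on `(0, ∞)` which, with all their derivatives, are of at most polynomial
growth at `∞`. -/
def polyGrowthSpace : Submodule ℂ (ℝ → ℂ) where
  carrier := {f | (∀ x ≤ 0, f x = 0) ∧ AnalyticOnNhd ℝ f (Ioi 0) ∧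
    ∀ p : ℕ, ∃ k : ℕ, iteratedDeriv p f =O[atTop] fun x : ℝ => x ^ k}
  zero_mem' := by
    refine ⟨fun _ _ => rfl, analyticOnNhd_const, fun p => ⟨0, ?_⟩⟩
    have h : iteratedDeriv p (0 : ℝ → ℂ) = fun _ => 0 := by
      ext x
      simp
    rw [h]
    exact Asymptotics.isBigO_zero _ _
  add_mem' := by
    rintro f g ⟨f0, fa, fg⟩ ⟨g0, ga, gg⟩
    refine ⟨fun x hx => by simp [f0 x hx, g0 x hx], fa.add ga, fun p => ?_⟩
    obtain ⟨k, hk⟩ := fg p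
    obtain ⟨l, hl⟩ := gg p
    have mono : ∀ m n : ℕ, m ≤ n → (fun x : ℝ => x ^ m) =O[atTop] fun x : ℝ => x ^ n := by
      intro m n hmn
      refine Asymptotics.IsBigO.of_bound 1 ?_
      filter_upwards [eventually_ge_atTop (1 : ℝ)] with x hx
      have hx0 : (0 : ℝ) ≤ x := by linarith
      rw [Real.norm_of_nonneg (pow_nonneg hx0 _), Real.norm_of_nonneg (pow_nonneg hx0 _), one_mul]
      exact pow_le_pow_right₀ hx hmn
    refine ⟨max k l, Asymptotics.IsBigO.congr' ?_
      (iteratedDeriv_add_eventuallyEq fa ga p).symm EventuallyEq.rfl⟩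
    exact (hk.trans (mono _ _ (le_max_left k l))).add (hl.trans (mono _ _ (le_max_right k l)))
  smul_mem' := by
    rintro a f ⟨f0, fa, fg⟩
    refine ⟨fun x hx => by simp [f0 x hx], fa.const_smul, fun p => ?_⟩
    obtain ⟨k, hk⟩ := fg p
    exact ⟨k, (hk.const_mul_left a).congr' (iteratedDeriv_smul_eventuallyEq fa a p).symm
      EventuallyEq.rfl⟩

/-- Analytic functions on `(0, ∞)` which, with all their derivatives, tend to `0` at `∞` faster
than any inverse power. -/
def rapidDecaySpace : Submodule ℂ (ℝ → ℂ) where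
  carrier := {f | (∀ x ≤ 0, f x = 0) ∧ AnalyticOnNhd ℝ f (Ioi 0) ∧
    ∀ p k : ℕ, Tendsto (fun x : ℝ => (x : ℂ) ^ k * iteratedDeriv p f x) atTop (𝓝 0)}
  zero_mem' := by
    refine ⟨fun _ _ => rfl, analyticOnNhd_const, fun p k => ?_⟩
    have h : iteratedDeriv p (0 : ℝ → ℂ) = fun _ => 0 := by
      ext x
      simp
    rw [h]
    simp
  add_mem' := by
    rintro f g ⟨f0, fa, fg⟩ ⟨g0, ga, gg⟩
    refine ⟨fun x hx => by simp [f0 x hx, g0 x hx], fa.add ga, fun p k => ?_⟩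
    have h := (fg p k).add (gg p k)
    rw [add_zero] at h
    refine h.congr' ?_
    filter_upwards [iteratedDeriv_add_eventuallyEq fa ga p] with x hx
    rw [hx, mul_add]
  smul_mem' := by
    rintro a f ⟨f0, fa, fg⟩
    refine ⟨fun x hx => by simp [f0 x hx], fa.const_smul, fun p k => ?_⟩
    have h := (fg p k).const_mul a
    rw [mul_zero] at h
    refine h.congr' ?_
    filter_upwards [iteratedDeriv_smul_eventuallyEq fa a p] with x hx
    rw [hx]
    ring

/-! ### The operators of type C' -/

/-- `A(u) = x∂ - x + c - 1 + u`. -/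
def opAC' (c u : ℂ) (f : ℝ → ℂ) : ℝ → ℂ :=
  onPos fun x => x * deriv f x - x * f x + (c - 1 + u) * f x

/-- `B₀ = ∂ - 1`. -/
def opBC' (f : ℝ → ℂ) : ℝ → ℂ := onPos fun x => deriv f x - f x

/-- `D(u) = ∂`. -/
def opDC' (f : ℝ → ℂ) : ℝ → ℂ := onPos (deriv f)

/-- `(∂ - 1)⁻¹ f(x) = -eˣ ∫ₓ^∞ e⁻ʸ f(y) dy`. -/
def invDerivSubOne (f : ℝ → ℂ) : ℝ → ℂ :=
  onPos fun x => -Complex.exp x * ∫ y in Ioi x, Complex.exp (-y) * f y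

/-- `x∂² + (c + u - x)∂ - u`. -/
def diffOpC' (c u : ℂ) (f : ℝ → ℂ) : ℝ → ℂ :=
  onPos fun x => x * deriv (deriv f) x + (c + u - x) * deriv f x - u * f x

/-- `C(u) = (∂ - 1)⁻¹ (x∂² + (c + u - x)∂ - u)`. -/
def opCC' (c u : ℂ) (f : ℝ → ℂ) : ℝ → ℂ := invDerivSubOne (diffOpC' c u f)

/-! ### The operators of type C'' -/

/-- `A(u) = x∂ + 2u`. -/
def opAC'' (u : ℂ) (f : ℝ → ℂ) : ℝ → ℂ := onPos fun x => x * deriv f x + 2 * u * f x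

/-- `B₀ = 2x⁻¹∂`. -/
def opBC'' (f : ℝ → ℂ) : ℝ → ℂ := onPos fun x => 2 * (x : ℂ)⁻¹ * deriv f x

/-- `D(u) = x⁻¹∂`. -/
def opDC'' (f : ℝ → ℂ) : ℝ → ℂ := onPos fun x => (x : ℂ)⁻¹ * deriv f x

/-- `∂⁻¹ f(x) = -∫ₓ^∞ f(y) dy`. -/
def invDeriv (f : ℝ → ℂ) : ℝ → ℂ := onPos fun x => -∫ y in Ioi x, f y

/-- `x∂² + (2u + 1)∂ - x`. -/
def diffOpC'' (u : ℂ) (f : ℝ → ℂ) : ℝ → ℂ :=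
  onPos fun x => x * deriv (deriv f) x + (2 * u + 1) * deriv f x - x * f x

/-- `C(u) = (1/2) ∂⁻¹ (x∂² + (2u + 1)∂ - x)`. -/
def opCC'' (u : ℂ) (f : ℝ → ℂ) : ℝ → ℂ := (1 / 2 : ℂ) • invDeriv (diffOpC'' u f)

/-! ### Special functions -/

/-- Tricomi's function `Ψ(a, c; x)`, `x > 0`, for arbitrary complex `a`, `c`. With
`g(t) = e^{-xt} (1+t)^{c-a-1}` it is `Γ(a)⁻¹ ∫₀^∞ t^{a-1} g(t) dt` for `Re a > 0`; its analytic
continuation in `a` is `(-1)^N Γ(a+N)⁻¹ ∫₀^∞ t^{a+N-1} g^{(N)}(t) dt` for any `N` such that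
`Re a + N > 0` (integration by parts). Below, `N` is the least such natural number. -/
def tricomiPsi (a c : ℂ) (x : ℝ) : ℂ :=
  (-1) ^ ⌊1 - a.re⌋₊ / Complex.Gamma (a + ⌊1 - a.re⌋₊) *
    ∫ t in Ioi (0 : ℝ), (t : ℂ) ^ (a + ⌊1 - a.re⌋₊ - 1) *
      iteratedDeriv ⌊1 - a.re⌋₊
        (fun s : ℝ => Complex.exp (-(x * s)) * (1 + (s : ℂ)) ^ (c - a - 1)) t

theorem tricomiPsi_of_re_pos {a : ℂ} (ha : 0 < a.re) (c : ℂ) (x : ℝ) :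
    tricomiPsi a c x = (Complex.Gamma a)⁻¹ * ∫ t in Ioi (0 : ℝ), (t : ℂ) ^ (a - 1) *
      (Complex.exp (-(x * t)) * (1 + (t : ℂ)) ^ (c - a - 1)) := by
  have h : ⌊1 - a.re⌋₊ = 0 := Nat.floor_eq_zero.2 (by linarith)
  simp [tricomiPsi, h]

/-- Macdonald's function (modified Bessel function of the third kind), `x > 0`:
`K_ν(x) = (1/2) (x/2)^ν ∫₀^∞ e^{-t - x²/(4t)} t^{-ν-1} dt`. -/
def macdonaldK (ν : ℂ) (x : ℝ) : ℂ :=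
  1 / 2 * ((x : ℂ) / 2) ^ ν *
    ∫ t in Ioi (0 : ℝ), Complex.exp (-t - x ^ 2 / (4 * t)) * (t : ℂ) ^ (-ν - 1)

/-- The Laguerre polynomial
`L_n^α(x) = ∑ₖ (-1)^k (α+k+1)_{n-k} x^k / (k! (n-k)!)`, for arbitrary complex `α`. -/
def laguerreL (n : ℕ) (α x : ℂ) : ℂ :=
  ∑ k ∈ Finset.range (n + 1), (-1) ^ k * (ascPochhammer ℂ (n - k)).eval (α + k + 1) /
    ((k.factorial : ℂ) * ((n - k).factorial : ℂ)) * x ^ k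

end

/-! Both families have the shape `A = a + αu`, `B = b`, `C = k + u`, `D = d` with `b = αd - s`, `[d,
a] = b` and `bk = da - r`. Since `b` is injective, every identity involving `k = b⁻¹(da - r)` can be
checked after multiplying by `b` on the left, so all the QISM I relations and the value `r + s(u +
1/2)` of the quantum determinant follow from these few identities (`isQISMIRep_and_hasQuantumDet`).
Type C' is `α = 1, r = -1, s = 1`; type C'' is `α = 2, r = 1, s = 0`.

The string conditions then reduce to analysis (`stringConditions_and_stringShifts`). If `A(u)` and
`D(u)` shift a family `F` with factors whose product is the quantum determinant, the form
`D(u-1)A(u) - B(u-1)C(u)` of the determinant gives `B(u-1)C(u)F(u) = 0`, hence `C(u)F(u) = 0`. It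
remains to prove the two shift relations, `F(u) ≠ 0`, and that `ker C(u)` is at most
one-dimensional. The last holds because `C(u)w = 0` is a second order differential equation: the
Wronskian of two solutions, times the integrating factor, is constant and by the growth conditions
tends to `0` at infinity (`exists_smul_eq_of_ode`).

The shift relations come from integration by parts in the integral representations. For type C'' the
function `x^{-u} K_u(x)` is a multiple of `∫ t^{u-1} e^{-yt-1/t} dt` at `y = x²/4`, convergent for
every `u`. For type C' the exponent of `1 + t` in the integral for `Ψ(u, c + u; x)` is `c - 1`,
independent of `u`; the relation for `A` is proved for the regularised integrals, and the one for
`D` is carried from `Re u > 0` to all `u` by `A`. -/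

noncomputable section

/-! ### Operator identities behind the QISM I relations and the string conditions. -/

section Algebra

variable {W : Type*} [AddCommGroup W] [Module ℂ W]

/-- The matrices `(a + αu, b; k + u, d)` form a representation of the QISM I algebra as soon as
their coefficients satisfy six commutation relations. -/
theorem isQISMIRep_of_linear {T : ℂ → Matrix (Fin 2) (Fin 2) (Module.End ℂ W)}
    {a b k d : Module.End ℂ W} {α : ℂ}
    (hT : ∀ u, T u = !![a + (α * u) • 1, b; k + u • 1, d])
    (hdb : d * b = b * d) (hkb : k * b = b * k - α • d) (hkd : k * d = d * k - d)
    (hab : a * b = b * a - α • b) (had : a * d = d * a - b) (hak : a * k = k * a + α • k - a) :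
    IsQISMIRep T := by
  intro u v
  rw [hT u, hT v]
  have hdb' : ∀ w, d (b w) = b (d w) := fun w => by simpa using congr($hdb w)
  have hkb' : ∀ w, k (b w) = b (k w) - α • d w := fun w => by simpa using congr($hkb w)
  have hkd' : ∀ w, k (d w) = d (k w) - d w := fun w => by simpa using congr($hkd w)
  have hab' : ∀ w, a (b w) = b (a w) - α • b w := fun w => by simpa using congr($hab w)
  have had' : ∀ w, a (d w) = d (a w) - b w := fun w => by simpa using congr($had w)
  have hak' : ∀ w, a (k w) = k (a w) + α • k w - a w := fun w => by simpa using congr($hak w)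
  refine Matrix.ext fun p q => ?_
  obtain ⟨i, j⟩ := p
  obtain ⟨l, m⟩ := q
  refine LinearMap.ext fun w => ?_
  -- The six relations serve as rewrite rules putting every word in the order `b, d, k, a`; each of
  -- the sixteen entries then becomes a linear identity.
  fin_cases i <;> fin_cases j <;> fin_cases l <;> fin_cases m <;>
    simp [rMatrixOp, rMatrix, Matrix.mul_apply, Fintype.sum_prod_type, Fin.sum_univ_two,
      Matrix.kroneckerMap_apply, Matrix.one_apply, add_mul, mul_add,
      hdb', hkb', hkd', hab', had', hak', Algebra.algebraMap_eq_smul_one] <;>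
    module

/-- After reordering, the first form equals `r + (u + 1/2)(αd - b)`, and `αd - b = s`; the other
three forms reduce in the same way. -/
theorem hasQuantumDet_of_linear {T : ℂ → Matrix (Fin 2) (Fin 2) (Module.End ℂ W)}
    {a b k d : Module.End ℂ W} {α r s : ℂ} {q : ℂ → ℂ}
    (hT : ∀ u, T u = !![a + (α * u) • 1, b; k + u • 1, d])
    (hkb : k * b = b * k - α • d) (had : a * d = d * a - b)
    (hda : d * a = b * k + r • 1) (hd : b = α • d - s • 1) (hq : ∀ u, q u = r + s * (u + 1 / 2)) :
    HasQuantumDet T q := by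
  intro u
  have h1 : ∀ w, k (b w) = b (k w) - α • d w := fun w => by simpa using congr($hkb w)
  have h2 : ∀ w, a (d w) = d (a w) - b w := fun w => by simpa using congr($had w)
  have h3 : ∀ w, d (a w) = b (k w) + r • w := fun w => by simpa using congr($hda w)
  have h4 : ∀ w, b w = α • d w - s • w := fun w => by simpa using congr($hd w)
  rw [quantumDet, hT, hT, hq]
  refine ⟨?_, ?_, ?_, ?_⟩ <;> refine LinearMap.ext fun w => ?_ <;>
    simp [add_mul, mul_add, h1, h2, h3] <;> simp only [h4] <;> module

/-- As `b` is affine in `d`, it commutes with `d` and its commutator with `a` is known. Relations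
involving `k` are compared after left multiplication by the injective `b`, where `bk` becomes `da -
r`; so no commutation rule for an inverse operator is ever needed. -/
theorem isQISMIRep_and_hasQuantumDet {T : ℂ → Matrix (Fin 2) (Fin 2) (Module.End ℂ W)}
    {a b k d : Module.End ℂ W} {α r s : ℂ} {q : ℂ → ℂ}
    (hT : ∀ u, T u = !![a + (α * u) • 1, b; k + u • 1, d]) (hb : Function.Injective b)
    (had : a * d = d * a - b) (hda : d * a = b * k + r • 1) (hd : b = α • d - s • 1)
    (hq : ∀ u, q u = r + s * (u + 1 / 2)) :
    IsQISMIRep T ∧ HasQuantumDet T q := by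
  have cancel : ∀ x y : Module.End ℂ W, b * x = b * y → x = y := fun x y h =>
    LinearMap.ext fun w => hb congr($h w)
  have hbk : b * k = d * a - r • 1 := eq_sub_of_add_eq hda.symm
  have hdb : d * b = b * d := by
    rw [hd]
    simp [mul_sub, sub_mul]
  have hab : a * b = b * a - α • b := by
    calc a * b = α • (a * d) - s • a := by rw [hd]; simp [mul_sub]
      _ = (α • d - s • 1) * a - α • b := by
        rw [had, smul_sub, sub_mul, smul_mul_assoc, smul_mul_assoc, one_mul]
        abel
      _ = b * a - α • b := by rw [← hd]
  have hkb : k * b = b * k - α • d := by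
    refine cancel _ _ ?_
    rw [mul_sub, ← mul_assoc, hbk, sub_mul, mul_assoc, hab, mul_smul_comm, mul_sub, mul_sub,
      ← mul_assoc, hdb, mul_smul_comm, hdb, smul_mul_assoc, one_mul, mul_smul_comm, mul_one,
      mul_assoc]
    abel
  have hkd : k * d = d * k - d := by
    refine cancel _ _ ?_
    rw [mul_sub, ← mul_assoc, ← mul_assoc, ← hdb, mul_assoc d b k, hbk, sub_mul, mul_assoc, had,
      mul_sub, mul_sub, smul_mul_assoc, one_mul, mul_smul_comm, mul_one]
    abel
  have hak : a * k = k * a + α • k - a := by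
    refine cancel _ _ ?_
    have h1 : b * a = a * b + α • b := by rw [hab]; abel
    rw [mul_sub, mul_add, ← mul_assoc, h1, add_mul, mul_assoc, ← mul_assoc b k a, mul_smul_comm,
      smul_mul_assoc, hbk, ← h1, mul_sub, ← mul_assoc, had, sub_mul, sub_mul, mul_smul_comm,
      smul_mul_assoc, mul_one, one_mul]
    abel
  exact ⟨isQISMIRep_of_linear hT hdb hkb hkd hab had hak,
    hasQuantumDet_of_linear hT hkb had hda hd hq⟩

/-- A family of nonzero vectors shifted along the whole complex plane by `A(u)` and `D(u)` gives a
representation of string type on every string that is infinite below. -/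
theorem stringConditions_and_stringShifts {T : ℂ → Matrix (Fin 2) (Fin 2) (Module.End ℂ W)}
    {F : ℂ → W} {q Δp Δm : ℂ → ℂ} {u₀ : ℂ} {jp : WithTop ℤ}
    (hrep : IsQISMIRep T) (hdet : HasQuantumDet T q) (hB : ∀ u, Function.Injective (T u 0 1))
    (hF : ∀ u, F u ≠ 0) (hA : ∀ u, T u 0 0 (F u) = Δm (u - 1 / 2) • F (u - 1))
    (hD : ∀ u, T u 1 1 (F u) = Δp (u + 1 / 2) • F (u + 1)) (hq : ∀ u, q u = Δp u * Δm u)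
    (hker : ∀ u, ∀ w₁ w₂ : W, w₁ ≠ 0 → T u 1 0 w₁ = 0 → T u 1 0 w₂ = 0 → ∃ z : ℂ, z • w₁ = w₂)
    (hΔm : ∀ u, Δm u ≠ 0)
    (hΔp : ∀ u ∈ paramString u₀ ⊥ jp, Δp (u + 1 / 2) = 0 ↔ IsHighest u₀ jp u)
    (hend : ∀ u, IsHighest u₀ jp (u - 1 / 2) → q u = 0) :
    StringConditions T u₀ ⊥ jp F ∧ StringShifts T u₀ ⊥ jp F Δp Δm := by
  -- The second form of the determinant at `u - 1/2` reads `D(u-1)A(u) - B(u-1)C(u)`. On `F u` the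
  -- first product already gives the whole scalar, so `B(u-1)C(u)F(u) = 0`.
  have hC : ∀ u, T u 1 0 (F u) = 0 := by
    intro u
    have h1 := congr($((hdet (u - 1 / 2)).2.1) (F u))
    have e1 : u - 1 / 2 - 1 / 2 = u - 1 := by ring
    have e2 : u - 1 / 2 + 1 / 2 = u := by ring
    have h2 := hD (u - 1)
    rw [show u - 1 + 1 / 2 = u - 1 / 2 by ring, sub_add_cancel] at h2
    simp only [e1, e2, LinearMap.sub_apply, Module.End.mul_apply, hA, map_smul, h2, smul_smul,
      LinearMap.smul_apply, Module.End.one_apply, hq, mul_comm] at h1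
    have h3 : T (u - 1) 0 1 (T u 1 0 (F u)) = 0 := by simpa using h1
    exact hB _ (h3.trans (map_zero _).symm)
  have hlow : ∀ u, ¬ IsLowest u₀ ⊥ u := by
    rintro u ⟨j, hj, -⟩
    exact WithBot.bot_ne_coe hj
  have hdet' : ∀ u w, quantumDet T u w = q u • w := fun u w => by
    rw [(hdet u).1]
    simp
  refine ⟨⟨hrep, fun u _ => ?_, fun u _ w hw hCw => ?_, fun u hu w hw hCw => ?_,
    fun u _ => hF u, fun u _ => hC u⟩, ⟨fun u _ _ => hA u, fun u _ _ => hD u,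
    fun u _ w _ => by rw [hdet', hq], fun u hu w _ => ?_⟩⟩
  · refine (finrank_eq_one_iff_of_nonzero' (⟨F u, hC u⟩ : LinearMap.ker (T u 1 0)) ?_).2 ?_
    · exact fun h => hF u congr(($h).1)
    · rintro ⟨w, hw⟩
      obtain ⟨z, hz⟩ := hker u (F u) w (hF u) (hC u) hw
      exact ⟨z, Subtype.ext hz⟩
  · refine iff_of_false (fun h => ?_) (hlow u)
    obtain ⟨z, hz⟩ := hker u w (F u) hw hCw (hC u)
    have h1 := hA u
    rw [← hz, map_smul, h, smul_zero] at h1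
    exact smul_ne_zero (hΔm _) (hF _) h1.symm
  · rw [← hΔp u hu]
    constructor
    · intro h
      obtain ⟨z, hz⟩ := hker u w (F u) hw hCw (hC u)
      have h1 := hD u
      rw [← hz, map_smul, h, smul_zero] at h1
      exact (smul_eq_zero.1 h1.symm).resolve_right (hF _)
    · intro h
      obtain ⟨z, hz⟩ := hker u (F u) w (hF u) (hC u) hCw
      rw [← hz, map_smul, hD, h, zero_smul, smul_zero]
  · rcases hu with hu | hu
    · exact absurd hu (hlow _)
    · rw [hdet', hend u hu, zero_smul]

end Algebra

/-! ### Functions on the half-line -/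

theorem onPos_of_pos (g : ℝ → ℂ) {x : ℝ} (hx : 0 < x) : onPos g x = g x :=
  indicator_of_mem (mem_Ioi.2 hx) g

theorem onPos_of_nonpos (g : ℝ → ℂ) {x : ℝ} (hx : x ≤ 0) : onPos g x = 0 :=
  indicator_of_notMem (notMem_Ioi.2 hx) g

theorem onPos_eventuallyEq_nhds (g : ℝ → ℂ) {x : ℝ} (hx : 0 < x) : onPos g =ᶠ[𝓝 x] g := by
  filter_upwards [Ioi_mem_nhds hx] with y hy using onPos_of_pos g hy

theorem onPos_eventuallyEq_atTop (g : ℝ → ℂ) : onPos g =ᶠ[atTop] g := by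
  filter_upwards [eventually_gt_atTop 0] with y hy using onPos_of_pos g hy

theorem AnalyticOnNhd.onPos {g : ℝ → ℂ} (hg : AnalyticOnNhd ℝ g (Ioi 0)) :
    AnalyticOnNhd ℝ (onPos g) (Ioi 0) :=
  fun x hx => (hg x hx).congr (onPos_eventuallyEq_nhds g hx).symm

theorem eq_of_eqOn_pos {f g : ℝ → ℂ} (hf : ∀ x ≤ 0, f x = 0) (hg : ∀ x ≤ 0, g x = 0)
    (h : ∀ x, 0 < x → f x = g x) : f = g := by
  funext x
  rcases le_or_gt x 0 with hx | hx
  · rw [hf x hx, hg x hx]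
  · exact h x hx

theorem iteratedDeriv_eventuallyEq_of_pos {f g : ℝ → ℂ} (h : ∀ x, 0 < x → f x = g x) (p : ℕ) :
    iteratedDeriv p f =ᶠ[atTop] iteratedDeriv p g := by
  filter_upwards [eventually_gt_atTop 0] with x hx
  refine Filter.EventuallyEq.iteratedDeriv_eq p ?_
  filter_upwards [Ioi_mem_nhds hx] with y hy using h y hy

/-! ### Growth classes -/

/-- At most polynomial growth. -/
def PolyBounded (g : ℝ → ℂ) : Prop := ∃ k : ℕ, g =O[atTop] fun x : ℝ => x ^ k

/-- Decay faster than any inverse power. -/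
def RapidlyDecaying (g : ℝ → ℂ) : Prop :=
  ∀ k : ℕ, Tendsto (fun x : ℝ => (x : ℂ) ^ k * g x) atTop (𝓝 0)

/-- A class of functions given by a growth condition at `∞`, stable under sums and under
multiplication by functions of at most polynomial growth. -/
structure IsGrowthClass (G : (ℝ → ℂ) → Prop) : Prop where
  zero : G fun _ => 0
  add : ∀ {f g : ℝ → ℂ}, G f → G g → G fun x => f x + g x
  congr : ∀ {f g : ℝ → ℂ}, G f → f =ᶠ[atTop] g → G g
  mul : ∀ {m f : ℝ → ℂ}, PolyBounded m → G f → G fun x => m x * f x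

theorem isBigO_pow_of_le {m n : ℕ} (h : m ≤ n) :
    (fun x : ℝ => x ^ m) =O[atTop] fun x : ℝ => x ^ n := by
  refine Asymptotics.IsBigO.of_bound 1 ?_
  filter_upwards [eventually_ge_atTop (1 : ℝ)] with x hx
  have hx0 : (0 : ℝ) ≤ x := by linarith
  rw [Real.norm_of_nonneg (pow_nonneg hx0 _), Real.norm_of_nonneg (pow_nonneg hx0 _), one_mul]
  exact pow_le_pow_right₀ hx h

theorem isGrowthClass_polyBounded : IsGrowthClass PolyBounded where
  zero := ⟨0, Asymptotics.isBigO_zero _ _⟩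
  add := by
    rintro f g ⟨k, hk⟩ ⟨l, hl⟩
    exact ⟨max k l, (hk.trans (isBigO_pow_of_le (le_max_left k l))).add
      (hl.trans (isBigO_pow_of_le (le_max_right k l)))⟩
  congr := by
    rintro f g ⟨k, hk⟩ h
    exact ⟨k, hk.congr' h EventuallyEq.rfl⟩
  mul := by
    rintro f g ⟨k, hk⟩ ⟨l, hl⟩
    refine ⟨k + l, ?_⟩
    simp only [pow_add]
    exact hk.mul hl

theorem isGrowthClass_rapidlyDecaying : IsGrowthClass RapidlyDecaying where
  zero := fun k => by simp
  add := fun hf hg k => by simpa [mul_add] using (hf k).add (hg k)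
  congr := fun hf h k => (hf k).congr' (by filter_upwards [h] with x hx; rw [hx])
  mul := by
    rintro m f ⟨l, hl⟩ hf k
    have h1 : (fun x : ℝ => (x : ℂ) ^ k * (m x * f x)) =O[atTop]
        fun x : ℝ => (x : ℂ) ^ (l + k) * f x := by
      have h2 : m =O[atTop] fun x : ℝ => (x : ℂ) ^ l := by
        refine hl.trans (Asymptotics.IsBigO.of_bound 1 (Eventually.of_forall fun x => ?_))
        simp
      have h3 := (Asymptotics.isBigO_refl (fun x : ℝ => (x : ℂ) ^ k * f x) atTop).mul h2
      refine (h3.congr_left fun x => by ring).congr_right fun x => by ring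
    exact h1.trans_tendsto (hf (l + k))

theorem polyBounded_const (a : ℂ) : PolyBounded fun _ => a :=
  ⟨0, by simpa using Asymptotics.isBigO_const_const a (one_ne_zero (α := ℝ)) atTop⟩

theorem IsGrowthClass.sum {G : (ℝ → ℂ) → Prop} (hG : IsGrowthClass G) {ι : Type*} (s : Finset ι)
    {f : ι → ℝ → ℂ} (h : ∀ i ∈ s, G (f i)) : G fun x => ∑ i ∈ s, f i x := by
  classical
  induction s using Finset.induction_on with
  | empty => simpa using hG.zero
  | insert a s ha ih =>
    simp only [Finset.sum_insert ha]
    exact hG.add (h a (Finset.mem_insert_self a s))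
      (ih fun i hi => h i (Finset.mem_insert_of_mem hi))

/-- Analytic functions on `(0, ∞)`, extended by `0`, with all derivatives in the class `G`. -/
def Stable (G : (ℝ → ℂ) → Prop) (f : ℝ → ℂ) : Prop :=
  (∀ x ≤ 0, f x = 0) ∧ AnalyticOnNhd ℝ f (Ioi 0) ∧ ∀ p : ℕ, G (iteratedDeriv p f)

theorem mem_polyGrowthSpace (f : ℝ → ℂ) : f ∈ polyGrowthSpace ↔ Stable PolyBounded f := Iff.rfl

theorem mem_rapidDecaySpace (f : ℝ → ℂ) : f ∈ rapidDecaySpace ↔ Stable RapidlyDecaying f := Iff.rfl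

/-! ### Closure of the function spaces under products and differentiation, for any growth class. -/

section Stable

variable {G : (ℝ → ℂ) → Prop}

theorem Stable.growth {f : ℝ → ℂ} (hf : Stable G f) : G f := by
  simpa using hf.2.2 0

theorem Stable.differentiableAt {f : ℝ → ℂ} (hf : Stable G f) {x : ℝ} (hx : 0 < x) :
    DifferentiableAt ℝ f x := (hf.2.1 x hx).differentiableAt

theorem Stable.hasDerivAt {f : ℝ → ℂ} (hf : Stable G f) {x : ℝ} (hx : 0 < x) :
    HasDerivAt f (deriv f x) x := (hf.differentiableAt hx).hasDerivAt

theorem Stable.deriv (hG : IsGrowthClass G) {f : ℝ → ℂ} (hf : Stable G f) :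
    Stable G (onPos (deriv f)) := by
  refine ⟨fun x hx => onPos_of_nonpos _ hx, AnalyticOnNhd.onPos hf.2.1.deriv, fun p => ?_⟩
  refine hG.congr (hf.2.2 (p + 1)) ?_
  rw [iteratedDeriv_succ']
  exact iteratedDeriv_eventuallyEq_of_pos (fun x hx => (onPos_of_pos _ hx).symm) p

/-- By Leibniz only derivatives up to order `n` enter. Keeping the hypotheses this weak lets the
induction in `stable_of_deriv` use it before the higher derivatives are controlled. -/
theorem IsGrowthClass.iteratedDeriv_mul (hG : IsGrowthClass G) {m f : ℝ → ℂ}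
    (hm : AnalyticOnNhd ℝ m (Ioi 0)) (hf : AnalyticOnNhd ℝ f (Ioi 0)) {n : ℕ}
    (hm' : ∀ i ≤ n, PolyBounded (iteratedDeriv i m)) (hf' : ∀ i ≤ n, G (iteratedDeriv i f)) :
    G (iteratedDeriv n fun x => m x * f x) := by
  have h : G fun x => ∑ i ∈ Finset.range (n + 1),
      (n.choose i : ℂ) * (iteratedDeriv i m x * iteratedDeriv (n - i) f x) :=
    hG.sum _ fun i hi => hG.mul (polyBounded_const _)
      (hG.mul (hm' i (Nat.lt_succ_iff.1 (Finset.mem_range.1 hi))) (hf' _ (Nat.sub_le n i)))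
  refine hG.congr h ?_
  filter_upwards [eventually_gt_atTop 0] with x hx
  have := _root_.iteratedDeriv_mul (n := n) (hm x hx).contDiffAt (hf x hx).contDiffAt
  rw [show (fun x => m x * f x) = m * f from rfl, this]
  simp only [mul_assoc]

theorem Stable.mul (hG : IsGrowthClass G) {m f : ℝ → ℂ} (hm : Stable PolyBounded m)
    (hf : Stable G f) : Stable G fun x => m x * f x :=
  ⟨fun x hx => by simp only [hf.1 x hx, mul_zero], hm.2.1.mul hf.2.1, fun _ =>
    hG.iteratedDeriv_mul hm.2.1 hf.2.1 (fun i _ => hm.2.2 i) fun i _ => hf.2.2 i⟩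

/-- A family of functions of class `G` whose derivatives are expressed through the family. -/
theorem stable_of_deriv (hG : IsGrowthClass G) {ι : Type*} {F m h : ι → ℝ → ℂ} {σ : ι → ι}
    (h0 : ∀ i, ∀ x ≤ 0, F i x = 0) (ha : ∀ i, AnalyticOnNhd ℝ (F i) (Ioi 0)) (hF : ∀ i, G (F i))
    (hm : ∀ i, Stable PolyBounded (m i)) (hh : ∀ i, Stable G (h i))
    (hd : ∀ i x, 0 < x → deriv (F i) x = m i x * F (σ i) x + h i x) (i : ι) : Stable G (F i) := by
  -- The induction is on the order of differentiation, uniformly in the index, because one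
  -- derivative moves `i` to `σ i`.
  suffices H : ∀ n : ℕ, ∀ p ≤ n, ∀ i, G (iteratedDeriv p (F i)) from
    ⟨h0 i, ha i, fun p => H p p le_rfl i⟩
  intro n
  induction n with
  | zero =>
    intro p hp i
    rw [Nat.le_zero.1 hp, iteratedDeriv_zero]
    exact hF i
  | succ n ih =>
    intro p hp i
    rcases Nat.of_le_succ hp with hp | rfl
    · exact ih p hp i
    have h1 := hG.add (hG.iteratedDeriv_mul (hm i).2.1 (ha (σ i)) (n := n)
      (fun j _ => (hm i).2.2 j) fun j hj => ih j hj (σ i)) ((hh i).2.2 n)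
    refine hG.congr h1 ?_
    rw [iteratedDeriv_succ']
    refine EventuallyEq.trans ?_
      (iteratedDeriv_eventuallyEq_of_pos (fun x hx => (hd i x hx).symm) n)
    exact (iteratedDeriv_add_eventuallyEq ((hm i).2.1.mul (ha (σ i))) (hh i).2.1 n).symm

theorem stable_zero (hG : IsGrowthClass G) : Stable G fun _ => 0 :=
  ⟨fun _ _ => rfl, analyticOnNhd_const, fun p => by
    have h : iteratedDeriv p (fun _ : ℝ => (0 : ℂ)) = fun _ => 0 := by
      ext x
      simp
    rw [h]
    exact hG.zero⟩

end Stable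

theorem stable_const (a : ℂ) : Stable PolyBounded (onPos fun _ => a) := by
  have hz := stable_zero isGrowthClass_polyBounded
  refine stable_of_deriv isGrowthClass_polyBounded (ι := Unit) (F := fun _ => onPos fun _ => a)
    (m := fun _ _ => 0) (h := fun _ _ => 0) (σ := id)
    (fun _ x hx => onPos_of_nonpos _ hx) (fun _ => analyticOnNhd_const.onPos) (fun _ => ?_)
    (fun _ => hz) (fun _ => hz) (fun _ x hx => ?_) ()
  · exact isGrowthClass_polyBounded.congr (polyBounded_const a) (onPos_eventuallyEq_atTop _).symm
  · rw [(onPos_eventuallyEq_nhds _ hx).deriv_eq]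
    simp

theorem stable_id : Stable PolyBounded (onPos fun x => (x : ℂ)) := by
  have hz := stable_zero isGrowthClass_polyBounded
  refine stable_of_deriv isGrowthClass_polyBounded (ι := Unit)
    (F := fun _ => onPos fun x => (x : ℂ)) (m := fun _ _ => 0)
    (h := fun _ => onPos fun _ => 1) (σ := id)
    (fun _ x hx => onPos_of_nonpos _ hx)
    (fun _ => AnalyticOnNhd.onPos fun x _ => Complex.ofRealCLM.analyticAt x) (fun _ => ?_)
    (fun _ => hz) (fun _ => stable_const 1) (fun _ x hx => ?_) ()
  · refine isGrowthClass_polyBounded.congr ⟨1, ?_⟩ (onPos_eventuallyEq_atTop _).symm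
    refine Asymptotics.IsBigO.of_bound 1 (Eventually.of_forall fun x => ?_)
    simp
  · rw [(onPos_eventuallyEq_nhds _ hx).deriv_eq, onPos_of_pos _ hx, zero_mul, zero_add,
      onPos_of_pos _ hx]
    exact (Complex.ofRealCLM.hasDerivAt (x := x)).deriv.trans (by simp)

theorem stable_inv : Stable PolyBounded (onPos fun x => (x : ℂ)⁻¹) := by
  have hz := stable_zero isGrowthClass_polyBounded
  -- All powers are treated together, since differentiation takes the `n`-th to a multiple of the
  -- next one.
  have key : ∀ n : ℕ, Stable PolyBounded (onPos fun x => ((x : ℂ)⁻¹) ^ n) := by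
    refine stable_of_deriv isGrowthClass_polyBounded
      (m := fun n => onPos fun _ => -(n : ℂ)) (h := fun _ _ => 0) (σ := fun n => n + 1)
      (fun _ x hx => onPos_of_nonpos _ hx)
      (fun n => AnalyticOnNhd.onPos fun x hx => ?_) (fun n => ?_)
      (fun n => stable_const _) (fun _ => hz) (fun n x hx => ?_)
    · exact ((Complex.ofRealCLM.analyticAt x).inv
        (by simpa using (mem_Ioi.1 hx).ne')).pow n
    · refine isGrowthClass_polyBounded.congr ⟨0, ?_⟩ (onPos_eventuallyEq_atTop _).symm
      refine Asymptotics.IsBigO.of_bound 1 ?_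
      filter_upwards [eventually_ge_atTop 1] with x hx
      simp only [norm_pow, norm_inv, Complex.norm_real, Real.norm_eq_abs, pow_zero, norm_one,
        mul_one]
      exact pow_le_one₀ (by positivity) (inv_le_one_of_one_le₀ (hx.trans (le_abs_self x)))
    · have hx' : (x : ℂ) ≠ 0 := by exact_mod_cast hx.ne'
      rw [(onPos_eventuallyEq_nhds _ hx).deriv_eq, onPos_of_pos _ hx, onPos_of_pos _ hx]
      have h1 : HasDerivAt (fun x : ℝ => ((x : ℂ)⁻¹) ^ n)
          (n * ((x : ℂ)⁻¹) ^ (n - 1) * (-1 / (x : ℂ) ^ 2)) x := by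
        have h := (Complex.ofRealCLM.hasDerivAt (x := x)).fun_inv hx'
        exact h.fun_pow n
      rw [h1.deriv]
      rcases n with _ | n
      · simp
      · simp only [Nat.add_sub_cancel, pow_succ]
        field_simp
        simp
  simpa using key 1

/-! ### Primitives of real-analytic functions -/

/-- A primitive of a complex-valued real-analytic function is real-analytic. -/
theorem analyticAt_of_hasDerivAt {f F : ℝ → ℂ} {x : ℝ} (hf : AnalyticAt ℝ f x)
    (hF : ∀ᶠ y in 𝓝 x, HasDerivAt F (f y) y) : AnalyticAt ℝ F x := by
  obtain ⟨p, r, hp⟩ := hf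
  obtain ⟨ε, hε, hFε⟩ := Metric.eventually_nhds_iff_ball.1 hF
  -- The series with the same coefficients in a complex variable extends `f` holomorphically to a
  -- disc. A holomorphic primitive exists there, and its restriction to the reals differs from `F`
  -- by a constant.
  set q : FormalMultilinearSeries ℂ ℂ ℂ := FormalMultilinearSeries.ofScalars ℂ p.coeff with hq
  have hqr : q.radius = p.radius := by
    have : ∀ n, ‖q n‖ = ‖p n‖ := fun n => by
      rw [FormalMultilinearSeries.norm_apply_eq_norm_coef,
        FormalMultilinearSeries.norm_apply_eq_norm_coef, hq,
        FormalMultilinearSeries.coeff_ofScalars]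
    simp only [FormalMultilinearSeries.radius, this]
  have hqpos : 0 < q.radius := hqr ▸ hp.r_pos.trans_le hp.r_le
  have hqs := q.hasFPowerSeriesOnBall hqpos
  obtain ⟨ρ, hρ0, hρ⟩ : ∃ ρ : ℝ, 0 < ρ ∧ ENNReal.ofReal ρ < min r (ENNReal.ofReal ε) := by
    have h0 : 0 < min r (ENNReal.ofReal ε) := lt_min hp.r_pos (ENNReal.ofReal_pos.2 hε)
    obtain ⟨c, hc0, hc⟩ := ENNReal.lt_iff_exists_nnreal_btwn.1 h0
    exact ⟨c, by exact_mod_cast hc0, by simpa using hc⟩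
  have hρr : ENNReal.ofReal ρ < r := hρ.trans_le (min_le_left _ _)
  have hρε : ρ < ε := (ENNReal.ofReal_lt_ofReal_iff hε).1 (hρ.trans_le (min_le_right _ _))
  have hdiff : DifferentiableOn ℂ q.sum (Metric.ball 0 ρ) := by
    intro z hz
    have hz' : z ∈ Metric.eball (0 : ℂ) q.radius := by
      rw [← Metric.eball_ofReal] at hz
      exact Metric.eball_subset_eball (hρr.le.trans (hp.r_le.trans hqr.ge)) hz
    exact (hqs.analyticAt_of_mem hz').differentiableAt.differentiableWithinAt
  obtain ⟨P, hP⟩ := hdiff.isExactOn_ball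
  have hsum : ∀ y ∈ Metric.ball x ρ, q.sum ((y - x : ℝ) : ℂ) = f y := by
    intro y hy
    have hy1 : y - x ∈ Metric.eball (0 : ℝ) r := by
      have : y - x ∈ Metric.ball (0 : ℝ) ρ := by
        simpa [Real.dist_eq] using hy
      rw [← Metric.eball_ofReal] at this
      exact Metric.eball_subset_eball hρr.le this
    have hy2 : ((y - x : ℝ) : ℂ) ∈ Metric.eball (0 : ℂ) q.radius := by
      have : ((y - x : ℝ) : ℂ) ∈ Metric.ball (0 : ℂ) ρ := by
        rw [mem_ball_zero_iff, Complex.norm_real]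
        simpa [Real.dist_eq] using hy
      rw [← Metric.eball_ofReal] at this
      exact Metric.eball_subset_eball (hρr.le.trans (hp.r_le.trans hqr.ge)) this
    have h1 := hp.hasSum hy1
    have h2 := hqs.hasSum hy2
    rw [zero_add] at h2
    rw [add_sub_cancel] at h1
    refine h2.unique (h1.congr_fun fun n => ?_)
    simp [hq, FormalMultilinearSeries.coeff_ofScalars]
  have hmem : ∀ y ∈ Metric.ball x ρ, ((y - x : ℝ) : ℂ) ∈ Metric.ball (0 : ℂ) ρ := by
    intro y hy
    rw [mem_ball_zero_iff, Complex.norm_real]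
    simpa [Real.dist_eq] using hy
  have hPd : ∀ y ∈ Metric.ball x ρ,
      HasDerivAt (fun y : ℝ => P ((y - x : ℝ) : ℂ)) (f y) y := by
    intro y hy
    have h1 := hP _ (hmem y hy)
    rw [hsum y hy] at h1
    have h2 : HasDerivAt (fun y : ℝ => ((y - x : ℝ) : ℂ)) 1 y := by
      simpa using ((hasDerivAt_id y).sub_const x).ofReal_comp
    have h3 := h1.comp y h2
    rw [mul_one] at h3
    exact h3
  have hconst : ∀ y ∈ Metric.ball x ρ, F y - P ((y - x : ℝ) : ℂ) = F x - P ((x - x : ℝ) : ℂ) := by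
    intro y hy
    refine (convex_ball x ρ).is_const_of_fderivWithin_eq_zero (𝕜 := ℝ)
      (f := fun y => F y - P ((y - x : ℝ) : ℂ)) ?_ ?_ hy (Metric.mem_ball_self hρ0)
    · intro z hz
      exact ((hFε z (Metric.ball_subset_ball hρε.le hz)).sub
        (hPd z hz)).differentiableAt.differentiableWithinAt
    · intro z hz
      have h1 := (hFε z (Metric.ball_subset_ball hρε.le hz)).fun_sub (hPd z hz)
      rw [sub_self] at h1
      rw [fderivWithin_of_isOpen Metric.isOpen_ball hz]
      have h2 := h1.hasFDerivAt.fderiv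
      simpa using h2
  have hPan : AnalyticAt ℝ (fun y : ℝ => P ((y - x : ℝ) : ℂ)) x := by
    have h1 : AnalyticAt ℂ P ((x - x : ℝ) : ℂ) := by
      have h2 : DifferentiableOn ℂ P (Metric.ball 0 ρ) :=
        fun z hz => (hP z hz).differentiableAt.differentiableWithinAt
      exact h2.analyticAt (Metric.isOpen_ball.mem_nhds (hmem x (Metric.mem_ball_self hρ0)))
    have h3 : AnalyticAt ℝ (fun y : ℝ => ((y - x : ℝ) : ℂ)) x :=
      (Complex.ofRealCLM.analyticAt _).comp (analyticAt_id.sub analyticAt_const)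
    exact h1.restrictScalars.comp (f := fun y : ℝ => ((y - x : ℝ) : ℂ)) h3
  refine (hPan.add (analyticAt_const (v := F x - P ((x - x : ℝ) : ℂ)))).congr ?_
  filter_upwards [Metric.ball_mem_nhds x hρ0] with y hy
  rw [Pi.add_apply, ← hconst y hy]
  ring

/-! ### The inverse of `∂ - μ` -/

/-- `-e^{μx} ∫ₓ^∞ e^{-μy} f(y) dy`. -/
def invDerivSub (μ : ℂ) (f : ℝ → ℂ) : ℝ → ℂ :=
  onPos fun x => -Complex.exp (μ * x) * ∫ y in Ioi x, Complex.exp (-(μ * y)) * f y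

/-- Both inverse operators of the theorem are instances of `invDerivSub`, with `μ = 1` and `μ = 0`,
so differentiability and analyticity are proved once. -/
theorem invDerivSubOne_eq (f : ℝ → ℂ) : invDerivSubOne f = invDerivSub 1 f := by
  simp [invDerivSubOne, invDerivSub]

theorem invDeriv_eq (f : ℝ → ℂ) : invDeriv f = invDerivSub 0 f := by
  simp [invDeriv, invDerivSub]

section InvDerivSub

variable {μ : ℂ} {f : ℝ → ℂ}

theorem hasDerivAt_exp_mul (μ : ℂ) (x : ℝ) :
    HasDerivAt (fun x : ℝ => Complex.exp (μ * x)) (μ * Complex.exp (μ * x)) x := by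
  have h := ((Complex.ofRealCLM.hasDerivAt (x := x)).const_mul μ).cexp
  simpa [mul_comm] using h

theorem analyticAt_exp_mul (μ : ℂ) (x : ℝ) :
    AnalyticAt ℝ (fun x : ℝ => Complex.exp (μ * x)) x :=
  (analyticAt_cexp.restrictScalars (𝕜 := ℝ)).comp
    (f := fun x : ℝ => μ * (x : ℂ)) (analyticAt_const.mul (Complex.ofRealCLM.analyticAt x))

theorem hasDerivAt_integral_Ioi {g : ℝ → ℂ} (hg : ContinuousOn g (Ioi 0))
    (hi : ∀ x, 0 < x → IntegrableOn g (Ioi x)) {x : ℝ} (hx : 0 < x) :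
    HasDerivAt (fun x => ∫ y in Ioi x, g y) (-g x) x := by
  have hx2 : 0 < x / 2 := by linarith
  have h1 : HasDerivAt (fun z => ∫ y in x / 2..z, g y) (g x) x := by
    refine intervalIntegral.integral_hasDerivAt_right ?_ ?_ ?_
    · rw [intervalIntegrable_iff_integrableOn_Ioc_of_le (by linarith)]
      exact (hi _ hx2).mono_set Ioc_subset_Ioi_self
    · exact hg.stronglyMeasurableAtFilter isOpen_Ioi x hx
    · exact hg.continuousAt (Ioi_mem_nhds hx)
  refine (h1.const_sub (∫ y in Ioi (x / 2), g y)).congr_of_eventuallyEq ?_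
  filter_upwards [Ioi_mem_nhds (show x / 2 < x by linarith)] with z hz
  rw [← intervalIntegral.integral_Ioi_sub_Ioi (hi _ hx2) (le_of_lt hz), sub_sub_cancel]

theorem hasDerivAt_invDerivSub (hf : ContinuousOn f (Ioi 0))
    (hi : ∀ x : ℝ, 0 < x → IntegrableOn (fun y : ℝ => Complex.exp (-(μ * y)) * f y) (Ioi x))
    {x : ℝ} (hx : 0 < x) :
    HasDerivAt (invDerivSub μ f) (μ * invDerivSub μ f x + f x) x := by
  have hc : ContinuousOn (fun y : ℝ => Complex.exp (-(μ * y)) * f y) (Ioi 0) :=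
    ContinuousOn.mul (by fun_prop) hf
  have h1 := (hasDerivAt_exp_mul μ x).neg.mul (hasDerivAt_integral_Ioi hc hi hx)
  refine (h1.congr_of_eventuallyEq (onPos_eventuallyEq_nhds _ hx)).congr_deriv ?_
  have h2 : Complex.exp (μ * x) * Complex.exp (-(μ * x)) = 1 := by
    rw [← Complex.exp_add, add_neg_cancel, Complex.exp_zero]
  rw [invDerivSub, onPos_of_pos _ hx]
  simp only [Pi.neg_apply]
  linear_combination f x * h2

theorem analyticOnNhd_invDerivSub (hf : AnalyticOnNhd ℝ f (Ioi 0))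
    (hi : ∀ x : ℝ, 0 < x → IntegrableOn (fun y : ℝ => Complex.exp (-(μ * y)) * f y) (Ioi x)) :
    AnalyticOnNhd ℝ (invDerivSub μ f) (Ioi 0) := by
  refine AnalyticOnNhd.onPos fun x hx => ?_
  have ha : AnalyticOnNhd ℝ (fun y : ℝ => Complex.exp (-(μ * y)) * f y) (Ioi 0) := by
    intro y hy
    have := analyticAt_exp_mul (-μ) y
    simp only [neg_mul] at this
    exact this.mul (hf y hy)
  refine (analyticAt_exp_mul μ x).neg.mul (analyticAt_of_hasDerivAt (ha x hx).neg ?_)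
  filter_upwards [Ioi_mem_nhds hx] with y hy
  exact hasDerivAt_integral_Ioi ha.continuousOn hi hy

/-- The derivative of `e^{-μy} g(y)` is `e^{-μy} f(y)`, so the integral is a boundary term. The
limit hypothesis is what excludes the solutions `e^{μx}` of the homogeneous equation. -/
theorem invDerivSub_of_hasDerivAt {g : ℝ → ℂ} (hg0 : ∀ x ≤ 0, g x = 0)
    (hf : ∀ x, 0 < x → HasDerivAt g (μ * g x + f x) x)
    (hi : ∀ x : ℝ, 0 < x → IntegrableOn (fun y : ℝ => Complex.exp (-(μ * y)) * f y) (Ioi x))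
    (hlim : Tendsto (fun x : ℝ => Complex.exp (-(μ * x)) * g x) atTop (𝓝 0)) :
    invDerivSub μ f = g := by
  refine eq_of_eqOn_pos (fun x hx => onPos_of_nonpos _ hx) hg0 fun x hx => ?_
  have h1 : ∀ y ∈ Ici x, HasDerivAt (fun y : ℝ => Complex.exp (-(μ * y)) * g y)
      (Complex.exp (-(μ * y)) * f y) y := by
    intro y hy
    have h := (hasDerivAt_exp_mul (-μ) y).mul (hf y (hx.trans_le hy))
    simp only [neg_mul] at h
    refine h.congr_deriv ?_
    ring
  have h2 := integral_Ioi_of_hasDerivAt_of_tendsto' h1 (hi x hx) hlim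
  have h3 : Complex.exp (μ * x) * Complex.exp (-(μ * x)) = 1 := by
    rw [← Complex.exp_add, add_neg_cancel, Complex.exp_zero]
  rw [invDerivSub, onPos_of_pos _ hx, h2]
  linear_combination g x * h3

end InvDerivSub

/-! ### Invertibility of `∂ - 1` and `∂` -/

theorem polyBounded_mul_exp_isBigO {f : ℝ → ℂ} (hf : PolyBounded f) :
    (fun y : ℝ => Complex.exp (-y) * f y) =O[atTop] fun y : ℝ => Real.exp (-(1 / 2) * y) := by
  obtain ⟨k, hk⟩ := hf
  have h1 := hk.trans (isLittleO_pow_exp_pos_mul_atTop k (b := 1 / 2) (by norm_num)).isBigO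
  have h2 : (fun y : ℝ => Complex.exp (-y)) =O[atTop] fun y : ℝ => Real.exp (-y) :=
    Asymptotics.IsBigO.of_bound 1 (Eventually.of_forall fun y => by
      rw [Complex.norm_exp, Real.norm_of_nonneg (Real.exp_pos _).le]
      simp)
  refine (h2.mul h1).congr_right fun y => ?_
  rw [← Real.exp_add]
  ring_nf

theorem Stable.integrableOn_exp_mul {f : ℝ → ℂ} (hf : Stable PolyBounded f) {x : ℝ} (hx : 0 < x) :
    IntegrableOn (fun y : ℝ => Complex.exp (-y) * f y) (Ioi x) := by
  have hc : ContinuousOn (fun y : ℝ => Complex.exp (-y) * f y) (Ici x) :=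
    ContinuousOn.mul (by fun_prop)
      (hf.2.1.continuousOn.mono fun y hy => hx.trans_le (mem_Ici.1 hy))
  exact integrableOn_Ici_iff_integrableOn_Ioi (by finiteness) |>.mp <|
    (hc.locallyIntegrableOn measurableSet_Ici).integrableOn_of_isBigO_atTop
      (polyBounded_mul_exp_isBigO hf.growth)
      ⟨Ioi 0, Ioi_mem_atTop 0, exp_neg_integrableOn_Ioi 0 (by norm_num)⟩

/-- A nonnegative derivative whose primitive has a limit at infinity is integrable, so one explicit
primitive yields both the integrable majorant and the bound. -/
theorem norm_integral_Ioi_le_of_hasDerivAt {h : ℝ → ℂ} {g g' : ℝ → ℝ} {x : ℝ}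
    (hd : ∀ y ∈ Ici x, HasDerivAt g (g' y) y) (hle : ∀ y ∈ Ioi x, ‖h y‖ ≤ g' y)
    (hg : Tendsto g atTop (𝓝 0)) : ‖∫ y in Ioi x, h y‖ ≤ -g x := by
  have hpos : ∀ y ∈ Ioi x, 0 ≤ g' y := fun y hy => (norm_nonneg _).trans (hle y hy)
  have h1 := integral_Ioi_of_hasDerivAt_of_nonneg' hd hpos hg
  rw [zero_sub] at h1
  rw [← h1]
  refine norm_integral_le_of_norm_le (integrableOn_Ioi_deriv_of_nonneg' hd hpos hg) ?_
  filter_upwards [ae_restrict_mem measurableSet_Ioi] with y hy using hle y hy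

/-- For large `y` the integrand is dominated by the derivative of `-2M e^{-y} y^k`, whose integral
over the tail is exactly `2M e^{-x} x^k`. -/
theorem polyBounded_invDerivSubOne {f : ℝ → ℂ} (hf : PolyBounded f) :
    PolyBounded (invDerivSubOne f) := by
  obtain ⟨k, hk⟩ := hf
  obtain ⟨M, hM0, hM⟩ := hk.exists_pos
  rw [Asymptotics.IsBigOWith] at hM
  obtain ⟨X, hX⟩ := eventually_atTop.1 hM
  refine ⟨k, Asymptotics.IsBigO.of_bound (2 * M) ?_⟩
  -- Beyond `2k` one has `k y^{k-1} ≤ y^k / 2`, which is why the factor `2` in front of `M`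
  -- suffices.
  filter_upwards [eventually_ge_atTop X, eventually_ge_atTop (2 * k : ℝ),
    eventually_gt_atTop 0] with x hxX hxk hx0
  have hd : ∀ y ∈ Ici x, HasDerivAt (fun y : ℝ => -(2 * M) * (Real.exp (-y) * y ^ k))
      ((2 * M) * (Real.exp (-y) * (y ^ k - k * y ^ (k - 1)))) y := by
    intro y _
    refine ((((hasDerivAt_neg y).exp.mul (hasDerivAt_pow k y))).const_mul (-(2 * M))).congr_deriv ?_
    ring
  have hle : ∀ y ∈ Ioi x, ‖Complex.exp (-y) * f y‖ ≤
      (2 * M) * (Real.exp (-y) * (y ^ k - k * y ^ (k - 1))) := by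
    intro y hy
    have hy' : x < y := hy
    have hy0 : 0 < y := hx0.trans hy'
    have h1 := hX y (hxX.trans hy'.le)
    rw [Real.norm_of_nonneg (pow_nonneg hy0.le k)] at h1
    have h2 : 2 * (k * y ^ (k - 1)) ≤ y ^ k := by
      rcases k with _ | k
      · simp
      · rw [Nat.add_sub_cancel, pow_succ, ← mul_assoc, mul_comm _ y]
        exact mul_le_mul_of_nonneg_right (hxk.trans hy'.le) (pow_nonneg hy0.le k)
    have h3 : ‖Complex.exp (-(y : ℂ))‖ = Real.exp (-y) := by
      rw [Complex.norm_exp]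
      simp
    rw [norm_mul, h3]
    have h4 : M * y ^ k ≤ (2 * M) * (y ^ k - k * y ^ (k - 1)) := by nlinarith
    calc Real.exp (-y) * ‖f y‖ ≤ Real.exp (-y) * ((2 * M) * (y ^ k - k * y ^ (k - 1))) :=
          mul_le_mul_of_nonneg_left (h1.trans h4) (Real.exp_pos _).le
      _ = _ := by ring
  have hlim : Tendsto (fun y : ℝ => -(2 * M) * (Real.exp (-y) * y ^ k)) atTop (𝓝 0) := by
    have := (Real.tendsto_pow_mul_exp_neg_atTop_nhds_zero k).const_mul (-(2 * M))
    simpa [mul_comm] using this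
  have h5 := norm_integral_Ioi_le_of_hasDerivAt hd hle hlim
  have h6 : ‖-Complex.exp (x : ℂ)‖ = Real.exp x := by
    rw [norm_neg, Complex.norm_exp, Complex.ofReal_re]
  rw [invDerivSubOne, onPos_of_pos _ hx0, norm_mul, h6, Real.norm_of_nonneg (pow_nonneg hx0.le k)]
  calc Real.exp x * ‖∫ y in Ioi x, Complex.exp (-y) * f y‖
      ≤ Real.exp x * -(-(2 * M) * (Real.exp (-x) * x ^ k)) :=
        mul_le_mul_of_nonneg_left h5 (Real.exp_pos _).le
    _ = (2 * M * x ^ k) * (Real.exp x * Real.exp (-x)) := by ring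
    _ = 2 * M * x ^ k := by rw [← Real.exp_add, add_neg_cancel, Real.exp_zero, mul_one]

theorem RapidlyDecaying.isBigO_rpow {f : ℝ → ℂ} (hf : RapidlyDecaying f) :
    f =O[atTop] fun y : ℝ => y ^ (-2 : ℝ) := by
  refine Asymptotics.IsBigO.of_bound 1 ?_
  filter_upwards [(hf 2).norm.eventually_le_const (u := 1) (by simp),
    eventually_gt_atTop 0] with y hy hy0
  have h2 : y ^ (-2 : ℝ) = (y ^ 2)⁻¹ := by
    rw [Real.rpow_neg hy0.le]
    norm_cast
  rw [norm_mul, norm_pow, Complex.norm_real, Real.norm_of_nonneg hy0.le] at hy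
  rw [h2, Real.norm_of_nonneg (by positivity), one_mul, ← one_div, le_div_iff₀ (by positivity)]
  linarith

theorem integrableOn_of_rapidlyDecaying {f : ℝ → ℂ} (hc : ContinuousOn f (Ioi 0))
    (hf : RapidlyDecaying f) {x : ℝ} (hx : 0 < x) : IntegrableOn f (Ioi x) := by
  refine integrableOn_Ici_iff_integrableOn_Ioi (by finiteness) |>.mp <|
    ((hc.mono fun y hy => hx.trans_le (mem_Ici.1 hy)).locallyIntegrableOn
      measurableSet_Ici).integrableOn_of_isBigO_atTop hf.isBigO_rpow
      ⟨Ioi 1, Ioi_mem_atTop 1, integrableOn_Ioi_rpow_of_lt (by norm_num) one_pos⟩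

/-- On the tail `x^k ≤ y^k`, so `x^k` times the integral is at most the tail of the convergent
integral of `y^k |f(y)|`. -/
theorem rapidlyDecaying_invDeriv {f : ℝ → ℂ} (hc : ContinuousOn f (Ioi 0))
    (hf : RapidlyDecaying f) : RapidlyDecaying (invDeriv f) := by
  intro k
  have hd : RapidlyDecaying fun y : ℝ => (y : ℂ) ^ k * f y := fun l => by
    refine (hf (l + k)).congr fun y => ?_
    ring
  have hi : IntegrableOn (fun y : ℝ => ‖(y : ℂ) ^ k * f y‖) (Ioi 1) :=
    (integrableOn_of_rapidlyDecaying (x := 1)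
      (ContinuousOn.mul (by fun_prop) hc) hd one_pos).norm
  have h0 : Tendsto (fun x : ℝ => ∫ y in Ioi x, ‖(y : ℂ) ^ k * f y‖) atTop (𝓝 0) :=
    tendsto_integral_Ioi_zero tendsto_id
  refine squeeze_zero_norm' ?_ h0
  filter_upwards [eventually_ge_atTop 1] with x hx
  have hx0 : 0 < x := by linarith
  rw [invDeriv, onPos_of_pos _ hx0, mul_neg, norm_neg, ← integral_const_mul]
  refine norm_integral_le_of_norm_le (hi.mono_set (Ioi_subset_Ioi hx)) ?_
  filter_upwards [ae_restrict_mem measurableSet_Ioi] with y hy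
  have hy' : x < y := hy
  simp only [norm_mul, norm_pow, Complex.norm_real, Real.norm_eq_abs]
  rw [abs_of_pos hx0, abs_of_pos (hx0.trans hy')]
  gcongr

/-- The result `g` satisfies `g' = μg + f`, so growth of `g` itself controls all its derivatives
through `stable_of_deriv`. -/
theorem stable_invDerivSub {G : (ℝ → ℂ) → Prop} (hG : IsGrowthClass G) {f : ℝ → ℂ} {μ : ℂ}
    (hf : Stable G f)
    (hi : ∀ x : ℝ, 0 < x → IntegrableOn (fun y : ℝ => Complex.exp (-(μ * y)) * f y) (Ioi x))
    (hg : G (invDerivSub μ f)) : Stable G (invDerivSub μ f) := by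
  refine stable_of_deriv hG (ι := Unit) (F := fun _ => invDerivSub μ f)
    (m := fun _ => onPos fun _ => μ) (h := fun _ => f) (σ := id)
    (fun _ x hx => onPos_of_nonpos _ hx) (fun _ => analyticOnNhd_invDerivSub hf.2.1 hi)
    (fun _ => hg) (fun _ => stable_const μ) (fun _ => hf) (fun _ x hx => ?_) ()
  rw [(hasDerivAt_invDerivSub hf.2.1.continuousOn hi hx).deriv, onPos_of_pos _ hx]

theorem invDerivSubOne_spec {f : ℝ → ℂ} (hf : Stable PolyBounded f) :
    Stable PolyBounded (invDerivSubOne f) ∧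
      opBC' (invDerivSubOne f) = f ∧ invDerivSubOne (opBC' f) = f := by
  have hi : ∀ g, Stable PolyBounded g → ∀ x : ℝ, 0 < x →
      IntegrableOn (fun y : ℝ => Complex.exp (-((1 : ℂ) * y)) * g y) (Ioi x) := fun g hg x hx => by
    simpa using hg.integrableOn_exp_mul hx
  have hG := isGrowthClass_polyBounded
  have hB : Stable PolyBounded (opBC' f) := by
    have h1 : opBC' f = onPos (deriv f) + fun x => onPos (fun _ => -1) x * f x := by
      refine eq_of_eqOn_pos (fun x hx => onPos_of_nonpos _ hx) (fun x hx => ?_) fun x hx => ?_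
      · simp [onPos_of_nonpos _ hx]
      · simp only [opBC', onPos_of_pos _ hx, Pi.add_apply]
        ring
    rw [h1]
    exact polyGrowthSpace.add_mem (hf.deriv hG) ((stable_const (-1)).mul hG hf)
  refine ⟨?_, ?_, ?_⟩
  · rw [invDerivSubOne_eq]
    refine stable_invDerivSub hG hf (hi f hf) ?_
    rw [← invDerivSubOne_eq]
    exact polyBounded_invDerivSubOne hf.growth
  · refine eq_of_eqOn_pos (fun x hx => onPos_of_nonpos _ hx) hf.1 fun x hx => ?_
    rw [opBC', onPos_of_pos _ hx, invDerivSubOne_eq,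
      (hasDerivAt_invDerivSub hf.2.1.continuousOn (hi f hf) hx).deriv]
    ring
  · rw [invDerivSubOne_eq]
    refine invDerivSub_of_hasDerivAt hf.1 (fun x hx => ?_) (hi _ hB) ?_
    · refine (hf.hasDerivAt hx).congr_deriv ?_
      rw [opBC', onPos_of_pos _ hx]
      ring
    · simp only [one_mul]
      refine (polyBounded_mul_exp_isBigO hf.growth).trans_tendsto ?_
      exact Real.tendsto_exp_atBot.comp (tendsto_id.const_mul_atTop_of_neg (by norm_num))

theorem invDeriv_spec {f : ℝ → ℂ} (hf : Stable RapidlyDecaying f) :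
    Stable RapidlyDecaying (invDeriv f) ∧
      onPos (deriv (invDeriv f)) = f ∧ invDeriv (onPos (deriv f)) = f := by
  have hG := isGrowthClass_rapidlyDecaying
  have hi : ∀ g, Stable RapidlyDecaying g → ∀ x : ℝ, 0 < x →
      IntegrableOn (fun y : ℝ => Complex.exp (-((0 : ℂ) * y)) * g y) (Ioi x) := fun g hg x hx => by
    simpa using integrableOn_of_rapidlyDecaying hg.2.1.continuousOn hg.growth hx
  refine ⟨?_, ?_, ?_⟩
  · rw [invDeriv_eq]
    refine stable_invDerivSub hG hf (hi f hf) ?_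
    rw [← invDeriv_eq]
    exact rapidlyDecaying_invDeriv hf.2.1.continuousOn hf.growth
  · refine eq_of_eqOn_pos (fun x hx => onPos_of_nonpos _ hx) hf.1 fun x hx => ?_
    rw [onPos_of_pos _ hx, invDeriv_eq,
      (hasDerivAt_invDerivSub hf.2.1.continuousOn (hi f hf) hx).deriv]
    ring
  · rw [invDeriv_eq]
    refine invDerivSub_of_hasDerivAt hf.1 (fun x hx => ?_) (hi _ (hf.deriv hG)) ?_
    · refine (hf.hasDerivAt hx).congr_deriv ?_
      rw [onPos_of_pos _ hx]
      ring
    · simpa using hf.growth 0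

/-! ### Differentiation and multiplication as operators -/

section Operators

variable {G : (ℝ → ℂ) → Prop} {V : Submodule ℂ (ℝ → ℂ)}

/-- The operator `∂` on a space of analytic functions on `(0, ∞)`. -/
def derivEnd (hG : IsGrowthClass G) (hV : ∀ f, f ∈ V ↔ Stable G f) : Module.End ℂ V where
  toFun f := ⟨onPos (deriv f), (hV _).2 (((hV _).1 f.2).deriv hG)⟩
  map_add' f g := by
    refine Subtype.ext (eq_of_eqOn_pos (fun x hx => onPos_of_nonpos _ hx)
      (fun x hx => by simp [onPos_of_nonpos _ hx]) fun x hx => ?_)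
    simp only [Submodule.coe_add, Pi.add_apply, onPos_of_pos _ hx]
    exact deriv_add (((hV _).1 f.2).differentiableAt hx) (((hV _).1 g.2).differentiableAt hx)
  map_smul' a f := by
    refine Subtype.ext (eq_of_eqOn_pos (fun x hx => onPos_of_nonpos _ hx)
      (fun x hx => by simp [onPos_of_nonpos _ hx]) fun x hx => ?_)
    simp only [Submodule.coe_smul, Pi.smul_apply, onPos_of_pos _ hx, RingHom.id_apply]
    exact deriv_const_smul a (((hV _).1 f.2).differentiableAt hx)

/-- Multiplication by a function of at most polynomial growth. -/
def mulEnd (hG : IsGrowthClass G) (hV : ∀ f, f ∈ V ↔ Stable G f) {m : ℝ → ℂ}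
    (hm : Stable PolyBounded m) : Module.End ℂ V where
  toFun f := ⟨fun x => m x * (f : ℝ → ℂ) x, (hV _).2 (hm.mul hG ((hV _).1 f.2))⟩
  map_add' _ _ := Subtype.ext (funext fun _ => mul_add _ _ _)
  map_smul' _ _ := Subtype.ext (funext fun _ => mul_left_comm _ _ _)

variable (hG : IsGrowthClass G) (hV : ∀ f, f ∈ V ↔ Stable G f)

theorem derivEnd_apply (f : V) {x : ℝ} (hx : 0 < x) :
    (derivEnd hG hV f : ℝ → ℂ) x = deriv f x := onPos_of_pos _ hx

theorem mulEnd_id_apply (f : V) {x : ℝ} (hx : 0 < x) :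
    (mulEnd hG hV stable_id f : ℝ → ℂ) x = x * (f : ℝ → ℂ) x :=
  congrArg (· * (f : ℝ → ℂ) x) (onPos_of_pos _ hx)

theorem mulEnd_inv_apply (f : V) {x : ℝ} (hx : 0 < x) :
    (mulEnd hG hV stable_inv f : ℝ → ℂ) x = (x : ℂ)⁻¹ * (f : ℝ → ℂ) x :=
  congrArg (· * (f : ℝ → ℂ) x) (onPos_of_pos _ hx)

theorem eq_of_eqOn_pos_of_mem (hV : ∀ f, f ∈ V ↔ Stable G f) {f g : V}
    (h : ∀ x, 0 < x → (f : ℝ → ℂ) x = (g : ℝ → ℂ) x) : f = g :=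
  Subtype.ext (eq_of_eqOn_pos ((hV _).1 f.2).1 ((hV _).1 g.2).1 h)

theorem derivEnd_mul_mulEnd_id :
    derivEnd hG hV * mulEnd hG hV stable_id = mulEnd hG hV stable_id * derivEnd hG hV + 1 := by
  refine LinearMap.ext fun f => eq_of_eqOn_pos_of_mem hV fun x hx => ?_
  simp only [Module.End.mul_apply, LinearMap.add_apply, Submodule.coe_add, Pi.add_apply,
    Module.End.one_apply, mulEnd_id_apply hG hV _ hx, derivEnd_apply hG hV _ hx]
  have h1 : HasDerivAt (fun y : ℝ => (y : ℂ) * (f : ℝ → ℂ) y)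
      (1 * (f : ℝ → ℂ) x + x * deriv f x) x :=
    (Complex.ofRealCLM.hasDerivAt (x := x)).mul (((hV _).1 f.2).hasDerivAt hx)
  have h2 : (mulEnd hG hV stable_id f : ℝ → ℂ) =ᶠ[𝓝 x] fun y : ℝ => (y : ℂ) * (f : ℝ → ℂ) y := by
    filter_upwards [Ioi_mem_nhds hx] with y hy using mulEnd_id_apply hG hV f hy
  rw [h2.deriv_eq, h1.deriv]
  ring

theorem mulEnd_inv_mul_mulEnd_id :
    mulEnd hG hV stable_inv * mulEnd hG hV stable_id = 1 := by
  refine LinearMap.ext fun f => eq_of_eqOn_pos_of_mem hV fun x hx => ?_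
  have hx' : (x : ℂ) ≠ 0 := by exact_mod_cast hx.ne'
  simp only [Module.End.mul_apply, mulEnd_id_apply hG hV _ hx, mulEnd_inv_apply hG hV _ hx,
    Module.End.one_apply]
  field_simp

theorem mulEnd_id_mul_mulEnd_inv :
    mulEnd hG hV stable_id * mulEnd hG hV stable_inv = 1 := by
  refine LinearMap.ext fun f => eq_of_eqOn_pos_of_mem hV fun x hx => ?_
  have hx' : (x : ℂ) ≠ 0 := by exact_mod_cast hx.ne'
  simp only [Module.End.mul_apply, mulEnd_id_apply hG hV _ hx, mulEnd_inv_apply hG hV _ hx,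
    Module.End.one_apply]
  field_simp

theorem deriv_derivEnd_apply (f : V) {x : ℝ} (hx : 0 < x) :
    deriv (derivEnd hG hV f : ℝ → ℂ) x = deriv (deriv f) x :=
  (onPos_eventuallyEq_nhds _ hx).deriv_eq

end Operators

/-! ### Solutions of second order equations -/

/-- Two analytic solutions on `(0, ∞)` of a second order equation are proportional if their
Wronskian, times an integrating factor, tends to `0` at `∞`. -/
theorem exists_smul_eq_of_ode {f g m P : ℝ → ℂ}
    (hf : AnalyticOnNhd ℝ f (Ioi 0)) (hg : AnalyticOnNhd ℝ g (Ioi 0))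
    (hf0 : ∀ x ≤ 0, f x = 0) (hg0 : ∀ x ≤ 0, g x = 0) (hne : f ≠ 0)
    (hm : ∀ x, 0 < x → m x ≠ 0) (hmd : ∀ x, 0 < x → HasDerivAt m (P x * m x) x)
    (hode : ∀ x, 0 < x → deriv (deriv f) x * g x - f x * deriv (deriv g) x
      = -P x * (deriv f x * g x - f x * deriv g x))
    (hlim : Tendsto (fun x => m x * (deriv f x * g x - f x * deriv g x)) atTop (𝓝 0)) :
    ∃ z : ℂ, z • f = g := by
  set w : ℝ → ℂ := fun x => m x * (deriv f x * g x - f x * deriv g x) with hw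
  have hf1 : ∀ x, 0 < x → HasDerivAt f (deriv f x) x :=
    fun x hx => (hf x hx).differentiableAt.hasDerivAt
  have hg1 : ∀ x, 0 < x → HasDerivAt g (deriv g x) x :=
    fun x hx => (hg x hx).differentiableAt.hasDerivAt
  -- The Wronskian `W` satisfies `W' = -PW` while `m' = Pm`, so `mW` is constant.
  have hwd : ∀ x, 0 < x → HasDerivAt w 0 x := by
    intro x hx
    have hf2 := (hf x hx).deriv.differentiableAt.hasDerivAt
    have hg2 := (hg x hx).deriv.differentiableAt.hasDerivAt
    refine ((hmd x hx).mul ((hf2.mul (hg1 x hx)).sub ((hf1 x hx).mul hg2))).congr_deriv ?_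
    simp only [Pi.sub_apply, Pi.mul_apply]
    linear_combination m x * hode x hx
  have hwc : ∀ x, 0 < x → ∀ y, 0 < y → w x = w y := by
    intro x hx y hy
    refine (convex_Ioi (0 : ℝ)).is_const_of_fderivWithin_eq_zero (𝕜 := ℝ)
      (fun z hz => (hwd z hz).differentiableAt.differentiableWithinAt) (fun z hz => ?_) hx hy
    rw [fderivWithin_of_isOpen isOpen_Ioi hz]
    simpa using (hwd z hz).hasFDerivAt.fderiv
  have hw0 : ∀ x, 0 < x → deriv f x * g x - f x * deriv g x = 0 := by
    intro x hx
    have h1 : Tendsto w atTop (𝓝 (w x)) := by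
      refine tendsto_const_nhds.congr' ?_
      filter_upwards [eventually_gt_atTop 0] with y hy using hwc x hx y hy
    exact (mul_eq_zero.1 (tendsto_nhds_unique h1 hlim)).resolve_left (hm x hx)
  obtain ⟨x₀, hx₀, hfx₀⟩ : ∃ x, 0 < x ∧ f x ≠ 0 := by
    by_contra! h
    exact hne (eq_of_eqOn_pos hf0 (fun _ _ => rfl) h)
  refine ⟨g x₀ / f x₀, ?_⟩
  obtain ⟨ε, hε, hball⟩ : ∃ ε > 0, ∀ y ∈ Metric.ball x₀ ε, 0 < y ∧ f y ≠ 0 := by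
    refine Metric.eventually_nhds_iff_ball.1 ?_
    exact (eventually_gt_nhds hx₀).and ((hf x₀ hx₀).continuousAt.eventually_ne hfx₀)
  -- Where `f` does not vanish, the vanishing Wronskian makes the quotient `g / f` locally constant.
  have hq : ∀ y ∈ Metric.ball x₀ ε, g y / f y = g x₀ / f x₀ := by
    intro y hy
    have hd : ∀ z ∈ Metric.ball x₀ ε, HasDerivAt (fun z => g z / f z) 0 z := by
      intro z hz
      obtain ⟨hz0, hfz⟩ := hball z hz
      refine ((hg1 z hz0).div (hf1 z hz0) hfz).congr_deriv ?_
      rw [div_eq_zero_iff]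
      left
      linear_combination -hw0 z hz0
    refine (convex_ball x₀ ε).is_const_of_fderivWithin_eq_zero (𝕜 := ℝ)
      (f := fun z => g z / f z)
      (fun z hz => (hd z hz).differentiableAt.differentiableWithinAt) (fun z hz => ?_) hy
      (Metric.mem_ball_self hε)
    rw [fderivWithin_of_isOpen Metric.isOpen_ball hz]
    simpa using (hd z hz).hasFDerivAt.fderiv
  -- Analyticity carries the proportionality across the zeros of `f`.
  have heq : EqOn ((g x₀ / f x₀) • f) g (Ioi 0) := by
    refine (hf.const_smul).eqOn_of_preconnected_of_eventuallyEq hg isPreconnected_Ioi hx₀ ?_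
    filter_upwards [Metric.ball_mem_nhds x₀ hε] with y hy
    rw [Pi.smul_apply, smul_eq_mul, ← hq y hy, div_mul_cancel₀ _ (hball y hy).2]
  exact eq_of_eqOn_pos (fun x hx => by simp [hf0 x hx]) hg0 fun x hx => heq hx

/-! ### Mellin transforms of functions with an exponential factor -/

/-- This is integration by parts for `t^s f(t)`, with boundary value `l` at `0`. The integral of
`t^{s-1} f` carries a factor `s`, so its convergence is required only for `s ≠ 0`; the case `s = 0`
is needed to evaluate `Ψ(0, c; x)`. -/
theorem mellin_deriv_add {f f' : ℝ → ℂ} {s l : ℂ} (hd : ∀ t, 0 < t → HasDerivAt f (f' t) t)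
    (h1 : MellinConvergent f (s + 1)) (h2 : MellinConvergent f' (s + 1))
    (h0 : s ≠ 0 → MellinConvergent f s)
    (hl : Tendsto (fun t : ℝ => (t : ℂ) ^ s * f t) (𝓝[>] 0) (𝓝 l)) :
    s * mellin f s + mellin f' (s + 1) = -l := by
  have hu : ∀ t ∈ Ioi (0 : ℝ), HasDerivAt (fun t : ℝ => (t : ℂ) ^ s) (s * (t : ℂ) ^ (s - 1)) t := by
    intro t ht
    have h := ((hasDerivAt_id (t : ℂ)).cpow_const (c := s)
      (Or.inl (by simpa using mem_Ioi.1 ht))).comp_ofReal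
    simpa using h
  have hv : ∀ t ∈ Ioi (0 : ℝ), HasDerivAt f (f' t) t := fun t ht => hd t ht
  have i1 : IntegrableOn (fun t : ℝ => s * (t : ℂ) ^ (s - 1) * f t) (Ioi 0) := by
    by_cases hs : s = 0
    · simp [hs]
    · simp only [mul_assoc]
      exact Integrable.const_mul (h0 hs) s
  have i2 : IntegrableOn (fun t : ℝ => (t : ℂ) ^ s * f' t) (Ioi 0) := by
    simpa [MellinConvergent] using h2
  have i3 : IntegrableOn (fun t : ℝ => (t : ℂ) ^ s * f t) (Ioi 0) := by
    simpa [MellinConvergent] using h1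
  have hinf : Tendsto (fun t : ℝ => (t : ℂ) ^ s * f t) atTop (𝓝 0) :=
    tendsto_zero_of_hasDerivAt_of_integrableOn_Ioi (fun t ht => (hu t ht).mul (hv t ht))
      (i1.add i2) i3
  have h3 := integral_Ioi_deriv_mul_eq_sub hu hv (i1.add i2) hl hinf
  rw [integral_add i1 i2, zero_sub] at h3
  rw [← h3, mellin, mellin, ← integral_const_mul]
  simp [mul_assoc]

theorem continuousOn_ofReal_cpow (r : ℂ) : ContinuousOn (fun t : ℝ => (t : ℂ) ^ r) (Ioi 0) :=
  fun _ ht => (Complex.continuousAt_ofReal_cpow_const _ _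
    (Or.inr (mem_Ioi.1 ht).ne')).continuousWithinAt

theorem norm_exp_neg_mul (z : ℂ) (t : ℝ) : ‖Complex.exp (-(z * t))‖ = Real.exp (-(z.re * t)) := by
  simp [Complex.norm_exp]

/-! ### Integrals of `t^{s-1} e^{-zt} ψ(t)` as functions of `z`. -/

section Laplace

variable {ψ : ℝ → ℂ} {s : ℂ}

/-- The modulus of the integrand depends on `z` only through its real part. -/
theorem MellinConvergent.exp_mul_of_re (hψ : ContinuousOn ψ (Ioi 0)) {z : ℂ}
    (h : MellinConvergent (fun t : ℝ => Complex.exp (-((z.re : ℂ) * t)) * ψ t) s) :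
    MellinConvergent (fun t : ℝ => Complex.exp (-(z * t)) * ψ t) s := by
  refine Integrable.mono h ?_ ?_
  · have hc : ContinuousOn (fun t : ℝ => Complex.exp (-(z * t)) * ψ t) (Ioi 0) :=
      ContinuousOn.mul (by fun_prop) hψ
    exact ((continuousOn_ofReal_cpow _).smul hc).aestronglyMeasurable measurableSet_Ioi
  · refine Eventually.of_forall fun t => ?_
    simp only [norm_smul, norm_mul, norm_exp_neg_mul, Complex.ofReal_re]
    exact le_rfl

/-- Differentiation of `∫ t^{s-1} e^{-zt} ψ(t) dt` with respect to `z`. -/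
theorem hasDerivAt_mellin_exp_mul (hψ : ContinuousOn ψ (Ioi 0))
    (h0 : ∀ x : ℝ, 0 < x → MellinConvergent (fun t : ℝ => Complex.exp (-((x : ℂ) * t)) * ψ t) s)
    (h1 : ∀ x : ℝ, 0 < x →
      MellinConvergent (fun t : ℝ => Complex.exp (-((x : ℂ) * t)) * ψ t) (s + 1))
    {z : ℂ} (hz : 0 < z.re) :
    HasDerivAt (fun z : ℂ => mellin (fun t : ℝ => Complex.exp (-(z * t)) * ψ t) s)
      (-mellin (fun t : ℝ => Complex.exp (-(z * t)) * ψ t) (s + 1)) z := by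
  have hz2 : 0 < z.re / 2 := by linarith
  have hmeas : ∀ w : ℂ, ∀ r : ℂ, AEStronglyMeasurable
      (fun t : ℝ => (t : ℂ) ^ r • (Complex.exp (-(w * t)) * ψ t)) (volume.restrict (Ioi 0)) := by
    intro w r
    have hc : ContinuousOn (fun t : ℝ => Complex.exp (-(w * t)) * ψ t) (Ioi 0) :=
      ContinuousOn.mul (by fun_prop) hψ
    exact ((continuousOn_ofReal_cpow _).smul hc).aestronglyMeasurable measurableSet_Ioi
  -- On this half-plane `|e^{-wt}| ≤ e^{-t Re z / 2}`, which gives a majorant independent of `w`.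
  have hs : {w : ℂ | z.re / 2 < w.re} ∈ 𝓝 z :=
    (isOpen_lt continuous_const Complex.continuous_re).mem_nhds 
      (show z.re / 2 < z.re by linarith)
  have key := hasDerivAt_integral_of_dominated_loc_of_deriv_le (μ := volume.restrict (Ioi (0 : ℝ)))
    (F := fun (w : ℂ) (t : ℝ) => (t : ℂ) ^ (s - 1) • (Complex.exp (-(w * t)) * ψ t))
    (F' := fun (w : ℂ) (t : ℝ) => -((t : ℂ) ^ (s + 1 - 1) • (Complex.exp (-(w * t)) * ψ t)))
    (bound := fun t : ℝ => ‖(t : ℂ) ^ (s + 1 - 1) •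
      (Complex.exp (-(((z.re / 2 : ℝ) : ℂ) * t)) * ψ t)‖)
    hs (Eventually.of_forall fun w => hmeas w _)
    (MellinConvergent.exp_mul_of_re hψ (h0 _ hz)) (hmeas z _).neg ?_ (h1 _ hz2).norm ?_
  · refine key.2.congr_deriv ?_
    rw [integral_neg]
    rfl
  · filter_upwards [ae_restrict_mem measurableSet_Ioi] with t ht w hw
    have ht' : 0 < t := ht
    have hw' : z.re / 2 < w.re := hw
    simp only [norm_neg, norm_smul, norm_mul, norm_exp_neg_mul, Complex.ofReal_re]
    gcongr
  · filter_upwards [ae_restrict_mem measurableSet_Ioi] with t ht w _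
    have ht' : (t : ℂ) ≠ 0 := by exact_mod_cast (mem_Ioi.1 ht).ne'
    have h2 : HasDerivAt (fun w : ℂ => -(w * t)) (-t) w := by
      simpa using ((hasDerivAt_id w).mul_const (t : ℂ)).fun_neg
    refine ((h2.cexp.mul_const (ψ t)).const_smul ((t : ℂ) ^ (s - 1))).congr_deriv ?_
    rw [show s + 1 - 1 = (s - 1) + 1 by ring, Complex.cpow_add _ _ ht', Complex.cpow_one]
    simp only [smul_eq_mul]
    ring

theorem hasDerivAt_mellin_exp_mul_ofReal (hψ : ContinuousOn ψ (Ioi 0))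
    (h0 : ∀ x : ℝ, 0 < x → MellinConvergent (fun t : ℝ => Complex.exp (-((x : ℂ) * t)) * ψ t) s)
    (h1 : ∀ x : ℝ, 0 < x →
      MellinConvergent (fun t : ℝ => Complex.exp (-((x : ℂ) * t)) * ψ t) (s + 1))
    {x : ℝ} (hx : 0 < x) :
    HasDerivAt (fun x : ℝ => mellin (fun t : ℝ => Complex.exp (-((x : ℂ) * t)) * ψ t) s)
      (-mellin (fun t : ℝ => Complex.exp (-((x : ℂ) * t)) * ψ t) (s + 1)) x :=
  (hasDerivAt_mellin_exp_mul hψ h0 h1 (z := x) (by simpa using hx)).comp_ofReal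

/-- The integral is complex differentiable, hence holomorphic, on the right half-plane; real
analyticity follows by restriction. -/
theorem analyticOnNhd_mellin_exp_mul (hψ : ContinuousOn ψ (Ioi 0))
    (h0 : ∀ x : ℝ, 0 < x → MellinConvergent (fun t : ℝ => Complex.exp (-((x : ℂ) * t)) * ψ t) s)
    (h1 : ∀ x : ℝ, 0 < x →
      MellinConvergent (fun t : ℝ => Complex.exp (-((x : ℂ) * t)) * ψ t) (s + 1)) :
    AnalyticOnNhd ℝ
      (fun x : ℝ => mellin (fun t : ℝ => Complex.exp (-((x : ℂ) * t)) * ψ t) s) (Ioi 0) := by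
  intro x hx
  have hd : DifferentiableOn ℂ
      (fun z : ℂ => mellin (fun t : ℝ => Complex.exp (-(z * t)) * ψ t) s) {w : ℂ | 0 < w.re} :=
    fun w hw => (hasDerivAt_mellin_exp_mul hψ h0 h1 hw).differentiableAt.differentiableWithinAt
  have ha := (hd.analyticAt (z := (x : ℂ)) ((isOpen_lt continuous_const
    Complex.continuous_re).mem_nhds (by simpa using hx))).restrictScalars (𝕜 := ℝ)
  exact ha.comp (f := fun y : ℝ => (y : ℂ)) (Complex.ofRealCLM.analyticAt x)

/-- For `x ≥ 1` the integrand is bounded in modulus by its value at `x = 1`. -/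
theorem isBigO_one_mellin_exp_mul
    (h : MellinConvergent (fun t : ℝ => Complex.exp (-((1 : ℝ) * t)) * ψ t) s) :
    (fun x : ℝ => mellin (fun t : ℝ => Complex.exp (-((x : ℂ) * t)) * ψ t) s)
      =O[atTop] fun _ => (1 : ℝ) := by
  refine Asymptotics.IsBigO.of_bound
    (∫ t in Ioi (0 : ℝ), ‖(t : ℂ) ^ (s - 1) • (Complex.exp (-((1 : ℝ) * t)) * ψ t)‖) ?_
  filter_upwards [eventually_ge_atTop 1] with x hx
  rw [norm_one, mul_one]
  refine norm_integral_le_of_norm_le (Integrable.norm h) ?_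
  filter_upwards [ae_restrict_mem measurableSet_Ioi] with t ht
  have ht' : 0 < t := ht
  simp only [norm_smul, norm_mul, norm_exp_neg_mul, Complex.ofReal_re]
  gcongr

/-- If `ψ(t/x) → 1` along a filter, then `∫ t^{s-1} e^{-xt} ψ(t) dt ≠ 0` for some `x > 0`, because
`x^s` times this integral tends to `Γ(s)`. -/
theorem exists_mellin_exp_mul_ne_zero (hψ : ContinuousOn ψ (Ioi 0)) (hs : 0 < s.re)
    {l : Filter ℝ} [l.NeBot] [l.IsCountablyGenerated] (hl : ∀ᶠ x in l, 0 < x)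
    (hlim : ∀ t, 0 < t → Tendsto (fun x => ψ (t / x)) l (𝓝 1)) {B : ℝ → ℂ}
    (hB : ∀ᶠ x in l, ∀ t, 0 < t → ‖ψ (t / x)‖ ≤ ‖B t‖)
    (hBi : MellinConvergent (fun t : ℝ => Complex.exp (-((1 : ℝ) * t)) * B t) s) :
    ∃ x : ℝ, 0 < x ∧ mellin (fun t : ℝ => Complex.exp (-((x : ℂ) * t)) * ψ t) s ≠ 0 := by
  by_contra! h
  have hzero : ∀ᶠ x in l, (∫ t in Ioi (0 : ℝ),
      (t : ℂ) ^ (s - 1) • (Complex.exp (-((1 : ℝ) * t)) * ψ (t / x))) = 0 := by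
    filter_upwards [hl] with x hx
    have h1 := mellin_comp_mul_left (fun t : ℝ => Complex.exp (-((x : ℂ) * t)) * ψ t) s
      (inv_pos.2 hx)
    rw [h x hx, smul_zero] at h1
    rw [← h1, mellin]
    have hx' : (x : ℂ) ≠ 0 := by exact_mod_cast hx.ne'
    congr 1
    funext t
    have : (x : ℂ) * ((x⁻¹ * t : ℝ) : ℂ) = ((1 : ℝ) : ℂ) * t := by
      push_cast
      field_simp
    rw [this, inv_mul_eq_div]
  have hΓ : Tendsto (fun x => ∫ t in Ioi (0 : ℝ),
      (t : ℂ) ^ (s - 1) • (Complex.exp (-((1 : ℝ) * t)) * ψ (t / x))) l (𝓝 (∫ t in Ioi (0 : ℝ),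
      (t : ℂ) ^ (s - 1) • (Complex.exp (-((1 : ℝ) * t)) * 1))) := by
    refine tendsto_integral_filter_of_dominated_convergence
      (fun t : ℝ => ‖(t : ℂ) ^ (s - 1) • (Complex.exp (-((1 : ℝ) * t)) * B t)‖) ?_ ?_
      (Integrable.norm hBi) ?_
    · filter_upwards [hl] with x hx
      have hc : ContinuousOn (fun t : ℝ => ψ (t / x)) (Ioi 0) :=
        hψ.comp (f := fun t : ℝ => t / x) (by fun_prop) fun t ht => div_pos (mem_Ioi.1 ht) hx
      have hc' : ContinuousOn (fun t : ℝ => Complex.exp (-((1 : ℝ) * t)) * ψ (t / x)) (Ioi 0) :=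
        ContinuousOn.mul (by fun_prop) hc
      exact ((continuousOn_ofReal_cpow _).smul hc').aestronglyMeasurable measurableSet_Ioi
    · filter_upwards [hB] with x hx
      filter_upwards [ae_restrict_mem measurableSet_Ioi] with t ht
      simp only [norm_smul, norm_mul]
      gcongr
      exact hx t ht
    · filter_upwards [ae_restrict_mem measurableSet_Ioi] with t ht
      exact (((hlim t ht).const_mul _).const_smul _)
  have h2 := tendsto_nhds_unique (hΓ.congr' hzero) tendsto_const_nhds
  refine Complex.Gamma_ne_zero_of_re_pos hs ?_
  rw [Complex.Gamma_eq_integral hs, Complex.GammaIntegral, ← h2]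
  refine setIntegral_congr_fun measurableSet_Ioi fun t _ => ?_
  simp [mul_comm]

end Laplace

/-! ### The integrals for Macdonald's function -/

/-- `∫₀^∞ t^{u-1} e^{-xt-1/t} dt`. -/
def macdonaldIntegral (u : ℂ) (x : ℝ) : ℂ :=
  mellin (fun t : ℝ => Complex.exp (-((x : ℂ) * t)) * Complex.exp (-(t : ℂ)⁻¹)) u

theorem continuousOn_exp_neg_inv :
    ContinuousOn (fun t : ℝ => Complex.exp (-(t : ℂ)⁻¹)) (Ioi 0) := by
  refine ContinuousOn.cexp (ContinuousOn.neg (ContinuousOn.inv₀ (by fun_prop) fun t ht => ?_))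
  exact_mod_cast (mem_Ioi.1 ht).ne'

theorem norm_exp_neg_inv (t : ℝ) : ‖Complex.exp (-(t : ℂ)⁻¹)‖ = Real.exp (-t⁻¹) := by
  rw [Complex.norm_exp, ← Complex.ofReal_inv, ← Complex.ofReal_neg, Complex.ofReal_re]

theorem norm_exp_neg_inv_le_one {t : ℝ} (ht : 0 < t) : ‖Complex.exp (-(t : ℂ)⁻¹)‖ ≤ 1 := by
  rw [norm_exp_neg_inv, Real.exp_le_one_iff]
  simpa using ht.le

/-- One term of the series of `e^{1/t}` bounds it from below. This flatness at `0` makes the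
Macdonald integrals converge for every complex exponent and kills their boundary terms. -/
theorem exp_neg_inv_le (n : ℕ) {t : ℝ} (ht : 0 < t) :
    Real.exp (-t⁻¹) ≤ n.factorial * t ^ n := by
  have h1 := Real.pow_div_factorial_le_exp t⁻¹ (by positivity) n
  rw [Real.exp_neg, inv_le_iff_one_le_mul₀ (Real.exp_pos _)]
  calc (1 : ℝ) = n.factorial * t ^ n * ((t⁻¹) ^ n / n.factorial) := by
        rw [inv_pow]
        field_simp
    _ ≤ _ := by gcongr

theorem mellinConvergent_macdonald (s : ℂ) {x : ℝ} (hx : 0 < x) :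
    MellinConvergent (fun t : ℝ => Complex.exp (-((x : ℂ) * t)) * Complex.exp (-(t : ℂ)⁻¹)) s := by
  obtain ⟨n, hn⟩ := exists_nat_gt (-s.re)
  refine mellinConvergent_of_isBigO_rpow_exp hx (b := -n) ?_ ?_ ?_ (by linarith)
  · exact (ContinuousOn.mul (by fun_prop) continuousOn_exp_neg_inv).locallyIntegrableOn
      measurableSet_Ioi
  · refine Asymptotics.IsBigO.of_bound 1 ?_
    filter_upwards [eventually_gt_atTop 0] with t ht
    rw [norm_mul, norm_exp_neg_mul, Complex.ofReal_re, Real.norm_of_nonneg (Real.exp_pos _).le,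
      one_mul, neg_mul]
    exact mul_le_of_le_one_right (Real.exp_pos _).le (norm_exp_neg_inv_le_one ht)
  · refine Asymptotics.IsBigO.of_bound n.factorial ?_
    filter_upwards [self_mem_nhdsWithin] with t ht
    have ht' : 0 < t := ht
    rw [norm_mul, norm_exp_neg_mul, Complex.ofReal_re, norm_exp_neg_inv, neg_neg,
      Real.rpow_natCast, Real.norm_of_nonneg (by positivity)]
    have h2 := exp_neg_inv_le n ht'
    have h3 : Real.exp (-(x * t)) ≤ 1 := by
      rw [Real.exp_le_one_iff]
      have := mul_pos hx ht'
      linarith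
    calc Real.exp (-(x * t)) * Real.exp (-t⁻¹) ≤ 1 * Real.exp (-t⁻¹) := by gcongr
      _ ≤ _ := by rwa [one_mul]

theorem hasDerivAt_macdonaldIntegral (u : ℂ) {x : ℝ} (hx : 0 < x) :
    HasDerivAt (macdonaldIntegral u) (-macdonaldIntegral (u + 1) x) x :=
  hasDerivAt_mellin_exp_mul_ofReal continuousOn_exp_neg_inv
    (fun _ hx => mellinConvergent_macdonald u hx)
    (fun _ hx => mellinConvergent_macdonald (u + 1) hx) hx

theorem analyticOnNhd_macdonaldIntegral (u : ℂ) :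
    AnalyticOnNhd ℝ (macdonaldIntegral u) (Ioi 0) :=
  analyticOnNhd_mellin_exp_mul continuousOn_exp_neg_inv
    (fun _ hx => mellinConvergent_macdonald u hx)
    (fun _ hx => mellinConvergent_macdonald (u + 1) hx)

/-- Integrate by parts against `t^u`: the logarithmic derivative of `e^{-xt-1/t}` is `t^{-2} - x`,
which produces the exponents `u - 1` and `u + 1`. -/
theorem macdonaldIntegral_recurrence (u : ℂ) {x : ℝ} (hx : 0 < x) :
    x * macdonaldIntegral (u + 1) x = u * macdonaldIntegral u x + macdonaldIntegral (u - 1) x := by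
  set f : ℝ → ℂ := fun t : ℝ => Complex.exp (-((x : ℂ) * t)) * Complex.exp (-(t : ℂ)⁻¹) with hf
  have hsplit : ∀ t ∈ Ioi (0 : ℝ), (t : ℂ) ^ (u + 1 - 1) • ((t : ℂ) ^ (-2 : ℂ) * f t - x * f t) =
      (t : ℂ) ^ (u - 1 - 1) • f t - x * ((t : ℂ) ^ (u + 1 - 1) • f t) := by
    intro t ht
    have ht' : (t : ℂ) ≠ 0 := by exact_mod_cast (mem_Ioi.1 ht).ne'
    rw [show u - 1 - 1 = (u + 1 - 1) + (-2) by ring, Complex.cpow_add _ _ ht']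
    simp only [smul_eq_mul]
    ring
  have i1 : IntegrableOn (fun t : ℝ => (t : ℂ) ^ (u - 1 - 1) • f t) (Ioi 0) :=
    mellinConvergent_macdonald (u - 1) hx
  have i2 : IntegrableOn (fun t : ℝ => (x : ℂ) * ((t : ℂ) ^ (u + 1 - 1) • f t)) (Ioi 0) :=
    Integrable.const_mul (mellinConvergent_macdonald (u + 1) hx) _
  have key := mellin_deriv_add (f := f) (f' := fun t => (t : ℂ) ^ (-2 : ℂ) * f t - x * f t)
    (s := u) (l := 0) (fun t ht => ?_) (mellinConvergent_macdonald _ hx) ?_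
    (fun _ => mellinConvergent_macdonald _ hx) ?_
  · have h1 : mellin (fun t => (t : ℂ) ^ (-2 : ℂ) * f t - x * f t) (u + 1)
        = macdonaldIntegral (u - 1) x - x * macdonaldIntegral (u + 1) x := by
      rw [mellin, setIntegral_congr_fun measurableSet_Ioi hsplit, integral_sub i1 i2,
        integral_const_mul]
      rfl
    rw [h1] at key
    change u * macdonaldIntegral u x + _ = _ at key
    linear_combination -key
  · have ht' : (t : ℂ) ≠ 0 := by exact_mod_cast ht.ne'
    have e1 : HasDerivAt (fun t : ℝ => Complex.exp (-((x : ℂ) * t)))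
        (-x * Complex.exp (-((x : ℂ) * t))) t := by
      simpa using hasDerivAt_exp_mul (-(x : ℂ)) t
    have e2 : HasDerivAt (fun t : ℝ => -(t : ℂ)⁻¹) ((t : ℂ) ^ (-2 : ℂ)) t := by
      refine ((hasDerivAt_inv ht').fun_neg.comp_ofReal).congr_deriv ?_
      rw [neg_neg, Complex.cpow_neg]
      norm_cast
    refine (e1.mul e2.cexp).congr_deriv ?_
    rw [hf]
    ring
  · exact (i1.sub i2).congr_fun (fun t ht => (hsplit t ht).symm) measurableSet_Ioi
  · obtain ⟨n, hn⟩ := exists_nat_gt (-u.re)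
    refine squeeze_zero_norm' (a := fun t : ℝ => n.factorial * t ^ (u.re + n)) ?_ ?_
    · filter_upwards [self_mem_nhdsWithin] with t ht
      have ht' : 0 < t := ht
      have h2 := exp_neg_inv_le n ht'
      have h3 : Real.exp (-(x * t)) ≤ 1 := by
        rw [Real.exp_le_one_iff]
        have := mul_pos hx ht'
        linarith
      rw [hf, norm_mul, norm_mul, norm_exp_neg_mul, Complex.ofReal_re, norm_exp_neg_inv,
        Complex.norm_cpow_eq_rpow_re_of_pos ht', Real.rpow_add ht', Real.rpow_natCast]
      calc t ^ u.re * (Real.exp (-(x * t)) * Real.exp (-t⁻¹))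
          ≤ t ^ u.re * (1 * (n.factorial * t ^ n)) := by gcongr
        _ = _ := by ring
    · have h4 : ContinuousAt (fun t : ℝ => n.factorial * t ^ (u.re + n)) 0 :=
        (Real.continuousAt_rpow_const _ _ (Or.inr (by linarith))).const_mul _
      have h5 := h4.tendsto
      rw [Real.zero_rpow (by linarith), mul_zero] at h5
      exact h5.mono_left nhdsWithin_le_nhds

/-- The recurrence trades one factor `x` for a lower exponent. As no exponent is excluded, any power
of `x` can be absorbed. -/
theorem pow_mul_macdonaldIntegral_isBigO (k : ℕ) (u : ℂ) :
    (fun x : ℝ => (x : ℂ) ^ k * macdonaldIntegral u x) =O[atTop] fun _ => (1 : ℝ) := by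
  induction k generalizing u with
  | zero =>
    simp only [pow_zero, one_mul]
    exact isBigO_one_mellin_exp_mul (mellinConvergent_macdonald u one_pos)
  | succ k ih =>
    refine (((ih (u - 1)).const_mul_left (u - 1)).add (ih (u - 1 - 1))).congr' ?_ EventuallyEq.rfl
    filter_upwards [eventually_gt_atTop 0] with x hx
    have h := macdonaldIntegral_recurrence (u - 1) hx
    rw [sub_add_cancel] at h
    rw [pow_succ]
    linear_combination -((x : ℂ) ^ k * h)

theorem mellinConvergent_exp {s : ℂ} (hs : 0 < s.re) :
    MellinConvergent (fun t : ℝ => Complex.exp (-((1 : ℝ) * t)) * 1) s := by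
  have h := Complex.GammaIntegral_convergent hs
  refine h.congr_fun (fun t _ => ?_) measurableSet_Ioi
  simp [mul_comm]

/-- Here the limit is `x → 0+`, where `e^{-x/t} → 1`; `Re u > 0` makes the limiting Gamma integral
converge. -/
theorem exists_macdonaldIntegral_ne_zero {u : ℂ} (hu : 0 < u.re) :
    ∃ x : ℝ, 0 < x ∧ macdonaldIntegral u x ≠ 0 := by
  refine exists_mellin_exp_mul_ne_zero continuousOn_exp_neg_inv hu (l := 𝓝[>] 0)
    self_mem_nhdsWithin (fun t ht => ?_) (B := fun _ => 1) ?_ (mellinConvergent_exp hu)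
  · have h : ContinuousAt (fun x : ℝ => Complex.exp (-((x / t : ℝ) : ℂ))) 0 := by fun_prop
    have h1 := h.tendsto
    simp only [zero_div, Complex.ofReal_zero, neg_zero, Complex.exp_zero] at h1
    refine (h1.mono_left nhdsWithin_le_nhds).congr fun x => ?_
    rw [← Complex.ofReal_inv, inv_div]
  · filter_upwards [self_mem_nhdsWithin] with x hx t ht
    rw [norm_one]
    exact norm_exp_neg_inv_le_one (div_pos ht hx)

/-! ### Macdonald's function -/

/-- The substitution `t ↦ 1/t` turns `e^{-t-x²/(4t)}` into `e^{-1/t-(x²/4)t}`, and the powers of `x`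
cancel. -/
theorem cpow_neg_mul_macdonaldK (u : ℂ) {x : ℝ} (hx : 0 < x) :
    (x : ℂ) ^ (-u) * macdonaldK u x =
      1 / 2 * ((1 / 2 : ℝ) : ℂ) ^ u * macdonaldIntegral u (x ^ 2 / 4) := by
  have hx' : (x : ℂ) ≠ 0 := by exact_mod_cast hx.ne'
  have h1 : ((x : ℂ) / 2) ^ u = (x : ℂ) ^ u * ((1 / 2 : ℝ) : ℂ) ^ u := by
    rw [← Complex.mul_cpow_ofReal_nonneg hx.le (by norm_num)]
    push_cast
    congr 1
    ring
  have h2 : (∫ t in Ioi (0 : ℝ), Complex.exp (-t - x ^ 2 / (4 * t)) * (t : ℂ) ^ (-u - 1)) =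
      macdonaldIntegral u (x ^ 2 / 4) := by
    have h := mellin_comp_inv (fun t : ℝ => Complex.exp (-t - x ^ 2 / (4 * t))) u
    have h3 : (∫ t in Ioi (0 : ℝ), Complex.exp (-t - x ^ 2 / (4 * t)) * (t : ℂ) ^ (-u - 1)) =
        mellin (fun t : ℝ => Complex.exp (-t - x ^ 2 / (4 * t))) (-u) := by
      simp only [mellin, smul_eq_mul, mul_comm]
    rw [h3, ← h, macdonaldIntegral]
    congr 1
    funext t
    rw [← Complex.exp_add]
    congr 1
    push_cast
    rw [← div_div, div_inv_eq_mul]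
    ring
  rw [macdonaldK, h1, h2, Complex.cpow_neg]
  have h4 : (x : ℂ) ^ u ≠ 0 := by simp [Complex.cpow_eq_zero_iff, hx']
  field_simp

theorem hasDerivAt_macdonaldIntegral_sq (u : ℂ) {x : ℝ} (hx : 0 < x) :
    HasDerivAt (fun x : ℝ => macdonaldIntegral u (x ^ 2 / 4))
      (-(1 / 2) * x * macdonaldIntegral (u + 1) (x ^ 2 / 4)) x := by
  have h1 : HasDerivAt (fun x : ℝ => x ^ 2 / 4) (x / 2) x := by
    refine ((hasDerivAt_pow 2 x).div_const 4).congr_deriv ?_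
    push_cast
    ring
  refine ((hasDerivAt_macdonaldIntegral u (x := x ^ 2 / 4) (by positivity)).scomp x
    h1).congr_deriv ?_
  rw [Complex.real_smul]
  push_cast
  ring

/-- Differentiation sends the member `u` of the family to `-x/2` times the member `u + 1`, so
`stable_of_deriv` reduces everything to decay of the functions themselves. -/
theorem stable_macdonaldIntegral (u : ℂ) :
    Stable RapidlyDecaying (onPos fun x => macdonaldIntegral u (x ^ 2 / 4)) := by
  refine stable_of_deriv isGrowthClass_rapidlyDecaying
    (F := fun u => onPos fun x => macdonaldIntegral u (x ^ 2 / 4))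
    (m := fun _ x => onPos (fun _ => -(1 / 2)) x * onPos (fun x => (x : ℂ)) x)
    (h := fun _ _ => 0) (σ := fun u => u + 1)
    (fun _ x hx => onPos_of_nonpos _ hx) (fun u => AnalyticOnNhd.onPos fun x hx => ?_)
    (fun u => ?_) (fun _ => (stable_const _).mul isGrowthClass_polyBounded stable_id)
    (fun _ => stable_zero isGrowthClass_rapidlyDecaying) (fun u x hx => ?_) u
  · have hx' : 0 < x := hx
    exact (analyticOnNhd_macdonaldIntegral u (x ^ 2 / 4)
      (show 0 < x ^ 2 / 4 by positivity)).comp (f := fun x : ℝ => x ^ 2 / 4) (by fun_prop)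
  · refine isGrowthClass_rapidlyDecaying.congr (fun k => ?_) (onPos_eventuallyEq_atTop _).symm
    have h1 : Tendsto (fun x : ℝ => x ^ 2 / 4) atTop atTop :=
      (tendsto_pow_atTop two_ne_zero).atTop_div_const (by norm_num)
    have h2 := (pow_mul_macdonaldIntegral_isBigO (k + 1) u).comp_tendsto h1
    -- Boundedness of `(x²/4)^{k+1}` times the integral leaves a spare factor `x^{-(k+2)}`, which
    -- turns boundedness into convergence to `0`.
    have h3 : (fun x : ℝ => ((x : ℂ) ^ (k + 2))⁻¹) =o[atTop] fun _ => (1 : ℝ) := by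
      rw [Asymptotics.isLittleO_one_iff, tendsto_zero_iff_norm_tendsto_zero]
      simp only [norm_inv, norm_pow, Complex.norm_real]
      exact (tendsto_inv_atTop_zero.comp (tendsto_pow_atTop (by omega))).comp
        tendsto_norm_atTop_atTop
    have h4 := (h3.mul_isBigO (h2.const_mul_left (4 ^ (k + 1)))).congr_right
      (g₂ := fun _ => (1 : ℝ)) fun _ => mul_one _
    refine ((Asymptotics.isLittleO_one_iff ℝ).1 h4).congr' ?_
    filter_upwards [eventually_gt_atTop 0] with x hx
    have hx' : (x : ℂ) ≠ 0 := by exact_mod_cast hx.ne'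
    simp only [Function.comp_apply]
    have h5 : ((x ^ 2 / 4 : ℝ) : ℂ) ^ (k + 1) = x ^ k * x ^ (k + 2) / 4 ^ (k + 1) := by
      push_cast
      rw [div_pow]
      ring
    rw [h5]
    field_simp
  · rw [(onPos_eventuallyEq_nhds _ hx).deriv_eq, (hasDerivAt_macdonaldIntegral_sq u hx).deriv]
    rw [onPos_of_pos _ hx, onPos_of_pos _ hx, onPos_of_pos _ hx, add_zero]

/-! ### The integrals for Tricomi's function -/

/-- `∫₀^∞ t^{s-1} e^{-xt} (1+t)^b dt`. -/
def tricomiIntegral (s b : ℂ) (x : ℝ) : ℂ :=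
  mellin (fun t : ℝ => Complex.exp (-((x : ℂ) * t)) * (1 + (t : ℂ)) ^ b) s

theorem one_add_ofReal_mem_slitPlane {t : ℝ} (ht : -1 < t) :
    1 + (t : ℂ) ∈ Complex.slitPlane := by
  refine Or.inl ?_
  rw [Complex.add_re, Complex.one_re, Complex.ofReal_re]
  linarith

theorem hasDerivAt_one_add_cpow (b : ℂ) {t : ℝ} (ht : -1 < t) :
    HasDerivAt (fun t : ℝ => (1 + (t : ℂ)) ^ b) (b * (1 + (t : ℂ)) ^ (b - 1)) t := by
  have h := (((hasDerivAt_id (t : ℂ)).const_add 1).cpow_const (c := b)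
    (one_add_ofReal_mem_slitPlane ht)).comp_ofReal
  simpa using h

theorem continuousOn_one_add_cpow (b : ℂ) :
    ContinuousOn (fun t : ℝ => (1 + (t : ℂ)) ^ b) (Ioi 0) := fun _ ht =>
  (hasDerivAt_one_add_cpow b (by linarith [mem_Ioi.1 ht])).continuousAt.continuousWithinAt

theorem norm_one_add_cpow (b : ℂ) {t : ℝ} (ht : 0 < t) :
    ‖(1 + (t : ℂ)) ^ b‖ = (1 + t) ^ b.re := by
  rw [← Complex.ofReal_one, ← Complex.ofReal_add, Complex.norm_cpow_eq_rpow_re_of_pos (by linarith)]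

theorem norm_one_add_cpow_le {b : ℂ} {k : ℕ} (hk : b.re ≤ k) {t : ℝ} (ht : 0 < t) :
    ‖(1 + (t : ℂ)) ^ b‖ ≤ (1 + t) ^ k := by
  rw [norm_one_add_cpow b ht, ← Real.rpow_natCast]
  exact Real.rpow_le_rpow_of_exponent_le (by linarith) hk

theorem mellinConvergent_tricomi {s : ℂ} (hs : 0 < s.re) (b : ℂ) {x : ℝ} (hx : 0 < x) :
    MellinConvergent (fun t : ℝ => Complex.exp (-((x : ℂ) * t)) * (1 + (t : ℂ)) ^ b) s := by
  obtain ⟨k, hk⟩ := exists_nat_ge b.re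
  have hx2 : 0 < x / 2 := by linarith
  refine mellinConvergent_of_isBigO_rpow_exp hx2 (b := 0) ?_ ?_ ?_ hs
  · exact (ContinuousOn.mul (by fun_prop) (continuousOn_one_add_cpow b)).locallyIntegrableOn
      measurableSet_Ioi
  · have h1 : (fun t : ℝ => (1 + (t : ℂ)) ^ b) =O[atTop] fun t : ℝ => t ^ k := by
      refine Asymptotics.IsBigO.of_bound (2 ^ k) ?_
      filter_upwards [eventually_ge_atTop 1] with t ht
      refine (norm_one_add_cpow_le hk (by linarith)).trans ?_
      rw [Real.norm_of_nonneg (by positivity), ← mul_pow]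
      exact pow_le_pow_left₀ (by linarith) (by linarith) k
    have h2 := h1.trans (isLittleO_pow_exp_pos_mul_atTop k hx2).isBigO
    have h3 : (fun t : ℝ => Complex.exp (-((x : ℂ) * t))) =O[atTop]
        fun t : ℝ => Real.exp (-(x * t)) :=
      Asymptotics.IsBigO.of_bound 1 (Eventually.of_forall fun t => by
        rw [norm_exp_neg_mul, Real.norm_of_nonneg (Real.exp_pos _).le, one_mul, Complex.ofReal_re])
    refine (h3.mul h2).congr_right fun t => ?_
    rw [← Real.exp_add]
    ring_nf
  · refine Asymptotics.IsBigO.of_bound (2 ^ k) ?_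
    filter_upwards [Ioo_mem_nhdsGT (zero_lt_one' ℝ)] with t ht
    rw [neg_zero, Real.rpow_zero, norm_one, mul_one, norm_mul, norm_exp_neg_mul,
      Complex.ofReal_re]
    have h3 : Real.exp (-(x * t)) ≤ 1 := by
      rw [Real.exp_le_one_iff]
      have := mul_pos hx ht.1
      linarith
    calc Real.exp (-(x * t)) * ‖(1 + (t : ℂ)) ^ b‖ ≤ 1 * (1 + t) ^ k := by
          gcongr
          exact norm_one_add_cpow_le hk ht.1
      _ ≤ 2 ^ k := by
          rw [one_mul]
          exact pow_le_pow_left₀ (by linarith [ht.1]) (by linarith [ht.2]) k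

theorem re_add_one_pos {s : ℂ} (hs : 0 < s.re) : 0 < (s + 1).re := by
  rw [Complex.add_re, Complex.one_re]
  linarith

theorem hasDerivAt_tricomiIntegral {s : ℂ} (hs : 0 < s.re) (b : ℂ) {x : ℝ} (hx : 0 < x) :
    HasDerivAt (tricomiIntegral s b) (-tricomiIntegral (s + 1) b x) x :=
  hasDerivAt_mellin_exp_mul_ofReal (continuousOn_one_add_cpow b)
    (fun _ hx => mellinConvergent_tricomi hs b hx)
    (fun _ hx => mellinConvergent_tricomi (re_add_one_pos hs) b hx) hx

theorem analyticOnNhd_tricomiIntegral {s : ℂ} (hs : 0 < s.re) (b : ℂ) :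
    AnalyticOnNhd ℝ (tricomiIntegral s b) (Ioi 0) :=
  analyticOnNhd_mellin_exp_mul (continuousOn_one_add_cpow b)
    (fun _ hx => mellinConvergent_tricomi hs b hx)
    (fun _ hx => mellinConvergent_tricomi (re_add_one_pos hs) b hx)

theorem hasDerivAt_exp_mul_one_add_cpow (x : ℝ) (b : ℂ) {t : ℝ} (ht : -1 < t) :
    HasDerivAt (fun t : ℝ => Complex.exp (-((x : ℂ) * t)) * (1 + (t : ℂ)) ^ b)
      (-(x : ℂ) * (Complex.exp (-((x : ℂ) * t)) * (1 + (t : ℂ)) ^ b) +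
        b * (Complex.exp (-((x : ℂ) * t)) * (1 + (t : ℂ)) ^ (b - 1))) t := by
  have e1 : HasDerivAt (fun t : ℝ => Complex.exp (-((x : ℂ) * t)))
      (-x * Complex.exp (-((x : ℂ) * t))) t := by
    simpa using hasDerivAt_exp_mul (-(x : ℂ)) t
  refine (e1.mul (hasDerivAt_one_add_cpow b ht)).congr_deriv ?_
  ring

theorem mellin_const_mul_add {f g : ℝ → ℂ} {s : ℂ} (hf : MellinConvergent f s)
    (hg : MellinConvergent g s) (p q : ℂ) :
    MellinConvergent (fun t => p * f t + q * g t) s ∧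
      mellin (fun t => p * f t + q * g t) s = p * mellin f s + q * mellin g s := by
  have h := hasMellin_add (hf.const_smul p) (hg.const_smul q)
  simp only [smul_eq_mul] at h
  refine ⟨h.1, h.2.trans ?_⟩
  have h1 := mellin_const_smul f s p
  have h2 := mellin_const_smul g s q
  simp only [smul_eq_mul] at h1 h2
  rw [h1, h2]

/-- The boundary term at `0` vanishes because `t^s → 0` for `Re s > 0`. -/
theorem tricomiIntegral_by_parts {s : ℂ} (hs : 0 < s.re) (b : ℂ) {x : ℝ} (hx : 0 < x) :
    s * tricomiIntegral s b x + b * tricomiIntegral (s + 1) (b - 1) x =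
      x * tricomiIntegral (s + 1) b x := by
  have hs1 := re_add_one_pos hs
  have h1 := mellin_const_mul_add (mellinConvergent_tricomi hs1 b hx)
    (mellinConvergent_tricomi hs1 (b - 1) hx) (-x) b
  have key := mellin_deriv_add (l := 0)
    (fun t ht => hasDerivAt_exp_mul_one_add_cpow x b (by linarith))
    (mellinConvergent_tricomi hs1 b hx) h1.1 (fun _ => mellinConvergent_tricomi hs b hx) ?_
  · rw [h1.2] at key
    simp only [tricomiIntegral]
    linear_combination key
  · have c1 : ContinuousAt (fun t : ℝ => (t : ℂ) ^ s) 0 :=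
      Complex.continuousAt_ofReal_cpow_const _ _ (Or.inl hs)
    have c2 := (c1.mul (hasDerivAt_exp_mul_one_add_cpow x b (t := 0) (by norm_num)).continuousAt)
    have h2 := c2.tendsto
    have hs0 : s ≠ 0 := fun h => by simp [h] at hs
    rw [Pi.mul_apply, Complex.ofReal_zero, Complex.zero_cpow hs0, zero_mul] at h2
    exact h2.mono_left nhdsWithin_le_nhds

/-- This is the same integration by parts at `s = 0`, where the boundary value `1` of
`e^{-xt}(1+t)^b` at `t = 0` survives. -/
theorem tricomiIntegral_one (b : ℂ) {x : ℝ} (hx : 0 < x) :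
    b * tricomiIntegral 1 (b - 1) x + 1 = x * tricomiIntegral 1 b x := by
  have hs1 : 0 < (0 + 1 : ℂ).re := by simp
  have h1 := mellin_const_mul_add (mellinConvergent_tricomi hs1 b hx)
    (mellinConvergent_tricomi hs1 (b - 1) hx) (-x) b
  have key := mellin_deriv_add (l := 1)
    (fun t ht => hasDerivAt_exp_mul_one_add_cpow x b (by linarith))
    (mellinConvergent_tricomi hs1 b hx) h1.1 (fun h => absurd rfl h) ?_
  · rw [h1.2, zero_add] at key
    simp only [tricomiIntegral]
    linear_combination key
  · have h2 := (hasDerivAt_exp_mul_one_add_cpow x b (t := 0) (by norm_num)).continuousAt.tendsto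
    simp only [Complex.ofReal_zero, mul_zero, neg_zero, Complex.exp_zero, add_zero,
      Complex.one_cpow, mul_one] at h2
    simp only [Complex.cpow_zero, one_mul]
    exact h2.mono_left nhdsWithin_le_nhds

/-- Write `(1+t)^b = (1+t)^{b-1} + t (1+t)^{b-1}`. -/
theorem tricomiIntegral_split {s : ℂ} (hs : 0 < s.re) (b : ℂ) {x : ℝ} (hx : 0 < x) :
    tricomiIntegral s b x = tricomiIntegral s (b - 1) x + tricomiIntegral (s + 1) (b - 1) x := by
  have i1 := mellinConvergent_tricomi hs (b - 1) hx
  have i2 := mellinConvergent_tricomi (re_add_one_pos hs) (b - 1) hx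
  rw [tricomiIntegral, tricomiIntegral, tricomiIntegral, mellin, mellin, mellin,
    ← integral_add i1 i2]
  refine setIntegral_congr_fun measurableSet_Ioi fun t ht => ?_
  have ht' : (t : ℂ) ≠ 0 := by exact_mod_cast (mem_Ioi.1 ht).ne'
  have ht1 : 1 + (t : ℂ) ≠ 0 := Complex.slitPlane_ne_zero
    (one_add_ofReal_mem_slitPlane (by linarith [mem_Ioi.1 ht]))
  have e1 : (1 + (t : ℂ)) ^ b = (1 + (t : ℂ)) ^ (b - 1) * (1 + t) := by
    rw [Complex.cpow_sub _ _ ht1, Complex.cpow_one, div_mul_cancel₀ _ ht1]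
  have e2 : (t : ℂ) ^ (s + 1 - 1) = (t : ℂ) ^ (s - 1) * t := by
    rw [show s + 1 - 1 = s - 1 + 1 by ring, Complex.cpow_add _ _ ht', Complex.cpow_one]
  simp only [smul_eq_mul, e1, e2]
  ring

/-- Here the limit is `x → ∞`, where `(1 + t/x)^b → 1`; for `x ≥ 1` an integer power of `1 + t` is a
majorant. -/
theorem exists_tricomiIntegral_ne_zero {s : ℂ} (hs : 0 < s.re) (b : ℂ) :
    ∃ x : ℝ, 0 < x ∧ tricomiIntegral s b x ≠ 0 := by
  obtain ⟨k, hk⟩ := exists_nat_ge b.re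
  refine exists_mellin_exp_mul_ne_zero (continuousOn_one_add_cpow b) hs (l := atTop)
    (eventually_gt_atTop 0) (fun t ht => ?_) (B := fun t => (1 + (t : ℂ)) ^ (k : ℂ)) ?_
    (mellinConvergent_tricomi hs _ one_pos)
  · have h := (hasDerivAt_one_add_cpow b (t := 0) (by norm_num)).continuousAt.tendsto
    rw [Complex.ofReal_zero, add_zero, Complex.one_cpow] at h
    exact h.comp (tendsto_const_nhds.div_atTop tendsto_id)
  · filter_upwards [eventually_ge_atTop 1] with x hx t ht
    have hx0 : 0 < x := by linarith
    refine (norm_one_add_cpow_le hk (div_pos ht hx0)).trans ?_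
    rw [norm_one_add_cpow _ ht, Complex.natCast_re, Real.rpow_natCast]
    have := div_le_self ht.le hx
    have := div_pos ht hx0
    exact pow_le_pow_left₀ (by linarith) (by linarith) k

/-- The index set consists of the `s` with positive real part, which is preserved by the shift `s ↦
s + 1` that differentiation in `x` produces. -/
theorem stable_tricomiIntegral {s : ℂ} (hs : 0 < s.re) (b : ℂ) :
    Stable PolyBounded (onPos (tricomiIntegral s b)) := by
  refine stable_of_deriv isGrowthClass_polyBounded (ι := {s : ℂ // 0 < s.re})
    (F := fun s => onPos (tricomiIntegral s b)) (m := fun _ => onPos fun _ => -1)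
    (h := fun _ _ => 0) (σ := fun s => ⟨s + 1, re_add_one_pos s.2⟩)
    (fun _ x hx => onPos_of_nonpos _ hx)
    (fun s => (analyticOnNhd_tricomiIntegral s.2 b).onPos)
    (fun s => ?_) (fun _ => stable_const _)
    (fun _ => stable_zero isGrowthClass_polyBounded) (fun s x hx => ?_) ⟨s, hs⟩
  · refine isGrowthClass_polyBounded.congr ⟨0, ?_⟩ (onPos_eventuallyEq_atTop _).symm
    simp only [pow_zero]
    exact isBigO_one_mellin_exp_mul (mellinConvergent_tricomi s.2 b one_pos)
  · rw [(onPos_eventuallyEq_nhds _ hx).deriv_eq, (hasDerivAt_tricomiIntegral s.2 b hx).deriv,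
      onPos_of_pos _ hx, onPos_of_pos _ hx]
    ring

/-! ### Regularised Tricomi integrals, for parameters of nonpositive real part. -/

/-- `∫₀^∞ t^{s-1} g⁽ᴺ⁾(t) dt` with `g(t) = e^{-xt} (1+t)^b`. -/
def tricomiDerivIntegral (N : ℕ) (s b : ℂ) (x : ℝ) : ℂ :=
  mellin (iteratedDeriv N fun t : ℝ => Complex.exp (-((x : ℂ) * t)) * (1 + (t : ℂ)) ^ b) s

theorem contDiffAt_exp_mul_one_add_cpow (x : ℝ) (b : ℂ) {t : ℝ} (ht : -1 < t) (n : ℕ) :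
    ContDiffAt ℝ n (fun t : ℝ => Complex.exp (-((x : ℂ) * t)) * (1 + (t : ℂ)) ^ b) t := by
  have h1 : AnalyticAt ℂ (fun z : ℂ => Complex.exp (-((x : ℂ) * z)) * (1 + z) ^ b) (t : ℂ) :=
    (by fun_prop : AnalyticAt ℂ (fun z : ℂ => Complex.exp (-((x : ℂ) * z))) (t : ℂ)).mul
      ((analyticAt_const.add analyticAt_id).cpow analyticAt_const
        (one_add_ofReal_mem_slitPlane ht))
  exact ((h1.restrictScalars (𝕜 := ℝ)).comp (f := fun y : ℝ => (y : ℂ))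
    (Complex.ofRealCLM.analyticAt t)).contDiffAt

/-- One derivative in `t` gives a combination of the functions with exponents `b` and `b - 1`, with
coefficients independent of `t`; these pass through the remaining `N` derivatives. -/
theorem iteratedDeriv_succ_exp_mul_one_add_cpow (N : ℕ) (x : ℝ) (b : ℂ) {t : ℝ} (ht : -1 < t) :
    iteratedDeriv (N + 1) (fun t : ℝ => Complex.exp (-((x : ℂ) * t)) * (1 + (t : ℂ)) ^ b) t =
      -(x : ℂ) * iteratedDeriv N
          (fun t : ℝ => Complex.exp (-((x : ℂ) * t)) * (1 + (t : ℂ)) ^ b) t +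
        b * iteratedDeriv N
          (fun t : ℝ => Complex.exp (-((x : ℂ) * t)) * (1 + (t : ℂ)) ^ (b - 1)) t := by
  rw [iteratedDeriv_succ']
  have h1 : EqOn (deriv fun t : ℝ => Complex.exp (-((x : ℂ) * t)) * (1 + (t : ℂ)) ^ b)
      (fun t => -(x : ℂ) * (Complex.exp (-((x : ℂ) * t)) * (1 + (t : ℂ)) ^ b) +
        b * (Complex.exp (-((x : ℂ) * t)) * (1 + (t : ℂ)) ^ (b - 1))) (Ioi (-1)) :=
    fun t ht => (hasDerivAt_exp_mul_one_add_cpow x b ht).deriv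
  have c1 := contDiffAt_exp_mul_one_add_cpow x b ht N
  have c2 := contDiffAt_exp_mul_one_add_cpow x (b - 1) ht N
  rw [h1.iteratedDeriv_of_isOpen isOpen_Ioi N ht,
    iteratedDeriv_fun_add (contDiffAt_const.mul c1) (contDiffAt_const.mul c2),
    iteratedDeriv_const_mul_field, iteratedDeriv_const_mul_field]

theorem mellinConvergent_tricomiDeriv (N : ℕ) {s : ℂ} (hs : 0 < s.re) (b : ℂ) {x : ℝ}
    (hx : 0 < x) : MellinConvergent
      (iteratedDeriv N fun t : ℝ => Complex.exp (-((x : ℂ) * t)) * (1 + (t : ℂ)) ^ b) s := by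
  induction N generalizing b with
  | zero => simpa using mellinConvergent_tricomi hs b hx
  | succ N ih =>
    refine IntegrableOn.congr_fun (mellin_const_mul_add (ih b) (ih (b - 1)) (-x) b).1
      (fun t ht => ?_) measurableSet_Ioi
    simp only [iteratedDeriv_succ_exp_mul_one_add_cpow N x b
      (show -1 < t by linarith [mem_Ioi.1 ht])]

theorem tricomiDerivIntegral_zero (s b : ℂ) (x : ℝ) :
    tricomiDerivIntegral 0 s b x = tricomiIntegral s b x := by
  simp [tricomiDerivIntegral, tricomiIntegral]

theorem tricomiDerivIntegral_succ (N : ℕ) {s : ℂ} (hs : 0 < s.re) (b : ℂ) {x : ℝ} (hx : 0 < x) :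
    tricomiDerivIntegral (N + 1) s b x =
      -x * tricomiDerivIntegral N s b x + b * tricomiDerivIntegral N s (b - 1) x := by
  simp only [tricomiDerivIntegral]
  rw [← (mellin_const_mul_add (mellinConvergent_tricomiDeriv N hs b hx)
    (mellinConvergent_tricomiDeriv N hs (b - 1) hx) (-x) b).2]
  refine setIntegral_congr_fun measurableSet_Ioi fun t ht => ?_
  simp only [iteratedDeriv_succ_exp_mul_one_add_cpow N x b
    (show -1 < t by linarith [mem_Ioi.1 ht])]

theorem tricomiPsi_eq (a c : ℂ) (x : ℝ) :
    tricomiPsi a c x = (-1) ^ ⌊1 - a.re⌋₊ * ((Complex.Gamma (a + ⌊1 - a.re⌋₊))⁻¹ *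
      tricomiDerivIntegral ⌊1 - a.re⌋₊ (a + ⌊1 - a.re⌋₊) (c - a - 1) x) := by
  rw [tricomiPsi, tricomiDerivIntegral, mellin, div_eq_mul_inv, mul_assoc]
  rfl

/-! ### Tricomi's function as a vector of the space of functions of polynomial growth -/

/-- The operator `∂` on functions of polynomial growth. -/
def polyDeriv : Module.End ℂ polyGrowthSpace :=
  derivEnd isGrowthClass_polyBounded mem_polyGrowthSpace

/-- Multiplication by `x` on functions of polynomial growth. -/
def polyMulX : Module.End ℂ polyGrowthSpace :=
  mulEnd isGrowthClass_polyBounded mem_polyGrowthSpace stable_id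

theorem polyDeriv_apply (f : polyGrowthSpace) {x : ℝ} (hx : 0 < x) :
    (polyDeriv f : ℝ → ℂ) x = deriv f x := derivEnd_apply _ _ f hx

theorem polyMulX_apply (f : polyGrowthSpace) {x : ℝ} (hx : 0 < x) :
    (polyMulX f : ℝ → ℂ) x = x * (f : ℝ → ℂ) x := mulEnd_id_apply _ _ f hx

theorem polyDeriv_mul_polyMulX : polyDeriv * polyMulX = polyMulX * polyDeriv + 1 :=
  derivEnd_mul_mulEnd_id _ _

theorem polyDeriv_polyMulX (f : polyGrowthSpace) :
    polyDeriv (polyMulX f) = polyMulX (polyDeriv f) + f :=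
  congr($polyDeriv_mul_polyMulX f)

theorem polyGrowthSpace_ext {f g : polyGrowthSpace}
    (h : ∀ x, 0 < x → (f : ℝ → ℂ) x = (g : ℝ → ℂ) x) : f = g :=
  eq_of_eqOn_pos_of_mem mem_polyGrowthSpace h

/-- `Γ(s)⁻¹ ∫₀^∞ t^{s-1} g⁽ᴺ⁾(t) dt` with `g(t) = e^{-xt} (1+t)^b`, as a function of `x`. -/
def tricomiVec (s : ℂ) (hs : 0 < s.re) : ℕ → ℂ → polyGrowthSpace
  | 0, b => (Complex.Gamma s)⁻¹ •
      (⟨onPos (tricomiIntegral s b), stable_tricomiIntegral hs b⟩ : polyGrowthSpace)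
  | N + 1, b => -polyMulX (tricomiVec s hs N b) + b • tricomiVec s hs N (b - 1)

theorem tricomiVec_zero_apply {s : ℂ} (hs : 0 < s.re) (b : ℂ) {x : ℝ} (hx : 0 < x) :
    (tricomiVec s hs 0 b : ℝ → ℂ) x = (Complex.Gamma s)⁻¹ * tricomiIntegral s b x :=
  congrArg ((Complex.Gamma s)⁻¹ * ·) (onPos_of_pos (tricomiIntegral s b) hx)

theorem tricomiVec_succ {s : ℂ} (hs : 0 < s.re) (N : ℕ) (b : ℂ) :
    tricomiVec s hs (N + 1) b =
      -polyMulX (tricomiVec s hs N b) + b • tricomiVec s hs N (b - 1) := rfl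

/-- The recursion defining `tricomiVec` copies `tricomiDerivIntegral_succ`, so membership in the
space needs no separate growth estimate for the regularised integrals. -/
theorem tricomiVec_apply {s : ℂ} (hs : 0 < s.re) (N : ℕ) (b : ℂ) {x : ℝ} (hx : 0 < x) :
    (tricomiVec s hs N b : ℝ → ℂ) x =
      (Complex.Gamma s)⁻¹ * tricomiDerivIntegral N s b x := by
  induction N generalizing b with
  | zero => rw [tricomiVec_zero_apply hs b hx, tricomiDerivIntegral_zero]
  | succ N ih =>
    rw [tricomiVec, tricomiDerivIntegral_succ N hs b hx]
    simp only [Submodule.coe_add, Submodule.coe_neg, Submodule.coe_smul, Pi.add_apply,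
      Pi.neg_apply, Pi.smul_apply, smul_eq_mul, polyMulX_apply _ hx, ih]
    ring

theorem polyDeriv_tricomiVec_zero {s : ℂ} (hs : 0 < s.re) (b : ℂ) :
    polyDeriv (tricomiVec s hs 0 b) = (-s) • tricomiVec (s + 1) (re_add_one_pos hs) 0 b := by
  refine polyGrowthSpace_ext fun x hx => ?_
  have h0 : s ≠ 0 := fun h => by simp [h] at hs
  have h1 : (tricomiVec s hs 0 b : ℝ → ℂ) =ᶠ[𝓝 x]
      fun x => (Complex.Gamma s)⁻¹ * tricomiIntegral s b x := by
    filter_upwards [Ioi_mem_nhds hx] with y hy using tricomiVec_zero_apply hs b hy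
  rw [polyDeriv_apply _ hx, h1.deriv_eq, ((hasDerivAt_tricomiIntegral hs b hx).const_mul _).deriv,
    Submodule.coe_smul, Pi.smul_apply, tricomiVec_zero_apply _ b hx, smul_eq_mul,
    Complex.Gamma_add_one s h0, mul_inv]
  field_simp

/-- For `N = 0` this combines integration by parts with the splitting of `(1+t)^b`; the induction
uses only `[∂, x] = 1`. With `s = u + N` and `b = c - 1` the operator on the left is `A(u)`. -/
theorem shift_tricomiVec {s : ℂ} (hs : 0 < s.re) (N : ℕ) (b : ℂ) :
    polyMulX (polyDeriv (tricomiVec s hs N b)) - polyMulX (tricomiVec s hs N b) +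
      (b - N + s) • tricomiVec s hs N b = tricomiVec s hs (N + 1) b := by
  induction N generalizing b with
  | zero =>
    refine polyGrowthSpace_ext fun x hx => ?_
    have h0 : s ≠ 0 := fun h => by simp [h] at hs
    rw [polyDeriv_tricomiVec_zero, tricomiVec_succ]
    simp only [Submodule.coe_add, Submodule.coe_neg, Submodule.coe_smul, Submodule.coe_sub,
      Pi.add_apply, Pi.sub_apply, Pi.neg_apply, Pi.smul_apply, smul_eq_mul, polyMulX_apply _ hx,
      tricomiVec_zero_apply _ _ hx, Complex.Gamma_add_one s h0, Nat.cast_zero, sub_zero]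
    have h1 := tricomiIntegral_by_parts hs b hx
    have h2 := tricomiIntegral_split hs b hx
    have h3 : s * (s * Complex.Gamma s)⁻¹ = (Complex.Gamma s)⁻¹ := by
      rw [mul_inv, mul_inv_cancel_left₀ h0]
    linear_combination (Complex.Gamma s)⁻¹ * h1 + b * (Complex.Gamma s)⁻¹ * h2 -
      x * tricomiIntegral (s + 1) b x * h3
  | succ N ih =>
    have h1 := ih b
    have h2 := ih (b - 1)
    rw [tricomiVec, tricomiVec, ← h1, ← h2]
    simp only [map_add, map_sub, map_neg, map_smul, polyDeriv_polyMulX, Nat.cast_succ]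
    module

/-- One integration by parts relates the unregularised integral at `s` to the once regularised one
at `s + 1`; this serves when neither `u` nor `u - 1` needs regularisation. -/
theorem tricomiVec_one_zero {s : ℂ} (hs : 0 < s.re) (b : ℂ) :
    tricomiVec (s + 1) (re_add_one_pos hs) 1 b = -tricomiVec s hs 0 b := by
  refine polyGrowthSpace_ext fun x hx => ?_
  have h0 : s ≠ 0 := fun h => by simp [h] at hs
  rw [tricomiVec_succ]
  simp only [Submodule.coe_add, Submodule.coe_neg, Submodule.coe_smul, Pi.add_apply,
    Pi.neg_apply, Pi.smul_apply, smul_eq_mul, polyMulX_apply _ hx,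
    tricomiVec_zero_apply _ _ hx, Complex.Gamma_add_one s h0]
  have h1 := tricomiIntegral_by_parts hs b hx
  have h3 : s * (s * Complex.Gamma s)⁻¹ = (Complex.Gamma s)⁻¹ := by
    rw [mul_inv, mul_inv_cancel_left₀ h0]
  linear_combination (s * Complex.Gamma s)⁻¹ * h1 - tricomiIntegral s b x * h3

/-- The exponent `(c + u) - u - 1 = c - 1` does not depend on `u`, so moving along a string changes
only `N` and `s`. -/
theorem onPos_tricomiPsi {c u s : ℂ} {N : ℕ} (hN : ⌊1 - u.re⌋₊ = N) (hs : 0 < s.re)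
    (h : s = u + N) :
    onPos (tricomiPsi u (c + u)) =
      ((-1 : ℂ) ^ N • tricomiVec s hs N (c - 1) : polyGrowthSpace) := by
  refine eq_of_eqOn_pos (fun x hx => onPos_of_nonpos _ hx) (fun x hx => ?_) fun x hx => ?_
  · exact ((-1 : ℂ) ^ N • tricomiVec s hs N (c - 1) : polyGrowthSpace).2.1 x hx
  · rw [onPos_of_pos _ hx, tricomiPsi_eq, Submodule.coe_smul, Pi.smul_apply,
      tricomiVec_apply hs N _ hx, hN, ← h, smul_eq_mul, add_sub_cancel_right]

theorem floor_add_re_pos (u : ℂ) : 0 < (u + (⌊1 - u.re⌋₊ : ℕ)).re := by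
  rw [Complex.add_re, Complex.natCast_re]
  linarith [Nat.lt_floor_add_one (1 - u.re)]

/-- `Ψ(u, c + u; x)` as an element of the space of functions of polynomial growth. -/
def tricomiFun (c u : ℂ) : polyGrowthSpace :=
  ⟨onPos (tricomiPsi u (c + u)), by
    rw [onPos_tricomiPsi rfl (floor_add_re_pos u) rfl]
    exact Subtype.mem _⟩

theorem tricomiFun_eq {c u s : ℂ} {N : ℕ} (hN : ⌊1 - u.re⌋₊ = N) (hs : 0 < s.re)
    (h : s = u + N) : tricomiFun c u = (-1 : ℂ) ^ N • tricomiVec s hs N (c - 1) :=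
  Subtype.ext (onPos_tricomiPsi hN hs h)

theorem tricomiFun_of_re_pos (c : ℂ) {u : ℂ} (hu : 0 < u.re) :
    tricomiFun c u = tricomiVec u hu 0 (c - 1) := by
  rw [tricomiFun_eq (N := 0) (Nat.floor_eq_zero.2 (by linarith)) hu (by simp), pow_zero, one_smul]

/-- If `Re u > 1`, both functions are plain integrals. Otherwise passing to `u - 1` raises `N` by
one and keeps `s = u + N`, and the sign comes from `(-1)^N`. -/
theorem lower_tricomiFun (c u : ℂ) :
    polyMulX (polyDeriv (tricomiFun c u)) - polyMulX (tricomiFun c u) +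
      (c - 1 + u) • tricomiFun c u = -tricomiFun c (u - 1) := by
  rcases lt_or_ge 0 (u - 1).re with hu | hu
  · have hu1 := re_add_one_pos hu
    have h1 : tricomiFun c u = tricomiVec (u - 1 + 1) hu1 0 (c - 1) := by
      rw [← tricomiFun_of_re_pos c hu1, sub_add_cancel]
    rw [tricomiFun_of_re_pos c hu, ← tricomiVec_one_zero hu, ← shift_tricomiVec hu1, h1]
    simp only [Nat.cast_zero, sub_zero, sub_add_cancel]
  · set N : ℕ := ⌊1 - u.re⌋₊ with hN
    have hs := floor_add_re_pos u
    -- The natural floor commutes with adding `1` because `1 - Re u ≥ 0` in this case.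
    have hN' : ⌊1 - (u - 1).re⌋₊ = N + 1 := by
      rw [Complex.sub_re, Complex.one_re] at hu ⊢
      rw [hN, ← Nat.floor_add_one (by linarith)]
      ring_nf
    rw [tricomiFun_eq hN.symm hs rfl, tricomiFun_eq hN' hs (by push_cast; ring),
      ← shift_tricomiVec, pow_succ, show c - 1 - (N : ℂ) + (u + N) = c - 1 + u by ring]
    simp only [map_smul]
    module

/-- For `Re u > 0` this is differentiation under the integral. It descends from `u + 1` to `u` by
differentiating `-F(u) = A(u+1)F(u+1)` and using the lowering relation at `u + 2`. -/
theorem raise_tricomiFun (c u : ℂ) :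
    polyDeriv (tricomiFun c u) = (-u) • tricomiFun c (u + 1) := by
  obtain ⟨n, hn⟩ := exists_nat_gt (-u.re)
  induction n generalizing u with
  | zero =>
    have hu : 0 < u.re := by
      rw [Nat.cast_zero] at hn
      linarith
    rw [tricomiFun_of_re_pos c hu, tricomiFun_of_re_pos c (re_add_one_pos hu),
      polyDeriv_tricomiVec_zero]
  | succ n ih =>
    have h1 := ih (u + 1) (by
      rw [Complex.add_re, Complex.one_re]
      push_cast at hn
      linarith)
    have h2 := lower_tricomiFun c (u + 1)
    have h3 := lower_tricomiFun c (u + 1 + 1)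
    rw [add_sub_cancel_right] at h2 h3
    rw [← neg_neg (tricomiFun c u), ← h2, map_neg]
    have h4 : (u + 1) • (polyMulX (polyDeriv (tricomiFun c (u + 1 + 1))) -
        polyMulX (tricomiFun c (u + 1 + 1)) + (c - 1 + (u + 1 + 1)) • tricomiFun c (u + 1 + 1)) =
        -((u + 1) • tricomiFun c (u + 1)) := by rw [h3, smul_neg]
    simp only [map_add, map_sub, map_smul, polyDeriv_polyMulX, h1]
    rw [← sub_eq_zero] at h4 ⊢
    rw [← h4]
    module

theorem tricomiFun_zero_apply (c : ℂ) {x : ℝ} (hx : 0 < x) :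
    (tricomiFun c 0 : ℝ → ℂ) x = 1 := by
  have h1 : 0 < (1 : ℂ).re := by simp
  -- At `u = 0` the floor of `1 - Re u` is `1`, so one regularising derivative is present.
  rw [tricomiFun_eq (N := 1) (s := 1) (by simp) h1 (by simp), tricomiVec]
  simp only [Submodule.coe_add, Submodule.coe_neg, Submodule.coe_smul, Pi.add_apply,
    Pi.neg_apply, Pi.smul_apply, smul_eq_mul, polyMulX_apply _ hx,
    tricomiVec_zero_apply _ _ hx, Complex.Gamma_one]
  linear_combination -tricomiIntegral_one (c - 1) hx

/-- Nonvanishing descends from `u + 1` to `u` through `∂F(u) = -uF(u+1)`. The factor fails only at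
`u = 0`, where the function is the constant `1`. -/
theorem tricomiFun_ne_zero (c u : ℂ) : tricomiFun c u ≠ 0 := by
  obtain ⟨n, hn⟩ := exists_nat_gt (-u.re)
  induction n generalizing u with
  | zero =>
    have hu : 0 < u.re := by
      rw [Nat.cast_zero] at hn
      linarith
    obtain ⟨x, hx, hne⟩ := exists_tricomiIntegral_ne_zero hu (c - 1)
    intro h
    rw [tricomiFun_of_re_pos c hu] at h
    have h1 := tricomiVec_zero_apply hu (c - 1) hx
    rw [h] at h1
    exact mul_ne_zero (inv_ne_zero (Complex.Gamma_ne_zero_of_re_pos hu)) hne h1.symm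
  | succ n ih =>
    intro h
    by_cases hu : u = 0
    · have h1 := tricomiFun_zero_apply c one_pos
      rw [← hu, h] at h1
      exact zero_ne_one h1
    · have h1 := raise_tricomiFun c u
      rw [h, map_zero] at h1
      refine smul_ne_zero (neg_ne_zero.2 hu) (ih (u + 1) ?_) h1.symm
      rw [Complex.add_re, Complex.one_re]
      push_cast at hn
      linarith

/-! ### Laguerre polynomials -/

/-- This is the counterpart of the lowering relation for `Ψ`, with `α = c - n - 1`; it lets the two
families be identified by induction. -/
theorem laguerreL_recurrence (n : ℕ) (α x : ℂ) :
    ∃ d : ℂ, HasDerivAt (laguerreL n α) d x ∧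
      (n + 1) * laguerreL (n + 1) (α - 1) x =
        x * d - x * laguerreL n α x + α * laguerreL n α x := by
  set a : ℕ → ℂ → ℕ → ℂ := fun n α k => (-1) ^ k * (ascPochhammer ℂ (n - k)).eval (α + k + 1) /
    ((k.factorial : ℂ) * ((n - k).factorial : ℂ)) with ha
  have hL : ∀ n α x, laguerreL n α x = ∑ k ∈ Finset.range (n + 1), a n α k * x ^ k :=
    fun _ _ _ => rfl
  refine ⟨∑ k ∈ Finset.range (n + 1), a n α k * (k * x ^ (k - 1)), ?_, ?_⟩
  · have h1 : laguerreL n α = fun x => ∑ k ∈ Finset.range (n + 1), a n α k * x ^ k := rfl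
    rw [h1]
    exact HasDerivAt.fun_sum fun k _ => (hasDerivAt_pow k x).const_mul _
  -- Split `n + 1 = (n + 1 - k) + k` in the coefficient of `x^k`: the first part yields `xL' + αL`,
  -- the second `-xL`.
  · have h1 : ∀ k ∈ Finset.range (n + 1),
        ((n + 1 : ℂ) - k) * a (n + 1) (α - 1) k = (k + α) * a n α k := by
      intro k hk
      have hk' : k ≤ n := Nat.lt_succ_iff.1 (Finset.mem_range.1 hk)
      have e1 : n + 1 - k = (n - k) + 1 := by omega
      have e2 : ((n + 1 : ℂ) - k) = ((n - k : ℕ) : ℂ) + 1 := by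
        rw [Nat.cast_sub hk']
        ring
      have e3 : ((n - k : ℕ) : ℂ) + 1 ≠ 0 := Nat.cast_add_one_ne_zero _
      have e4 : ((n - k).factorial : ℂ) ≠ 0 := Nat.cast_ne_zero.2 (Nat.factorial_ne_zero _)
      have e5 : (k.factorial : ℂ) ≠ 0 := Nat.cast_ne_zero.2 (Nat.factorial_ne_zero _)
      simp only [ha, e1, e2, ascPochhammer_succ_left, Polynomial.eval_mul, Polynomial.eval_X,
        Polynomial.eval_comp, Polynomial.eval_add, Polynomial.eval_one, Nat.factorial_succ]
      push_cast
      rw [show α - 1 + k + 1 = α + k by ring]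
      field_simp
      ring
    have h2 : ∀ k, ((k + 1 : ℕ) : ℂ) * a (n + 1) (α - 1) (k + 1) = -a n α k := by
      intro k
      have e4 : ((n - k).factorial : ℂ) ≠ 0 := Nat.cast_ne_zero.2 (Nat.factorial_ne_zero _)
      have e5 : (k.factorial : ℂ) ≠ 0 := Nat.cast_ne_zero.2 (Nat.factorial_ne_zero _)
      have e6 : (k : ℂ) + 1 ≠ 0 := Nat.cast_add_one_ne_zero _
      simp only [ha, Nat.add_sub_add_right, Nat.factorial_succ]
      push_cast
      rw [show α - 1 + (k + 1) + 1 = α + k + 1 by ring]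
      field_simp
      ring
    have s1 : ∑ k ∈ Finset.range (n + 1 + 1), ((n + 1 : ℂ) - k) * a (n + 1) (α - 1) k * x ^ k =
        ∑ k ∈ Finset.range (n + 1), (k + α) * a n α k * x ^ k := by
      rw [Finset.sum_range_succ]
      push_cast
      rw [sub_self, zero_mul, zero_mul, add_zero]
      exact Finset.sum_congr rfl fun k hk => by rw [h1 k hk]
    have s2 : ∑ k ∈ Finset.range (n + 1 + 1), (k : ℂ) * a (n + 1) (α - 1) k * x ^ k =
        ∑ k ∈ Finset.range (n + 1), -a n α k * x ^ (k + 1) := by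
      rw [Finset.sum_range_succ']
      simp only [h2, Nat.cast_zero, zero_mul, add_zero]
    have s3 : ∀ k : ℕ, x * (a n α k * (k * x ^ (k - 1))) = k * a n α k * x ^ k := by
      intro k
      rcases k with _ | k
      · simp
      · rw [Nat.add_sub_cancel, pow_succ]
        ring
    rw [hL, hL, Finset.mul_sum, Finset.mul_sum, Finset.mul_sum, Finset.mul_sum]
    simp only [s3]
    calc ∑ k ∈ Finset.range (n + 1 + 1), ((n : ℂ) + 1) * (a (n + 1) (α - 1) k * x ^ k)
        = ∑ k ∈ Finset.range (n + 1 + 1), ((n + 1 : ℂ) - k) * a (n + 1) (α - 1) k * x ^ k +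
          ∑ k ∈ Finset.range (n + 1 + 1), (k : ℂ) * a (n + 1) (α - 1) k * x ^ k := by
          rw [← Finset.sum_add_distrib]
          exact Finset.sum_congr rfl fun k _ => by ring
      _ = _ := by
          rw [s1, s2, ← Finset.sum_sub_distrib, ← Finset.sum_add_distrib, ← Finset.sum_add_distrib]
          exact Finset.sum_congr rfl fun k _ => by ring

theorem tricomiFun_neg_natCast_apply (c : ℂ) (n : ℕ) {x : ℝ} (hx : 0 < x) :
    (tricomiFun c (-n) : ℝ → ℂ) x =
      (-1) ^ n * (n.factorial : ℂ) * laguerreL n (c - n - 1) x := by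
  induction n generalizing x with
  | zero =>
    rw [Nat.cast_zero, neg_zero, tricomiFun_zero_apply c hx]
    simp [laguerreL]
  | succ n ih =>
    obtain ⟨d, hd, hrec⟩ := laguerreL_recurrence n (c - n - 1) x
    have h1 : deriv (tricomiFun c (-n) : ℝ → ℂ) x = (-1) ^ n * (n.factorial : ℂ) * d := by
      have h2 : (tricomiFun c (-n) : ℝ → ℂ) =ᶠ[𝓝 x]
          fun x : ℝ => (-1) ^ n * (n.factorial : ℂ) * laguerreL n (c - n - 1) x := by
        filter_upwards [Ioi_mem_nhds hx] with y hy using ih hy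
      rw [h2.deriv_eq, (hd.comp_ofReal.const_mul _).deriv]
    have h3 := lower_tricomiFun c (-n)
    have h4 : (tricomiFun c (-(n : ℂ) - 1) : ℝ → ℂ) x = -(x * ((-1) ^ n * (n.factorial : ℂ) * d) -
        x * ((-1) ^ n * (n.factorial : ℂ) * laguerreL n (c - n - 1) x) + (c - 1 + -(n : ℂ)) *
        ((-1) ^ n * (n.factorial : ℂ) * laguerreL n (c - n - 1) x)) := by
      rw [← neg_neg (tricomiFun c (-(n : ℂ) - 1)), ← h3]
      simp only [Submodule.coe_add, Submodule.coe_neg, Submodule.coe_smul, Submodule.coe_sub,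
        Pi.add_apply, Pi.sub_apply, Pi.neg_apply, Pi.smul_apply, smul_eq_mul, polyMulX_apply _ hx,
        polyDeriv_apply _ hx, h1, ih hx]
    rw [show -((n + 1 : ℕ) : ℂ) = -(n : ℂ) - 1 by push_cast; ring, h4,
      show c - ((n + 1 : ℕ) : ℂ) - 1 = c - n - 1 - 1 by push_cast; ring, Nat.factorial_succ]
    push_cast
    linear_combination (-1) ^ n * (n.factorial : ℂ) * hrec

/-! ### The representation of type C' and its strings -/

theorem polyBounded_cpow (a : ℂ) : PolyBounded fun x : ℝ => (x : ℂ) ^ a := by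
  obtain ⟨k, hk⟩ := exists_nat_ge a.re
  refine ⟨k, Asymptotics.IsBigO.of_bound 1 ?_⟩
  filter_upwards [eventually_ge_atTop 1] with x hx
  rw [Complex.norm_cpow_eq_rpow_re_of_pos (by linarith), one_mul,
    Real.norm_of_nonneg (by positivity), ← Real.rpow_natCast]
  exact Real.rpow_le_rpow_of_exponent_le hx hk

theorem Stable.growth_deriv {G : (ℝ → ℂ) → Prop} {f : ℝ → ℂ} (hf : Stable G f) :
    G (_root_.deriv f) := by
  simpa using hf.2.2 1

theorem hasDerivAt_ofReal_cpow (a : ℂ) {x : ℝ} (hx : 0 < x) :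
    HasDerivAt (fun x : ℝ => (x : ℂ) ^ a) (a / x * (x : ℂ) ^ a) x := by
  have hx' : (x : ℂ) ≠ 0 := by exact_mod_cast hx.ne'
  have h := ((hasDerivAt_id (x : ℂ)).cpow_const (c := a)
    (Or.inl (by simpa using hx))).comp_ofReal
  refine h.congr_deriv ?_
  rw [id, Complex.cpow_sub _ _ hx', Complex.cpow_one]
  ring

/-- The operator `x∂² + (c + u - x)∂ - u`. -/
def kummerEnd (c u : ℂ) : Module.End ℂ polyGrowthSpace :=
  polyMulX * polyDeriv * polyDeriv + (c + u) • polyDeriv - polyMulX * polyDeriv - u • 1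

theorem coe_kummerEnd (c u : ℂ) (f : polyGrowthSpace) :
    (kummerEnd c u f : ℝ → ℂ) = diffOpC' c u f := by
  refine eq_of_eqOn_pos (kummerEnd c u f).2.1 (fun x hx => onPos_of_nonpos _ hx) fun x hx => ?_
  have h := deriv_derivEnd_apply isGrowthClass_polyBounded mem_polyGrowthSpace f hx
  change deriv (polyDeriv f : ℝ → ℂ) x = _ at h
  simp only [kummerEnd, LinearMap.add_apply, LinearMap.sub_apply, LinearMap.smul_apply,
    Module.End.mul_apply, Module.End.one_apply, Submodule.coe_add, Submodule.coe_sub,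
    Submodule.coe_smul, Pi.add_apply, Pi.sub_apply, Pi.smul_apply, smul_eq_mul,
    polyMulX_apply _ hx, polyDeriv_apply _ hx, h]
  rw [diffOpC', onPos_of_pos _ hx]
  ring

theorem coe_polyDeriv_sub_one (f : polyGrowthSpace) :
    ((polyDeriv - 1) f : ℝ → ℂ) = opBC' f := by
  refine eq_of_eqOn_pos ((polyDeriv - 1) f).2.1 (fun x hx => onPos_of_nonpos _ hx) fun x hx => ?_
  rw [opBC', onPos_of_pos _ hx, LinearMap.sub_apply, Submodule.coe_sub, Pi.sub_apply,
    polyDeriv_apply _ hx]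
  rfl

theorem bijective_polyDeriv_sub_one :
    Function.Bijective (polyDeriv - 1 : Module.End ℂ polyGrowthSpace) := by
  constructor
  · intro f g h
    have h1 := congr(invDerivSubOne ($h : polyGrowthSpace))
    rw [coe_polyDeriv_sub_one, coe_polyDeriv_sub_one, (invDerivSubOne_spec f.2).2.2,
      (invDerivSubOne_spec g.2).2.2] at h1
    exact Subtype.ext h1
  · intro f
    refine ⟨⟨invDerivSubOne f, (invDerivSubOne_spec f.2).1⟩, Subtype.ext ?_⟩
    rw [coe_polyDeriv_sub_one]
    exact (invDerivSubOne_spec f.2).2.1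

/-- The operator `(∂ - 1)⁻¹`. -/
def polyDerivSubOneInv : Module.End ℂ polyGrowthSpace :=
  (LinearEquiv.ofBijective (polyDeriv - 1) bijective_polyDeriv_sub_one).symm.toLinearMap

theorem mul_polyDerivSubOneInv : (polyDeriv - 1) * polyDerivSubOneInv = 1 :=
  LinearMap.ext fun f =>
    (LinearEquiv.ofBijective (polyDeriv - 1) bijective_polyDeriv_sub_one).apply_symm_apply f

theorem polyDerivSubOneInv_mul : polyDerivSubOneInv * (polyDeriv - 1) = 1 :=
  LinearMap.ext fun f =>
    (LinearEquiv.ofBijective (polyDeriv - 1) bijective_polyDeriv_sub_one).symm_apply_apply f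

theorem coe_polyDerivSubOneInv (f : polyGrowthSpace) :
    (polyDerivSubOneInv f : ℝ → ℂ) = invDerivSubOne f := by
  have h := congr($mul_polyDerivSubOneInv f)
  have h1 := (invDerivSubOne_spec (polyDerivSubOneInv f).2).2.2
  rw [← coe_polyDeriv_sub_one] at h1
  rw [← h1]
  exact congrArg (fun g : polyGrowthSpace => invDerivSubOne g) h

/-- The representation of type C'. -/
def repC' (c u : ℂ) : Matrix (Fin 2) (Fin 2) (Module.End ℂ polyGrowthSpace) :=
  -- The product `1 * u` matches the general shape with `α = 1` definitionally.
  !![polyMulX * (polyDeriv - 1) + (c - 1) • 1 + (1 * u) • 1, polyDeriv - 1;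
    polyDerivSubOneInv * kummerEnd c 0 + u • 1, polyDeriv]

theorem polyDeriv_sub_one_mul_kummer (c : ℂ) :
    (polyDeriv - 1) * (polyDerivSubOneInv * kummerEnd c 0) = kummerEnd c 0 := by
  rw [← mul_assoc, mul_polyDerivSubOneInv, one_mul]

/-- The dependence of `kummerEnd c u` on `u` is through `u(∂ - 1)`, which the inverse turns into
`u`. -/
theorem repC'_one_zero (c u : ℂ) : repC' c u 1 0 = polyDerivSubOneInv * kummerEnd c u := by
  have h1 : kummerEnd c u = kummerEnd c 0 + u • (polyDeriv - 1) := by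
    simp only [kummerEnd]
    module
  rw [h1, mul_add, mul_smul_comm, polyDerivSubOneInv_mul]
  rfl

/-- Here `∂(x(∂ - 1) + c - 1)` equals `kummerEnd c 0 - 1`, whence `r = -1`; and `b = d - 1` gives `α
= s = 1`. -/
theorem repC'_spec (c : ℂ) :
    IsQISMIRep (repC' c) ∧ HasQuantumDet (repC' c) fun u => u - 1 / 2 := by
  refine isQISMIRep_and_hasQuantumDet (α := 1) (r := -1) (s := 1) (fun u => rfl)
    bijective_polyDeriv_sub_one.1 ?_ ?_ (by simp) fun u => by ring
  · refine LinearMap.ext fun f => ?_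
    simp only [LinearMap.add_apply, LinearMap.sub_apply, LinearMap.smul_apply,
      Module.End.mul_apply, Module.End.one_apply, map_add, map_sub, map_smul, polyDeriv_polyMulX]
    module
  · rw [polyDeriv_sub_one_mul_kummer]
    refine LinearMap.ext fun f => ?_
    simp only [kummerEnd, LinearMap.add_apply, LinearMap.sub_apply, LinearMap.smul_apply,
      Module.End.mul_apply, Module.End.one_apply, map_add, map_sub, map_smul, polyDeriv_polyMulX]
    module

/-- The integrating factor is `x^{c+u} e^{-x}`; its exponential beats the polynomial growth of the
Wronskian. -/
theorem kummerEnd_ker {c u : ℂ} {f g : polyGrowthSpace} (hne : f ≠ 0)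
    (hf : kummerEnd c u f = 0) (hg : kummerEnd c u g = 0) : ∃ z : ℂ, z • f = g := by
  have hode : ∀ f : polyGrowthSpace, kummerEnd c u f = 0 → ∀ x : ℝ, 0 < x →
      x * deriv (deriv f) x + (c + u - x) * deriv f x - u * (f : ℝ → ℂ) x = 0 := by
    intro f hf x hx
    have h := congrFun (coe_kummerEnd c u f) x
    rw [diffOpC', onPos_of_pos _ hx, hf] at h
    exact h.symm
  have key := exists_smul_eq_of_ode (f := f) (g := g)
    (m := fun x : ℝ => (x : ℂ) ^ (c + u) * Complex.exp (-1 * x))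
    (P := fun x => (c + u) / x - 1) f.2.2.1 g.2.2.1 f.2.1 g.2.1
    (fun h => hne (Subtype.ext h)) (fun x hx => ?_) (fun x hx => ?_) (fun x hx => ?_) ?_
  · obtain ⟨z, hz⟩ := key
    exact ⟨z, Subtype.ext hz⟩
  · have hx' : (x : ℂ) ≠ 0 := by exact_mod_cast hx.ne'
    exact mul_ne_zero (by simp [Complex.cpow_eq_zero_iff, hx']) (Complex.exp_ne_zero _)
  · refine ((hasDerivAt_ofReal_cpow (c + u) hx).mul (hasDerivAt_exp_mul (-1) x)).congr_deriv ?_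
    ring
  · have hx' : (x : ℂ) ≠ 0 := by exact_mod_cast hx.ne'
    refine mul_left_cancel₀ hx' ?_
    field_simp
    linear_combination (g : ℝ → ℂ) x * hode f hf x hx - (f : ℝ → ℂ) x * hode g hg x hx
  · have hG := isGrowthClass_polyBounded
    have hf' := (mem_polyGrowthSpace _).1 f.2
    have hg' := (mem_polyGrowthSpace _).1 g.2
    have h1 := hG.add (hG.mul hf'.growth_deriv hg'.growth)
      (hG.mul (polyBounded_const (-1)) (hG.mul hf'.growth hg'.growth_deriv))
    have h2 := polyBounded_mul_exp_isBigO (hG.mul (polyBounded_cpow (c + u)) h1)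
    have h3 := h2.trans_tendsto
      (Real.tendsto_exp_atBot.comp (tendsto_id.const_mul_atTop_of_neg (by norm_num)))
    refine h3.congr fun x => ?_
    rw [neg_one_mul (x : ℂ)]
    ring

theorem repC'_string (c : ℂ) {u₀ : ℂ} {jp : WithTop ℤ}
    (hΔp : ∀ u ∈ paramString u₀ ⊥ jp, u = 0 ↔ IsHighest u₀ jp u)
    (hend : ∀ u, IsHighest u₀ jp u → u = 0) :
    StringConditions (repC' c) u₀ ⊥ jp (tricomiFun c) ∧
      StringShifts (repC' c) u₀ ⊥ jp (tricomiFun c) (fun u => -(u - 1 / 2)) (fun _ => -1) := by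
  refine stringConditions_and_stringShifts (repC'_spec c).1 (repC'_spec c).2
    (fun u => bijective_polyDeriv_sub_one.1) (tricomiFun_ne_zero c) (fun u => ?_) (fun u => ?_)
    (fun u => by ring) (fun u w₁ w₂ hw h1 h2 => ?_) (fun _ => by norm_num) (fun u hu => ?_)
    fun u hu => hend _ hu
  · have h := lower_tricomiFun c u
    rw [neg_one_smul, ← h]
    simp only [repC', Matrix.of_apply, Matrix.cons_val', Matrix.cons_val_zero,
      Matrix.cons_val_fin_one, LinearMap.add_apply, LinearMap.sub_apply, LinearMap.smul_apply,
      Module.End.mul_apply, Module.End.one_apply, map_sub]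
    module
  · rw [add_sub_cancel_right]
    exact raise_tricomiFun c u
  · have hinj : Function.Injective polyDerivSubOneInv :=
      (LinearEquiv.ofBijective (polyDeriv - 1) bijective_polyDeriv_sub_one).symm.injective
    rw [repC'_one_zero] at h1 h2
    exact kummerEnd_ker hw (hinj (h1.trans (map_zero _).symm)) (hinj (h2.trans (map_zero _).symm))
  · rw [← hΔp u hu, add_sub_cancel_right, neg_eq_zero]

theorem typeC' (c : ℂ) :
    (∀ u : ℂ, ∀ f ∈ polyGrowthSpace, diffOpC' c u f ∈ polyGrowthSpace) ∧
    ∃ T : ℂ → Matrix (Fin 2) (Fin 2) (Module.End ℂ polyGrowthSpace),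
    ∃ F : ℂ → polyGrowthSpace,
      (∀ (u : ℂ) (f : polyGrowthSpace),
        (T u 0 0 f : ℝ → ℂ) = opAC' c u f ∧ (T u 0 1 f : ℝ → ℂ) = opBC' f ∧
        (T u 1 0 f : ℝ → ℂ) = opCC' c u f ∧ (T u 1 1 f : ℝ → ℂ) = opDC' f) ∧
      (∀ u : ℂ, Function.Injective (T u 0 1)) ∧
      IsQISMIRep T ∧
      HasQuantumDet T (fun u => u - 1 / 2) ∧
      (∀ u : ℂ, (F u : ℝ → ℂ) = onPos (tricomiPsi u (c + u))) ∧
      (∀ u₀ : ℂ, (∀ m : ℤ, u₀ ≠ m) →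
        StringConditions T u₀ ⊥ ⊤ F ∧
        StringShifts T u₀ ⊥ ⊤ F (fun u => -(u - 1 / 2)) (fun _ => -1)) ∧
      StringConditions T 0 ⊥ ((1 : ℤ) : WithTop ℤ) F ∧
      StringShifts T 0 ⊥ ((1 : ℤ) : WithTop ℤ) F (fun u => -(u - 1 / 2)) (fun _ => -1) ∧
      ∀ (n : ℕ) (x : ℝ), 0 < x →
        (F (-n) : ℝ → ℂ) x = (-1) ^ n * (n.factorial : ℂ) * laguerreL n (c - n - 1) x := by
  have htop : ∀ u₀ u, ¬ IsHighest u₀ ⊤ u := by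
    rintro u₀ u ⟨j, hj, -⟩
    exact WithTop.top_ne_coe hj
  have hone : ∀ u, IsHighest 0 ((1 : ℤ) : WithTop ℤ) u ↔ u = 0 := by
    intro u
    constructor
    · rintro ⟨j, hj, rfl⟩
      rw [← WithTop.coe_inj.1 hj]
      simp
    · rintro rfl
      exact ⟨1, rfl, by simp⟩
  have hstr := repC'_string c (u₀ := 0) (jp := ((1 : ℤ) : WithTop ℤ))
    (fun u _ => (hone u).symm) fun u hu => (hone u).1 hu
  refine ⟨fun u f hf => ?_, repC' c, tricomiFun c,
    fun u f => ⟨?_, coe_polyDeriv_sub_one f, ?_, rfl⟩,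
    fun _ => bijective_polyDeriv_sub_one.1, (repC'_spec c).1, (repC'_spec c).2, fun _ => rfl,
    fun u₀ hu₀ => repC'_string c (fun u hu => ?_) fun u hu => absurd hu (htop _ _), hstr.1, hstr.2,
    fun n x hx => tricomiFun_neg_natCast_apply c n hx⟩
  · have h := coe_kummerEnd c u ⟨f, hf⟩
    rw [← h]
    exact Subtype.mem _
  · refine eq_of_eqOn_pos (repC' c u 0 0 f).2.1 (fun x hx => onPos_of_nonpos _ hx) fun x hx => ?_
    rw [opAC', onPos_of_pos _ hx]
    simp only [repC', Matrix.of_apply, Matrix.cons_val', Matrix.cons_val_zero,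
      Matrix.cons_val_fin_one, LinearMap.add_apply, LinearMap.sub_apply, LinearMap.smul_apply,
      Module.End.mul_apply, Module.End.one_apply, Submodule.coe_add, Submodule.coe_sub,
      Submodule.coe_smul, Pi.add_apply, Pi.sub_apply, Pi.smul_apply, smul_eq_mul,
      polyMulX_apply _ hx, polyDeriv_apply _ hx]
    ring
  · rw [repC'_one_zero, Module.End.mul_apply, coe_polyDerivSubOneInv, coe_kummerEnd]
    rfl
  -- The raising factor is `-u`, and a string through a non-integer never meets `0`.
  · refine iff_of_false ?_ (htop _ _)
    obtain ⟨m, -, -, rfl⟩ := hu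
    intro h
    refine hu₀ (-m) ?_
    push_cast
    exact eq_neg_of_add_eq_zero_left h

/-! ### The representation of type C'' and its strings -/

/-- The operator `∂` on rapidly decaying functions. -/
def rapidDeriv : Module.End ℂ rapidDecaySpace :=
  derivEnd isGrowthClass_rapidlyDecaying mem_rapidDecaySpace

/-- Multiplication by `x` on rapidly decaying functions. -/
def rapidMulX : Module.End ℂ rapidDecaySpace :=
  mulEnd isGrowthClass_rapidlyDecaying mem_rapidDecaySpace stable_id

/-- Multiplication by `x⁻¹` on rapidly decaying functions. -/
def rapidMulInv : Module.End ℂ rapidDecaySpace :=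
  mulEnd isGrowthClass_rapidlyDecaying mem_rapidDecaySpace stable_inv

theorem rapidDeriv_apply (f : rapidDecaySpace) {x : ℝ} (hx : 0 < x) :
    (rapidDeriv f : ℝ → ℂ) x = deriv f x := derivEnd_apply _ _ f hx

theorem rapidMulX_apply (f : rapidDecaySpace) {x : ℝ} (hx : 0 < x) :
    (rapidMulX f : ℝ → ℂ) x = x * (f : ℝ → ℂ) x := mulEnd_id_apply _ _ f hx

theorem rapidMulInv_apply (f : rapidDecaySpace) {x : ℝ} (hx : 0 < x) :
    (rapidMulInv f : ℝ → ℂ) x = (x : ℂ)⁻¹ * (f : ℝ → ℂ) x := mulEnd_inv_apply _ _ f hx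

theorem rapidDeriv_rapidMulX (f : rapidDecaySpace) :
    rapidDeriv (rapidMulX f) = rapidMulX (rapidDeriv f) + f :=
  congr($(derivEnd_mul_mulEnd_id isGrowthClass_rapidlyDecaying mem_rapidDecaySpace) f)

theorem rapidMulX_rapidMulInv (f : rapidDecaySpace) : rapidMulX (rapidMulInv f) = f :=
  congr($(mulEnd_id_mul_mulEnd_inv isGrowthClass_rapidlyDecaying mem_rapidDecaySpace) f)

theorem rapidMulInv_rapidMulX (f : rapidDecaySpace) : rapidMulInv (rapidMulX f) = f :=
  congr($(mulEnd_inv_mul_mulEnd_id isGrowthClass_rapidlyDecaying mem_rapidDecaySpace) f)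

theorem rapidMulX_rapidDeriv_rapidMulInv (f : rapidDecaySpace) :
    rapidMulX (rapidDeriv (rapidMulInv f)) = rapidDeriv f - rapidMulInv f := by
  have h := rapidDeriv_rapidMulX (rapidMulInv f)
  rw [rapidMulX_rapidMulInv] at h
  rw [h, add_sub_cancel_right]

theorem rapidDecaySpace_ext {f g : rapidDecaySpace}
    (h : ∀ x, 0 < x → (f : ℝ → ℂ) x = (g : ℝ → ℂ) x) : f = g :=
  eq_of_eqOn_pos_of_mem mem_rapidDecaySpace h

theorem bijective_rapidDeriv : Function.Bijective rapidDeriv := by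
  constructor
  · intro f g h
    have h1 : invDeriv (onPos (deriv f)) = invDeriv (onPos (deriv g)) :=
      congr(invDeriv ($h : rapidDecaySpace))
    rw [(invDeriv_spec f.2).2.2, (invDeriv_spec g.2).2.2] at h1
    exact Subtype.ext h1
  · intro f
    exact ⟨⟨invDeriv f, (invDeriv_spec f.2).1⟩, Subtype.ext (invDeriv_spec f.2).2.1⟩

/-- The operator `∂⁻¹`. -/
def rapidDerivInv : Module.End ℂ rapidDecaySpace :=
  (LinearEquiv.ofBijective rapidDeriv bijective_rapidDeriv).symm.toLinearMap

theorem rapidDeriv_rapidDerivInv (f : rapidDecaySpace) : rapidDeriv (rapidDerivInv f) = f :=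
  (LinearEquiv.ofBijective rapidDeriv bijective_rapidDeriv).apply_symm_apply f

theorem rapidDerivInv_rapidDeriv (f : rapidDecaySpace) : rapidDerivInv (rapidDeriv f) = f :=
  (LinearEquiv.ofBijective rapidDeriv bijective_rapidDeriv).symm_apply_apply f

theorem coe_rapidDerivInv (f : rapidDecaySpace) :
    (rapidDerivInv f : ℝ → ℂ) = invDeriv f := by
  rw [← (invDeriv_spec (rapidDerivInv f).2).2.2]
  exact congrArg (fun g : rapidDecaySpace => invDeriv g) (rapidDeriv_rapidDerivInv f)

/-- The operator `x∂² + (2u + 1)∂ - x`. -/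
def besselEnd (u : ℂ) : Module.End ℂ rapidDecaySpace :=
  rapidMulX * rapidDeriv * rapidDeriv + (2 * u + 1) • rapidDeriv - rapidMulX

theorem coe_besselEnd (u : ℂ) (f : rapidDecaySpace) :
    (besselEnd u f : ℝ → ℂ) = diffOpC'' u f := by
  refine eq_of_eqOn_pos (besselEnd u f).2.1 (fun x hx => onPos_of_nonpos _ hx) fun x hx => ?_
  have h := deriv_derivEnd_apply isGrowthClass_rapidlyDecaying mem_rapidDecaySpace f hx
  change deriv (rapidDeriv f : ℝ → ℂ) x = _ at h
  simp only [besselEnd, LinearMap.add_apply, LinearMap.sub_apply, LinearMap.smul_apply,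
    Module.End.mul_apply, Submodule.coe_add, Submodule.coe_sub,
    Submodule.coe_smul, Pi.add_apply, Pi.sub_apply, Pi.smul_apply, smul_eq_mul,
    rapidMulX_apply _ hx, rapidDeriv_apply _ hx, h]
  rw [diffOpC'', onPos_of_pos _ hx]

/-- The representation of type C''. -/
def repC'' (u : ℂ) : Matrix (Fin 2) (Fin 2) (Module.End ℂ rapidDecaySpace) :=
  !![rapidMulX * rapidDeriv + (2 * u) • 1, (2 : ℂ) • (rapidMulInv * rapidDeriv);
    (1 / 2 : ℂ) • (rapidDerivInv * besselEnd 0) + u • 1, rapidMulInv * rapidDeriv]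

/-- The parameter enters `besselEnd u` through `2u∂`, which `(1/2)∂⁻¹` turns into `u`. -/
theorem repC''_one_zero (u : ℂ) :
    repC'' u 1 0 = (1 / 2 : ℂ) • (rapidDerivInv * besselEnd u) := by
  refine LinearMap.ext fun f => ?_
  simp only [repC'', besselEnd, Matrix.of_apply, Matrix.cons_val', Matrix.cons_val_zero,
    Matrix.cons_val_one, Matrix.cons_val_fin_one, LinearMap.add_apply, LinearMap.sub_apply,
    LinearMap.smul_apply, Module.End.mul_apply, Module.End.one_apply, map_add, map_sub, map_smul,
    rapidDerivInv_rapidDeriv]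
  module

theorem injective_rapidMulInv : Function.Injective rapidMulInv :=
  Function.LeftInverse.injective rapidMulX_rapidMulInv

theorem injective_repC''_zero_one (u : ℂ) : Function.Injective (repC'' u 0 1) := by
  intro f g h
  have h1 : (2 : ℂ) • rapidMulInv (rapidDeriv f) = (2 : ℂ) • rapidMulInv (rapidDeriv g) := h
  exact bijective_rapidDeriv.1 (injective_rapidMulInv (smul_right_injective _ two_ne_zero h1))

/-- Here `da = x⁻¹(x∂² + ∂)` while `bk = x⁻¹(x∂² + ∂ - x)`, so `r = 1`; and `b = 2d` gives `α = 2`,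
`s = 0`. -/
theorem repC''_spec : IsQISMIRep repC'' ∧ HasQuantumDet repC'' fun _ => 1 := by
  have hb : (2 : ℂ) • (rapidMulInv * rapidDeriv) =
      (2 : ℂ) • (rapidMulInv * rapidDeriv) - (0 : ℂ) • (1 : Module.End ℂ rapidDecaySpace) := by
    module
  refine isQISMIRep_and_hasQuantumDet (α := 2) (r := 1) (s := 0) (fun u => rfl)
    (injective_repC''_zero_one 0) ?_ ?_ hb fun u => by ring
  · refine LinearMap.ext fun f => ?_
    simp only [LinearMap.sub_apply, LinearMap.smul_apply,
      Module.End.mul_apply, map_add, rapidDeriv_rapidMulX,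
      rapidMulX_rapidDeriv_rapidMulInv, rapidMulInv_rapidMulX]
    module
  · refine LinearMap.ext fun f => ?_
    simp only [besselEnd, LinearMap.add_apply, LinearMap.sub_apply, LinearMap.smul_apply,
      Module.End.mul_apply, Module.End.one_apply, map_add, map_sub, map_smul,
      rapidDeriv_rapidMulX, rapidMulInv_rapidMulX, rapidDeriv_rapidDerivInv]
    module

/-- The integrating factor `x^{2u+1}` has only power growth, so rapid decay of the Wronskian is
enough. -/
theorem besselEnd_ker {u : ℂ} {f g : rapidDecaySpace} (hne : f ≠ 0)
    (hf : besselEnd u f = 0) (hg : besselEnd u g = 0) : ∃ z : ℂ, z • f = g := by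
  have hode : ∀ f : rapidDecaySpace, besselEnd u f = 0 → ∀ x : ℝ, 0 < x →
      x * deriv (deriv f) x + (2 * u + 1) * deriv f x - x * (f : ℝ → ℂ) x = 0 := by
    intro f hf x hx
    have h := congrFun (coe_besselEnd u f) x
    rw [diffOpC'', onPos_of_pos _ hx, hf] at h
    exact h.symm
  have key := exists_smul_eq_of_ode (f := f) (g := g)
    (m := fun x : ℝ => (x : ℂ) ^ (2 * u + 1))
    (P := fun x => (2 * u + 1) / x) f.2.2.1 g.2.2.1 f.2.1 g.2.1
    (fun h => hne (Subtype.ext h)) (fun x hx => ?_)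
    (fun x hx => hasDerivAt_ofReal_cpow (2 * u + 1) hx) (fun x hx => ?_) ?_
  · obtain ⟨z, hz⟩ := key
    exact ⟨z, Subtype.ext hz⟩
  · have hx' : (x : ℂ) ≠ 0 := by exact_mod_cast hx.ne'
    simp [Complex.cpow_eq_zero_iff, hx']
  · have hx' : (x : ℂ) ≠ 0 := by exact_mod_cast hx.ne'
    refine mul_left_cancel₀ hx' ?_
    field_simp
    linear_combination (g : ℝ → ℂ) x * hode f hf x hx - (f : ℝ → ℂ) x * hode g hg x hx
  · have hG := isGrowthClass_rapidlyDecaying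
    have hf' := (mem_rapidDecaySpace _).1 f.2
    have hg' := (mem_rapidDecaySpace _).1 g.2
    have hpoly : ∀ h : ℝ → ℂ, RapidlyDecaying h → PolyBounded h := fun h hh =>
      ⟨0, by simpa using (hh 0).isBigO_one ℝ⟩
    have h1 := hG.add (hG.mul (hpoly _ hf'.growth_deriv) hg'.growth)
      (hG.mul (polyBounded_const (-1)) (hG.mul (hpoly _ hf'.growth) hg'.growth_deriv))
    refine ((hG.mul (polyBounded_cpow (2 * u + 1)) h1) 0).congr fun x => ?_
    ring

/-- `x^{-u} K_u(x)` as an element of the space of rapidly decaying functions. -/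
def macdonaldFun (u : ℂ) : rapidDecaySpace :=
  ⟨onPos fun x => (x : ℂ) ^ (-u) * macdonaldK u x, by
    have h : (onPos fun x => (x : ℂ) ^ (-u) * macdonaldK u x) =
        (1 / 2 * ((1 / 2 : ℝ) : ℂ) ^ u) • onPos fun x => macdonaldIntegral u (x ^ 2 / 4) := by
      refine eq_of_eqOn_pos (fun x hx => onPos_of_nonpos _ hx)
        (fun x hx => by simp [onPos_of_nonpos _ hx]) fun x hx => ?_
      rw [onPos_of_pos _ hx, cpow_neg_mul_macdonaldK u hx, Pi.smul_apply, onPos_of_pos _ hx,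
        smul_eq_mul]
    rw [h]
    exact rapidDecaySpace.smul_mem _ (stable_macdonaldIntegral u)⟩

theorem macdonaldFun_apply (u : ℂ) {x : ℝ} (hx : 0 < x) :
    (macdonaldFun u : ℝ → ℂ) x =
      1 / 2 * ((1 / 2 : ℝ) : ℂ) ^ u * macdonaldIntegral u (x ^ 2 / 4) := by
  rw [← cpow_neg_mul_macdonaldK u hx]
  exact onPos_of_pos (fun x => (x : ℂ) ^ (-u) * macdonaldK u x) hx

theorem half_cpow_add_one (u : ℂ) :
    ((1 / 2 : ℝ) : ℂ) ^ (u + 1) = ((1 / 2 : ℝ) : ℂ) ^ u * (1 / 2) := by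
  rw [Complex.cpow_add _ _ (by norm_num), Complex.cpow_one]
  norm_num

theorem deriv_macdonaldFun (u : ℂ) {x : ℝ} (hx : 0 < x) :
    deriv (macdonaldFun u : ℝ → ℂ) x = -(x * (macdonaldFun (u + 1) : ℝ → ℂ) x) := by
  have h : (macdonaldFun u : ℝ → ℂ) =ᶠ[𝓝 x]
      fun x => 1 / 2 * ((1 / 2 : ℝ) : ℂ) ^ u * macdonaldIntegral u (x ^ 2 / 4) := by
    filter_upwards [Ioi_mem_nhds hx] with y hy using macdonaldFun_apply u hy
  rw [h.deriv_eq, ((hasDerivAt_macdonaldIntegral_sq u hx).const_mul _).deriv,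
    macdonaldFun_apply _ hx, half_cpow_add_one]
  ring

theorem raise_macdonaldFun (u : ℂ) :
    rapidMulInv (rapidDeriv (macdonaldFun u)) = -macdonaldFun (u + 1) := by
  refine rapidDecaySpace_ext fun x hx => ?_
  have hx' : (x : ℂ) ≠ 0 := by exact_mod_cast hx.ne'
  rw [rapidMulInv_apply _ hx, rapidDeriv_apply _ hx, deriv_macdonaldFun u hx, Submodule.coe_neg,
    Pi.neg_apply, mul_neg, inv_mul_cancel_left₀ hx']

/-- This is `macdonaldIntegral_recurrence` at `x²/4`, with powers of `1/2` absorbed by the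
normalisation. -/
theorem lower_macdonaldFun (u : ℂ) :
    rapidMulX (rapidDeriv (macdonaldFun u)) + (2 * u) • macdonaldFun u = -macdonaldFun (u - 1) := by
  refine rapidDecaySpace_ext fun x hx => ?_
  have h := macdonaldIntegral_recurrence u (x := x ^ 2 / 4) (by positivity)
  have h1 := half_cpow_add_one (u - 1)
  rw [sub_add_cancel] at h1
  simp only [Submodule.coe_add, Submodule.coe_neg, Submodule.coe_smul, Pi.add_apply,
    Pi.neg_apply, Pi.smul_apply, smul_eq_mul, rapidMulX_apply _ hx, rapidDeriv_apply _ hx,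
    deriv_macdonaldFun u hx, macdonaldFun_apply _ hx, half_cpow_add_one, h1]
  push_cast at h ⊢
  linear_combination -(1 / 2) * ((1 / 2 : ℂ) ^ (u - 1)) * h

theorem macdonaldFun_ne_zero (u : ℂ) : macdonaldFun u ≠ 0 := by
  obtain ⟨n, hn⟩ := exists_nat_gt (-u.re)
  induction n generalizing u with
  | zero =>
    have hu : 0 < u.re := by
      rw [Nat.cast_zero] at hn
      linarith
    obtain ⟨z, hz, hne⟩ := exists_macdonaldIntegral_ne_zero hu
    intro h
    -- The point is chosen so that `x²/4 = z`.
    have h1 := macdonaldFun_apply u (x := 2 * √z) (by positivity)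
    rw [h, mul_pow, Real.sq_sqrt hz.le, show (2 : ℝ) ^ 2 * z / 4 = z by ring] at h1
    refine mul_ne_zero (mul_ne_zero (by norm_num) ?_) hne h1.symm
    simp [Complex.cpow_eq_zero_iff]
  | succ n ih =>
    intro h
    have h1 := raise_macdonaldFun u
    rw [h, map_zero, map_zero] at h1
    refine ih (u + 1) ?_ (neg_eq_zero.1 h1.symm)
    rw [Complex.add_re, Complex.one_re]
    push_cast at hn
    linarith

theorem repC''_string (u₀ : ℂ) :
    StringConditions repC'' u₀ ⊥ ⊤ macdonaldFun ∧
      StringShifts repC'' u₀ ⊥ ⊤ macdonaldFun (fun _ => -1) (fun _ => -1) := by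
  have htop : ∀ u, ¬ IsHighest u₀ ⊤ u := by
    rintro u ⟨j, hj, -⟩
    exact WithTop.top_ne_coe hj
  refine stringConditions_and_stringShifts repC''_spec.1 repC''_spec.2
    injective_repC''_zero_one macdonaldFun_ne_zero (fun u => ?_) (fun u => ?_)
    (fun u => by ring) (fun u w₁ w₂ hw h1 h2 => ?_) (fun _ => by norm_num)
    (fun u _ => iff_of_false (by norm_num) (htop u)) fun u hu => absurd hu (htop _)
  · rw [neg_one_smul, ← lower_macdonaldFun u]
    rfl
  · rw [neg_one_smul, ← raise_macdonaldFun u]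
    rfl
  · have hinj : Function.Injective rapidDerivInv :=
      (LinearEquiv.ofBijective rapidDeriv bijective_rapidDeriv).symm.injective
    have hker : ∀ w, repC'' u 1 0 w = 0 → besselEnd u w = 0 := by
      intro w h
      rw [repC''_one_zero, LinearMap.smul_apply, smul_eq_zero] at h
      exact hinj ((h.resolve_left (by norm_num)).trans (map_zero _).symm)
    exact besselEnd_ker hw (hker _ h1) (hker _ h2)

theorem typeC'' :
    (∀ u : ℂ, ∀ f ∈ rapidDecaySpace, diffOpC'' u f ∈ rapidDecaySpace) ∧
    ∃ T : ℂ → Matrix (Fin 2) (Fin 2) (Module.End ℂ rapidDecaySpace),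
    ∃ F : ℂ → rapidDecaySpace,
      (∀ (u : ℂ) (f : rapidDecaySpace),
        (T u 0 0 f : ℝ → ℂ) = opAC'' u f ∧ (T u 0 1 f : ℝ → ℂ) = opBC'' f ∧
        (T u 1 0 f : ℝ → ℂ) = opCC'' u f ∧ (T u 1 1 f : ℝ → ℂ) = opDC'' f) ∧
      (∀ u : ℂ, Function.Injective (T u 0 1)) ∧
      IsQISMIRep T ∧
      HasQuantumDet T (fun _ => 1) ∧
      (∀ u : ℂ, (F u : ℝ → ℂ) = onPos fun x => (x : ℂ) ^ (-u) * macdonaldK u x) ∧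
      ∀ u₀ : ℂ,
        StringConditions T u₀ ⊥ ⊤ F ∧
        StringShifts T u₀ ⊥ ⊤ F (fun _ => -1) (fun _ => -1) := by
  refine ⟨fun u f hf => ?_, repC'', macdonaldFun, fun u f => ⟨?_, ?_, ?_, ?_⟩,
    injective_repC''_zero_one, repC''_spec.1, repC''_spec.2, fun _ => rfl, repC''_string⟩
  · have h := coe_besselEnd u ⟨f, hf⟩
    rw [← h]
    exact Subtype.mem _
  · refine eq_of_eqOn_pos (repC'' u 0 0 f).2.1 (fun x hx => onPos_of_nonpos _ hx) fun x hx => ?_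
    have h : repC'' u 0 0 f = rapidMulX (rapidDeriv f) + (2 * u) • f := rfl
    rw [opAC'', onPos_of_pos _ hx, h]
    simp only [Submodule.coe_add, Submodule.coe_smul, Pi.add_apply, Pi.smul_apply, smul_eq_mul,
      rapidMulX_apply _ hx, rapidDeriv_apply _ hx]
  · refine eq_of_eqOn_pos (repC'' u 0 1 f).2.1 (fun x hx => onPos_of_nonpos _ hx) fun x hx => ?_
    have h : repC'' u 0 1 f = (2 : ℂ) • rapidMulInv (rapidDeriv f) := rfl
    rw [opBC'', onPos_of_pos _ hx, h]
    simp only [Submodule.coe_smul, Pi.smul_apply, smul_eq_mul,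
      rapidMulInv_apply _ hx, rapidDeriv_apply _ hx]
    ring
  · rw [repC''_one_zero, LinearMap.smul_apply, Submodule.coe_smul, Module.End.mul_apply,
      coe_rapidDerivInv, coe_besselEnd]
    rfl
  · refine eq_of_eqOn_pos (repC'' u 1 1 f).2.1 (fun x hx => onPos_of_nonpos _ hx) fun x hx => ?_
    have h : repC'' u 1 1 f = rapidMulInv (rapidDeriv f) := rfl
    rw [opDC'', onPos_of_pos _ hx, h, rapidMulInv_apply _ hx, rapidDeriv_apply _ hx]

end

theorem mainTheorem8 :
    -- Type C'
    ((∀ f ∈ polyGrowthSpace,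
        (∀ x : ℝ, 0 < x → IntegrableOn (fun y : ℝ => Complex.exp (-y) * f y) (Ioi x)) ∧
        invDerivSubOne f ∈ polyGrowthSpace ∧
        opBC' (invDerivSubOne f) = f ∧ invDerivSubOne (opBC' f) = f) ∧
      ∀ c : ℂ,
        (∀ u : ℂ, ∀ f ∈ polyGrowthSpace, diffOpC' c u f ∈ polyGrowthSpace) ∧
        ∃ T : ℂ → Matrix (Fin 2) (Fin 2) (Module.End ℂ polyGrowthSpace),
        ∃ F : ℂ → polyGrowthSpace,
          (∀ (u : ℂ) (f : polyGrowthSpace),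
            (T u 0 0 f : ℝ → ℂ) = opAC' c u f ∧ (T u 0 1 f : ℝ → ℂ) = opBC' f ∧
            (T u 1 0 f : ℝ → ℂ) = opCC' c u f ∧ (T u 1 1 f : ℝ → ℂ) = opDC' f) ∧
          (∀ u : ℂ, Function.Injective (T u 0 1)) ∧
          IsQISMIRep T ∧
          HasQuantumDet T (fun u => u - 1 / 2) ∧
          (∀ u : ℂ, (F u : ℝ → ℂ) = onPos (tricomiPsi u (c + u))) ∧
          (∀ u₀ : ℂ, (∀ m : ℤ, u₀ ≠ m) →
            StringConditions T u₀ ⊥ ⊤ F ∧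
            StringShifts T u₀ ⊥ ⊤ F (fun u => -(u - 1 / 2)) (fun _ => -1)) ∧
          -- the string `{0, -1, -2, …}`
          StringConditions T 0 ⊥ ((1 : ℤ) : WithTop ℤ) F ∧
          StringShifts T 0 ⊥ ((1 : ℤ) : WithTop ℤ) F (fun u => -(u - 1 / 2)) (fun _ => -1) ∧
          ∀ (n : ℕ) (x : ℝ), 0 < x →
            (F (-n) : ℝ → ℂ) x = (-1) ^ n * (n.factorial : ℂ) * laguerreL n (c - n - 1) x) ∧
    -- Type C''
    ((∀ f ∈ rapidDecaySpace,
        (∀ x : ℝ, 0 < x → IntegrableOn f (Ioi x)) ∧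
        invDeriv f ∈ rapidDecaySpace ∧
        onPos (deriv (invDeriv f)) = f ∧ invDeriv (onPos (deriv f)) = f) ∧
      (∀ u : ℂ, ∀ f ∈ rapidDecaySpace, diffOpC'' u f ∈ rapidDecaySpace) ∧
      ∃ T : ℂ → Matrix (Fin 2) (Fin 2) (Module.End ℂ rapidDecaySpace),
      ∃ F : ℂ → rapidDecaySpace,
        (∀ (u : ℂ) (f : rapidDecaySpace),
          (T u 0 0 f : ℝ → ℂ) = opAC'' u f ∧ (T u 0 1 f : ℝ → ℂ) = opBC'' f ∧
          (T u 1 0 f : ℝ → ℂ) = opCC'' u f ∧ (T u 1 1 f : ℝ → ℂ) = opDC'' f) ∧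
        (∀ u : ℂ, Function.Injective (T u 0 1)) ∧
        IsQISMIRep T ∧
        HasQuantumDet T (fun _ => 1) ∧
        (∀ u : ℂ, (F u : ℝ → ℂ) = onPos fun x => (x : ℂ) ^ (-u) * macdonaldK u x) ∧
        ∀ u₀ : ℂ,
          StringConditions T u₀ ⊥ ⊤ F ∧
          StringShifts T u₀ ⊥ ⊤ F (fun _ => -1) (fun _ => -1)) := by
  refine ⟨⟨fun f hf => ⟨fun x hx => Stable.integrableOn_exp_mul hf hx, invDerivSubOne_spec hf⟩,
    typeC'⟩, fun f hf => ⟨fun x hx => ?_, invDeriv_spec hf⟩, typeC''⟩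
  exact integrableOn_of_rapidlyDecaying hf.2.1.continuousOn (Stable.growth hf) hx
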